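/- Let $E$ be a real $d\times d$ matrix, $d\ge 1$, all of whose eigenvalues have positive real part; let $0<a_1<\dots<a_p$ be the distinct real parts of its eigenvalues and $q=\operatorname{trace}(E)$. Write $c^E=\exp(E\log c)$ for $c>0$. A function $f:\mathbb R^d\to[0,\infty)$ is called $E$-homogeneous if $f(c^Ex)=c\,f(x)$ for all $c>0$ and $x\ne0$. Fix a norm $\|\cdot\|_0$ on $\mathbb R^d$ such that $t\mapsto\|t^Ex\|_0$ is strictly increasing on $(0,\infty)$ for every $x\neq 0$; let $\tau(x)$, for $x\ne0$, be the unique $t>0$ with $\|t^{-E}x\|_0=1$, and $\tau(0)=0$. For $\beta>0$, a continuous function $\varphi:\mathbb R^d\to[0,\infty)$ is $(\beta,E)$-admissible if $\varphi(x)>0$ for $x\ne0$ and for all $0<A<B$ there is $C>0$ such that $|\varphi(x+y)-\varphi(y)|\le C\,\tau(x)^\beta$ whenever $A\le\|y\|\le B$ and $\tau(x)\le1$. Let $Z$ be an independently scattered, centred real Gaussian random measure on $\mathbb R^d$, and $W$ an independently scattered isotropic centred complex Gaussian random measure on $\mathbb R^d$, each with control measure a positive constant multiple of Lebesgue measure (that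 is, symmetric $2$-stable random measures, with any fixed normalisation). (i) Let $\beta>0$, let $\varphi$ be $E$-homogeneous and $(\beta,E)$-admissible, and let $0<H<\beta$; if $d=1$, assume also $H\ne q/2$. Let $$X_\varphi(x)=\int_{\mathbb R^d}\bigl(\varphi(x-y)^{H-q/2}-\varphi(-y)^{H-q/2}\bigr)\,Z(dy),\qquad x\in\mathbb R^d .$$ (ii) Let $\psi:\mathbb R^d\to[0,\infty)$ be continuous and $E^t$-homogeneous with $\psi(x)>0$ for $x\ne0$, and let $0<H<a_1$. Let $$X_\psi(x)=\operatorname{Re}\int_{\mathbb R^d}\bigl(e^{i\langle x,\xi\rangle}-1\bigr)\psi(\xi)^{-H-q/2}\,W(d\xi),\qquad x\in\mathbb R^d .$$ Let $K\subset\mathbb R^d$ be a compact set of positive Lebesgue measure. Let $X$ be any version of $X_\varphi$ in case (i), or of $X_\psi$ in case (ii), whose sample paths are almost surely continuous. Then, almost surely, the box dimension of the graph $\mathcal G(X)=\{(x,X(x)):x\in K\}\subset\mathbb R^{d+1}$ exists and $$\dim_{\mathcal H}\mathcal G(X)=\dim_{\mathcal B}\mathcal G(X)=d+1-\frac{H}{a_p}.$$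 -/

import Mathlib

open MeasureTheory Filter Topology
open scoped NNReal ENNReal

noncomputable section

namespace OperatorScaling

/-- The operator `c ^ E = exp (E log c)` on `ℝ^d`, applied to the vector `x` (used for `c > 0`). -/
def matPow {d : ℕ} (E : Matrix (Fin d) (Fin d) ℝ) (c : ℝ) (x : EuclideanSpace ℝ (Fin d)) :
    EuclideanSpace ℝ (Fin d) :=
  Matrix.toEuclideanLin (NormedSpace.exp (Real.log c • E)) x

/-- The set of the real parts of the (complex) eigenvalues of a real square matrix. -/
def realSpectrum {d : ℕ} (E : Matrix (Fin d) (Fin d) ℝ) : Set ℝ :=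
  Complex.re '' spectrum ℂ (E.map (algebraMap ℝ ℂ))

/-! ### Polar coordinates, homogeneous and admissible functions -/

/-- `N` is a norm on `ℝ^d` such that `t ↦ N (t ^ E x)` is strictly increasing on `(0, ∞)` for every
`x ≠ 0`. When the eigenvalues of `E` have positive real parts, such norms exist, and
`(r, θ) ↦ r ^ E θ` is then a homeomorphism from `(0, ∞) × {N = 1}` onto `ℝ^d \ {0}`. -/
structure IsAdaptedNorm {d : ℕ} (E : Matrix (Fin d) (Fin d) ℝ)
    (N : Seminorm ℝ (EuclideanSpace ℝ (Fin d))) : Prop where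
  eq_zero_of_apply_eq_zero : ∀ x, N x = 0 → x = 0
  strictMonoOn : ∀ x, x ≠ 0 → StrictMonoOn (fun t : ℝ => N (matPow E t x)) (Set.Ioi 0)

/-- The radial part `τ(x)`: for `x ≠ 0` the unique `t > 0` with `x = t ^ E l`, `N l = 1`, that is
with `N (t ^ (-E) x) = 1` (the set below is then a singleton); `τ(0) = 0` (the set is empty). -/
def radialPart {d : ℕ} (E : Matrix (Fin d) (Fin d) ℝ)
    (N : Seminorm ℝ (EuclideanSpace ℝ (Fin d))) (x : EuclideanSpace ℝ (Fin d)) : ℝ :=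
  sInf {t : ℝ | 0 < t ∧ N (matPow E t⁻¹ x) = 1}

/-- `φ` is `E`-homogeneous. -/
def IsHomogeneous {d : ℕ} (E : Matrix (Fin d) (Fin d) ℝ)
    (φ : EuclideanSpace ℝ (Fin d) → ℝ) : Prop :=
  ∀ c : ℝ, 0 < c → ∀ x, x ≠ 0 → φ (matPow E c x) = c * φ x

/-- `φ` is a continuous function to `[0, ∞)` which is positive off the origin. -/
structure IsContinuousPositive {d : ℕ} (φ : EuclideanSpace ℝ (Fin d) → ℝ) : Prop where
  continuous : Continuous φ
  nonneg : ∀ x, 0 ≤ φ x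
  pos : ∀ x, x ≠ 0 → 0 < φ x

/-- `φ` is `(β, E)`-admissible, the radial part being taken with respect to the norm `N`. -/
structure IsAdmissible {d : ℕ} (β : ℝ) (E : Matrix (Fin d) (Fin d) ℝ)
    (N : Seminorm ℝ (EuclideanSpace ℝ (Fin d))) (φ : EuclideanSpace ℝ (Fin d) → ℝ) : Prop
    extends IsContinuousPositive φ where
  bound : ∀ A B : ℝ, 0 < A → A < B → ∃ C : ℝ, 0 < C ∧
    ∀ x y : EuclideanSpace ℝ (Fin d), A ≤ ‖y‖ → ‖y‖ ≤ B → radialPart E N x ≤ 1 →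
      |φ (x + y) - φ y| ≤ C * radialPart E N x ^ β

/-! ### Stable random measures and their integrals -/

/-- `Z` is an independently scattered symmetric `α`-stable random measure on `ℝ^d` with Lebesgue
control measure, with values in `𝕜 = ℝ` (real case) or `𝕜 = ℂ` (complex isotropic case). Only the
values of `Z` on measurable sets of finite Lebesgue measure matter. The constant `κ > 0` is the
normalisation: the characteristic function of `Z A` is `t ↦ exp (-κ |t|^α λ(A))`, so that for
`α = 2` each `Z A` is a centred Gaussian variable (in the complex case its real and imaginary parts
are independent centred Gaussian variables) with variance `2 κ λ(A)` (for each of the parts). -/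
structure IsStableRandomMeasure {𝕜 : Type*} [RCLike 𝕜] [MeasurableSpace 𝕜] {d : ℕ}
    {Ω : Type*} [MeasurableSpace Ω] (α κ : ℝ) (P : Measure Ω)
    (Z : Set (EuclideanSpace ℝ (Fin d)) → Ω → 𝕜) : Prop where
  aemeasurable : ∀ A, MeasurableSet A → volume A ≠ ∞ → AEMeasurable (Z A) P
  charFun_eq : ∀ A, MeasurableSet A → volume A ≠ ∞ → ∀ t : 𝕜,
    ∫ ω, Complex.exp (Complex.I * ((RCLike.re (star t * Z A ω) : ℝ) : ℂ)) ∂P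
      = Complex.exp (-((κ * ‖t‖ ^ α * volume.real A : ℝ) : ℂ))
  indep : ∀ (n : ℕ) (A : Fin n → Set (EuclideanSpace ℝ (Fin d))),
    (∀ i, MeasurableSet (A i)) → (∀ i, volume (A i) ≠ ∞) → Pairwise (Function.onFun Disjoint A) →
      ProbabilityTheory.iIndepFun (fun i => Z (A i)) P
  sigma_additive : ∀ A : ℕ → Set (EuclideanSpace ℝ (Fin d)),
    (∀ i, MeasurableSet (A i)) → volume (⋃ i, A i) ≠ ∞ → Pairwise (Function.onFun Disjoint A) →
      ∀ᵐ ω ∂P, Tendsto (fun n => ∑ i ∈ Finset.range n, Z (A i) ω) atTop (𝓝 (Z (⋃ i, A i) ω))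

/-- The integral of a simple function: `∑ c Z({s = c})`, the sum over the values `c` of `s`. -/
def simpleStochIntegral {𝕜 : Type*} [RCLike 𝕜] {d : ℕ} {Ω : Type*}
    (Z : Set (EuclideanSpace ℝ (Fin d)) → Ω → 𝕜)
    (s : SimpleFunc (EuclideanSpace ℝ (Fin d)) 𝕜) (ω : Ω) : 𝕜 :=
  ∑ c ∈ s.range, c * Z (s ⁻¹' {c}) ω

/-- `Y` is (a version of) the stochastic integral `∫ f dZ` of `f ∈ L^α(ℝ^d)`: the limit in
probability of the integrals of simple functions which converge to `f` in `L^α(ℝ^d)`. -/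
def IsStochIntegral {𝕜 : Type*} [RCLike 𝕜] {d : ℕ} {Ω : Type*} [MeasurableSpace Ω] (α : ℝ)
    (P : Measure Ω) (Z : Set (EuclideanSpace ℝ (Fin d)) → Ω → 𝕜)
    (f : EuclideanSpace ℝ (Fin d) → 𝕜) (Y : Ω → 𝕜) : Prop :=
  MemLp f (ENNReal.ofReal α) volume ∧
  ∃ s : ℕ → SimpleFunc (EuclideanSpace ℝ (Fin d)) 𝕜,
    (∀ n, MemLp (s n) (ENNReal.ofReal α) volume) ∧
    Tendsto (fun n => eLpNorm (fun y => s n y - f y) (ENNReal.ofReal α) volume) atTop (𝓝 0) ∧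
    TendstoInMeasure P (fun n => simpleStochIntegral Z (s n)) atTop Y

/-- `X` is (a version of) the moving average field
`X_φ(x) = ∫ (φ(x - y)^(H - q/α) - φ(-y)^(H - q/α)) Z(dy)`, where `q = trace E`. -/
def IsMovingAverageField {d : ℕ} {Ω : Type*} [MeasurableSpace Ω] (α H : ℝ)
    (E : Matrix (Fin d) (Fin d) ℝ) (φ : EuclideanSpace ℝ (Fin d) → ℝ) (P : Measure Ω)
    (Z : Set (EuclideanSpace ℝ (Fin d)) → Ω → ℝ) (X : EuclideanSpace ℝ (Fin d) → Ω → ℝ) : Prop :=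
  ∀ x, IsStochIntegral α P Z
    (fun y => φ (x - y) ^ (H - E.trace / α) - φ (-y) ^ (H - E.trace / α)) (X x)

/-- `X` is (a version of) the harmonizable field
`X_ψ(x) = Re ∫ (e^{i⟨x, ξ⟩} - 1) ψ(ξ)^(-H - q/α) W(dξ)`, where `q = trace E`. -/
def IsHarmonizableField {d : ℕ} {Ω : Type*} [MeasurableSpace Ω] (α H : ℝ)
    (E : Matrix (Fin d) (Fin d) ℝ) (ψ : EuclideanSpace ℝ (Fin d) → ℝ) (P : Measure Ω)
    (W : Set (EuclideanSpace ℝ (Fin d)) → Ω → ℂ) (X : EuclideanSpace ℝ (Fin d) → Ω → ℝ) : Prop :=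
  ∀ x, ∃ Y : Ω → ℂ, IsStochIntegral α P W
      (fun ξ => (Complex.exp (Complex.I * ((inner ℝ x ξ : ℝ) : ℂ)) - 1)
        * ((ψ ξ ^ (-H - E.trace / α) : ℝ) : ℂ)) Y ∧
    X x =ᵐ[P] fun ω => (Y ω).re

/-! ### Graphs and box dimension -/

/-- The graph of the function `f` over the set `K`. The product carries the maximum metric, which
is bi-Lipschitz equivalent to the Euclidean metric of `ℝ^(d+1)`, so that the Hausdorff and box
dimensions are the Euclidean ones. -/
def graphOver {d : ℕ} (K : Set (EuclideanSpace ℝ (Fin d))) (f : EuclideanSpace ℝ (Fin d) → ℝ) :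
    Set (EuclideanSpace ℝ (Fin d) × ℝ) :=
  (fun x => (x, f x)) '' K

/-- The nonempty totally bounded set `F` has a box dimension (its lower and upper box dimensions
agree), and this dimension is `D`: `log N_ε(F) / (-log ε) → D` as `ε → 0+`, where `N_ε(F)` is the
least number of closed balls of radius `ε` that cover `F`. -/
def HasBoxDim {M : Type*} [PseudoMetricSpace M] (F : Set M) (D : ℝ) : Prop :=
  F.Nonempty ∧ TotallyBounded F ∧
  Tendsto (fun ε : ℝ≥0 =>
      Real.log ((Metric.externalCoveringNumber ε F).toNat : ℝ) / (-Real.log (ε : ℝ)))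
    (𝓝[>] 0) (𝓝 D)

end OperatorScaling

end

open MeasureTheory Filter Topology ProbabilityTheory
open scoped NNReal ENNReal

noncomputable section

namespace OperatorScaling

/-! In both cases the increment X(x) - X(y) is centred Gaussian with standard deviation n(x - y),
where n(h) = √(2κ) ‖f_h - f_0‖ in L² and f_x is the kernel of the field. The proof uses nothing
about X beyond these one-dimensional laws and path continuity. The function n is even, subadditive,
lower semicontinuous, positive off the origin, and satisfies n(exp(sE) x) = exp(Hs) n(x); this is
`IsVariogram`, and the whole dimension count (`ae_dim_graphOver_of_isVariogram`) is carried out for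
such an n.

Upper bound. Since exp(sE) grows more slowly than exp(bs) for every b > a_p, the scaling of n gives
n(h) ≤ C‖h‖^γ near 0 for every γ < H/a_p (`IsVariogram.exists_le_rpow`). Gaussian moments and
chaining along dyadic nets then bound the oscillation of X at scale 2^(-k) by a multiple of
2^(-kγ'), for any γ' < γ (`ae_exists_abs_sub_net_le`), and counting boxes over the net shows that
the upper box dimension is at most d + 1 - γ'.

Lower bound. A left eigenvector of E for an eigenvalue of real part a_p yields a vector u ≠ 0 with
n(h) ≥ c |⟨u,h⟩|^(H/a_p) (`IsVariogram.exists_rpow_inner_le`). As the Gaussian density is at most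
1/n, the mean of max(‖x-y‖, |X(x)-X(y)|)^(-s) is at most a constant times ‖x-y‖^(1-s)
|⟨u,x-y⟩|^(-H/a_p). Because H/a_p < 1, this is locally integrable for 1 < s < d + 1 - H/a_p. The
s-energy of Lebesgue measure lifted to the graph is therefore almost surely finite, and
`le_dimH_of_energy_ne_top` bounds the Hausdorff dimension from below. The Hausdorff dimension never
exceeds the lower box dimension, so the two bounds determine every dimension.

The inequality H < a_p, assumed through a_1 in the harmonizable case, follows for moving averages
from β ≤ a_1 (`IsAdmissible.le_of_isLeast`). Square integrability of the kernels is part of what it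
means for the stochastic integral to exist. -/

/-! ### Matrix exponentials: determinant and growth -/

open scoped Matrix.Norms.Operator in
theorem hasDerivAt_matrix_exp {m : Type*} [Fintype m] [DecidableEq m] (A : Matrix m m ℝ) (i j : m) :
    HasDerivAt (fun s : ℝ => NormedSpace.exp (s • A) i j) (A i j) 0 := by
  have h := hasDerivAt_exp_smul_const (𝕂 := ℝ) A (0:ℝ)
  have h2 := ((Matrix.entryLinearMap ℝ ℝ i j).toContinuousLinearMap.hasFDerivAt).comp_hasDerivAt (0:ℝ) h
  have h3 : A i j = (Matrix.entryLinearMap ℝ ℝ i j).toContinuousLinearMap (NormedSpace.exp ((0:ℝ) • A) * A) := by simp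
  rw [h3]
  exact h2

/-- By the Leibniz formula the derivative at 0 depends only on the values and first derivatives of
the entries there. So M may be replaced by 1 + sA, whose determinant is 1 + s tr A + O(s²). -/
theorem hasDerivAt_det_of_entries {m : Type*} [Fintype m] [DecidableEq m] {M : ℝ → Matrix m m ℝ} {A : Matrix m m ℝ} (hM : ∀ i j, HasDerivAt (fun s => M s i j) (A i j) 0) (h0 : M 0 = 1) :
   HasDerivAt (fun s => (M s).det) A.trace 0 := by
  have key : ∀ N : ℝ → Matrix m m ℝ, (∀ i j, HasDerivAt (fun s => N s i j) (A i j) 0) → N 0 = 1 → HasDerivAt (fun s => (N s).det) (∑ σ : Equiv.Perm m, ((Equiv.Perm.sign σ : ℤ) : ℝ) * ∑ i, (∏ j ∈ Finset.univ.erase i, (1 : Matrix m m ℝ) (σ j) j) • A (σ i) i) 0 := by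
    intro N hN hN0
    simp_rw [Matrix.det_apply']
    refine HasDerivAt.fun_sum fun σ _ => HasDerivAt.const_mul _ ?_
    have := HasDerivAt.fun_finsetProd (u := Finset.univ) (f := fun i s => N s (σ i) i) (x := (0:ℝ)) (fun i _ => hN (σ i) i)
    simpa only [hN0] using this
  have h1 := key M hM h0
  have h2 := key (fun s => 1 + s • A) (fun i j => by
    have : HasDerivAt (fun s : ℝ => (1 : Matrix m m ℝ) i j + s * A i j) (1 * A i j) 0 := ((hasDerivAt_id (0:ℝ)).mul_const _).const_add _
    simpa using this) (by simp)
  have h3 : HasDerivAt (fun s : ℝ => (1 + s • A).det) A.trace 0 := by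
    set p := (Matrix.det (1 + (Polynomial.X : Polynomial ℝ) • A.map Polynomial.C)).divX.divX with hp
    have e : (fun s : ℝ => (1 + s • A).det) = fun s => 1 + A.trace * s + p.eval s * s ^ 2 := funext fun s => Matrix.det_one_add_smul s A
    rw [e]
    have := (((hasDerivAt_id (0:ℝ)).const_mul A.trace).const_add 1).add ((p.hasDerivAt 0).mul (hasDerivAt_pow 2 (0:ℝ)))
    exact this.congr_deriv (by simp)
  rw [h3.unique h2]
  exact h1

theorem matrix_exp_add_smul {𝕜 : Type*} [RCLike 𝕜] {m : Type*} [Fintype m] [DecidableEq m] (A : Matrix m m 𝕜) (s t : 𝕜) : NormedSpace.exp ((s + t) • A) = NormedSpace.exp (s • A) * NormedSpace.exp (t • A) := by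
  rw [add_smul]
  exact Matrix.exp_add_of_commute _ _ (((Commute.refl A).smul_left s).smul_right t)

/-- Multiplicativity propagates the derivative at 0 to the equation D' = tr(A) D, so D(s) exp(-s tr
A) is constant. -/
theorem det_matrix_exp_smul {m : Type*} [Fintype m] [DecidableEq m] (A : Matrix m m ℝ) (s : ℝ) :
    (NormedSpace.exp (s • A)).det = Real.exp (s * A.trace) := by
  have h0 := hasDerivAt_det_of_entries (hasDerivAt_matrix_exp A) (by simp)
  set D : ℝ → ℝ := fun s => (NormedSpace.exp (s • A)).det with hD
  have hadd : ∀ s t, D (s + t) = D s * D t := fun s t => by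
    simp only [hD, matrix_exp_add_smul, Matrix.det_mul]
  have hder : ∀ s, HasDerivAt D (D s * A.trace) s := by
    intro s
    have h1 : HasDerivAt (fun t => D s * D (t - s)) (D s * A.trace) s := by
      refine HasDerivAt.const_mul _ ?_
      have h0' : HasDerivAt D A.trace (s - s) := by simpa using h0
      simpa [Function.comp_def] using HasDerivAt.comp (h₂ := D) (h := fun t => t - s) s h0' ((hasDerivAt_id s).sub_const s)
    refine h1.congr_of_eventuallyEq (Eventually.of_forall fun t => ?_)
    change D t = D s * D (t - s)
    rw [← hadd]; simp
  have hconst : ∀ s, D s * Real.exp (-(s * A.trace)) = D 0 * Real.exp (-(0 * A.trace)) := by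
    intro s
    refine is_const_of_deriv_eq_zero (f := fun s => D s * Real.exp (-(s * A.trace))) ?_ ?_ s 0
    · intro s; exact ((hder s).differentiableAt).mul (by fun_prop)
    · intro s
      have h2 : HasDerivAt (fun s : ℝ => Real.exp (-(s * A.trace))) (Real.exp (-(s * A.trace)) * (-(1 * A.trace))) s :=
        (((hasDerivAt_id s).mul_const A.trace).neg).exp
      refine ((hder s).mul h2).deriv.trans ?_; ring
  have h1 := hconst s
  have hD0 : D 0 = 1 := by simp [hD]
  rw [hD0] at h1
  simp only [zero_mul, neg_zero, Real.exp_zero, mul_one] at h1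
  rw [Real.exp_neg] at h1
  exact (mul_inv_eq_one₀ (Real.exp_ne_zero _)).1 h1

open scoped Matrix.Norms.Operator in
theorem hasSum_matrix_exp {𝕜 : Type*} [RCLike 𝕜] {m : Type*} [Fintype m] [DecidableEq m] (A : Matrix m m 𝕜) :
    HasSum (fun n : ℕ => ((n.factorial : 𝕜)⁻¹) • A ^ n) (NormedSpace.exp A) :=
  NormedSpace.exp_series_hasSum_exp' A

theorem matrix_exp_map {m : Type*} [Fintype m] [DecidableEq m] (A : Matrix m m ℝ) :
    NormedSpace.exp (A.map (algebraMap ℝ ℂ)) = (NormedSpace.exp A).map (algebraMap ℝ ℂ) := by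
  have h := (hasSum_matrix_exp A).map ((algebraMap ℝ ℂ).mapMatrix (m := m))
    (Continuous.matrix_map continuous_id Complex.continuous_ofReal)
  refine (hasSum_matrix_exp _).unique ?_
  convert! h using 1
  funext n
  have e : (A.map (algebraMap ℝ ℂ)) ^ n = (A ^ n).map (algebraMap ℝ ℂ) :=
    (map_pow (algebraMap ℝ ℂ).mapMatrix A n).symm
  rw [e]
  ext i j
  simp

/-- The scalar part sμ commutes with s(A - μ), and on a generalised eigenvector the exponential
series of the latter stops after k terms. -/
theorem matrix_exp_smul_mulVec {m : Type*} [Fintype m] [DecidableEq m] {A : Matrix m m ℂ} {μ : ℂ}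
    {k : ℕ} {v : m → ℂ} (h : ((A - μ • 1) ^ k).mulVec v = 0) (s : ℂ) :
    (NormedSpace.exp (s • A)).mulVec v =
      Complex.exp (s * μ) • ∑ j ∈ Finset.range k,
        (s ^ j / j.factorial) • ((A - μ • 1) ^ j).mulVec v := by
  set N := A - μ • 1 with hN
  have hsplit : s • A = (s * μ) • (1 : Matrix m m ℂ) + s • N := by
    rw [hN, smul_sub, smul_smul]; abel
  have hexp1 : NormedSpace.exp ((s * μ) • (1 : Matrix m m ℂ)) = Complex.exp (s * μ) • 1 := by
    have e : ∀ c : ℂ, c • (1 : Matrix m m ℂ) = Matrix.diagonal (fun _ => c) := fun c => by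
      rw [Matrix.smul_one_eq_diagonal]
    rw [e, e, Matrix.exp_diagonal]
    congr 1
    funext i
    rw [Complex.exp_eq_exp_ℂ]
    exact Pi.coe_exp (fun _ => s * μ) i
  have hcomm : Commute ((s * μ) • (1 : Matrix m m ℂ)) (s • N) :=
    (Commute.one_left _).smul_left _
  rw [hsplit, Matrix.exp_add_of_commute _ _ hcomm, hexp1, smul_mul_assoc, one_mul,
    Matrix.smul_mulVec]
  congr 1
  have hs := (hasSum_matrix_exp (s • N)).map
    (⟨⟨fun M : Matrix m m ℂ => M.mulVec v, Matrix.zero_mulVec v⟩, fun M N => Matrix.add_mulVec M N v⟩ : Matrix m m ℂ →+ (m → ℂ))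
    (Continuous.matrix_mulVec continuous_id continuous_const)
  refine hs.unique ?_
  have hz : ∀ j, j ∉ Finset.range k → (s ^ j / j.factorial) • (N ^ j).mulVec v = 0 := by
    intro j hj
    obtain ⟨l, rfl⟩ := Nat.exists_eq_add_of_le (not_lt.1 (fun hh => hj (Finset.mem_range.2 hh)))
    rw [add_comm k l, pow_add N, ← Matrix.mulVec_mulVec, h, Matrix.mulVec_zero, smul_zero]
  have h3 := hasSum_sum_of_ne_finset_zero (L := SummationFilter.unconditional ℕ) hz
  convert h3 using 1
  funext n
  simp [smul_pow, Matrix.smul_mulVec, smul_smul, div_eq_inv_mul]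

theorem exists_mulVec_eq_smul_of_mem_spectrum {m : Type*} [Fintype m] [DecidableEq m]
    {A : Matrix m m ℂ} {μ : ℂ} (h : μ ∈ spectrum ℂ A) : ∃ v ≠ 0, A.mulVec v = μ • v := by
  rw [spectrum.mem_iff, Matrix.isUnit_iff_isUnit_det, isUnit_iff_ne_zero, not_not,
    ← Matrix.exists_mulVec_eq_zero_iff] at h
  obtain ⟨v, hv, h⟩ := h
  refine ⟨v, hv, ?_⟩
  rw [Matrix.sub_mulVec, sub_eq_zero, Algebra.algebraMap_eq_smul_one, Matrix.smul_mulVec, Matrix.one_mulVec] at h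
  exact h.symm

theorem mem_spectrum_of_mulVec {m : Type*} [Fintype m] [DecidableEq m]
    {A : Matrix m m ℂ} {μ : ℂ} {v : m → ℂ} (hv : v ≠ 0) (h : A.mulVec v = μ • v) :
    μ ∈ spectrum ℂ A := by
  rw [spectrum.mem_iff, Matrix.isUnit_iff_isUnit_det, isUnit_iff_ne_zero, not_not,
    ← Matrix.exists_mulVec_eq_zero_iff]
  refine ⟨v, hv, ?_⟩
  rw [Matrix.sub_mulVec, sub_eq_zero, Algebra.algebraMap_eq_smul_one, Matrix.smul_mulVec, Matrix.one_mulVec]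
  exact h.symm

theorem matrix_exp_smul_mulVec_eigenvector {m : Type*} [Fintype m] [DecidableEq m]
    {A : Matrix m m ℂ} {μ : ℂ} {v : m → ℂ} (h : A.mulVec v = μ • v) (s : ℂ) :
    (NormedSpace.exp (s • A)).mulVec v = Complex.exp (s * μ) • v := by
  have h1 : ((A - μ • 1) ^ 1).mulVec v = 0 := by
    rw [pow_one, Matrix.sub_mulVec, h, Matrix.smul_mulVec, Matrix.one_mulVec, sub_self]
  rw [matrix_exp_smul_mulVec h1 s]
  simp

/-- The generalised eigenspaces span. On each one the orbit is a polynomial in s times exp(sμ), and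
the strict gap δ = b - Re μ absorbs the polynomial through (δs)^j / j! ≤ exp(δs). -/
theorem exists_norm_matrix_exp_mulVec_le {m : Type*} [Fintype m] [DecidableEq m]
    (A : Matrix m m ℂ) {b : ℝ} (hb : ∀ μ ∈ spectrum ℂ A, μ.re < b) (v : m → ℂ) :
    ∃ C : ℝ, 0 ≤ C ∧ ∀ s : ℝ, 0 ≤ s →
      ‖(NormedSpace.exp ((s : ℂ) • A)).mulVec v‖ ≤ C * Real.exp (b * s) := by
  have hv : v ∈ ⨆ μ, Module.End.maxGenEigenspace (Matrix.toLin' A) μ := by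
    rw [Module.End.iSup_maxGenEigenspace_eq_top]; trivial
  induction hv using Submodule.iSup_induction' with
  | mem μ v hv =>
    obtain ⟨k, hk⟩ := (Module.End.mem_maxGenEigenspace _ _ _).1 hv
    have e : (Matrix.toLin' A - μ • (1 : Module.End ℂ (m → ℂ))) ^ k =
        Matrix.toLin' ((A - μ • 1) ^ k) := by
      rw [Matrix.toLin'_pow, map_sub, map_smul, Matrix.toLin'_one]; rfl
    rw [e, Matrix.toLin'_apply] at hk
    by_cases hv0 : v = 0
    · exact ⟨0, le_rfl, fun s _ => by simp [hv0]⟩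
    have hμ : μ ∈ spectrum ℂ A := by
      by_contra hμ
      rw [spectrum.notMem_iff, Algebra.algebraMap_eq_smul_one] at hμ
      have hu : IsUnit ((A - μ • 1) ^ k) := by
        rw [← neg_sub] 
        exact hμ.neg.pow k
      rw [Matrix.isUnit_iff_isUnit_det, isUnit_iff_ne_zero] at hu
      exact hv0 (Matrix.eq_zero_of_mulVec_eq_zero hu hk)
    set δ := b - μ.re with hδ
    have hδ0 : 0 < δ := sub_pos.2 (hb μ hμ)
    refine ⟨∑ j ∈ Finset.range k, ‖((A - μ • 1) ^ j).mulVec v‖ / δ ^ j, by positivity,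
      fun s hs => ?_⟩
    rw [matrix_exp_smul_mulVec hk, norm_smul, Complex.norm_exp]
    have hsum : ‖∑ j ∈ Finset.range k, ((s : ℂ) ^ j / j.factorial) • ((A - μ • 1) ^ j).mulVec v‖ ≤
        (∑ j ∈ Finset.range k, ‖((A - μ • 1) ^ j).mulVec v‖ / δ ^ j) * Real.exp (δ * s) := by
      refine (norm_sum_le _ _).trans ?_
      rw [Finset.sum_mul]
      refine Finset.sum_le_sum fun j _ => ?_
      rw [norm_smul, norm_div, norm_pow, Complex.norm_real, Real.norm_of_nonneg hs,
        Complex.norm_natCast]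
      have := Real.pow_div_factorial_le_exp (δ * s) (by positivity) j
      calc s ^ j / j.factorial * ‖((A - μ • 1) ^ j).mulVec v‖
          = ‖((A - μ • 1) ^ j).mulVec v‖ / δ ^ j * ((δ * s) ^ j / j.factorial) := by
            rw [mul_pow]; field_simp
        _ ≤ _ := by gcongr
    calc _ ≤ Real.exp ((s : ℂ) * μ).re * ((∑ j ∈ Finset.range k, ‖((A - μ • 1) ^ j).mulVec v‖ / δ ^ j) *
          Real.exp (δ * s)) := by gcongr
      _ = _ := by
        rw [mul_left_comm, ← Real.exp_add]
        congr 2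
        simp [hδ]; ring
  | zero => exact ⟨0, le_rfl, fun s _ => by simp⟩
  | add v w _ _ h1 h2 =>
    obtain ⟨C, hC, h1⟩ := h1
    obtain ⟨D, hD, h2⟩ := h2
    refine ⟨C + D, by positivity, fun s hs => ?_⟩
    rw [Matrix.mulVec_add, add_mul C D]
    exact (norm_add_le _ _).trans (add_le_add (h1 s hs) (h2 s hs))

/-! ### The flow exp(sE) on ℝ^d -/

theorem euclidean_norm_le_sum {d : ℕ} (x : EuclideanSpace ℝ (Fin d)) : ‖x‖ ≤ ∑ i, ‖x i‖ := by
  rw [EuclideanSpace.norm_eq]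
  refine Real.sqrt_le_iff.2 ⟨by positivity, ?_⟩
  exact Finset.sum_sq_le_sq_sum_of_nonneg fun i _ => norm_nonneg _

/-- The one-parameter group `s ↦ exp (s E)` acting on `ℝ^d`. -/
def flow {d : ℕ} (E : Matrix (Fin d) (Fin d) ℝ) (s : ℝ) :
    EuclideanSpace ℝ (Fin d) →ₗ[ℝ] EuclideanSpace ℝ (Fin d) :=
  Matrix.toEuclideanLin (NormedSpace.exp (s • E))

variable {d : ℕ} (E : Matrix (Fin d) (Fin d) ℝ)

theorem matPow_eq_flow (c : ℝ) (x : EuclideanSpace ℝ (Fin d)) :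
    matPow E c x = flow E (Real.log c) x := rfl

theorem matPow_exp (s : ℝ) (x : EuclideanSpace ℝ (Fin d)) :
    matPow E (Real.exp s) x = flow E s x := by
  rw [matPow_eq_flow, Real.log_exp]

theorem flow_apply (s : ℝ) (x : EuclideanSpace ℝ (Fin d)) (i : Fin d) :
    flow E s x i = (NormedSpace.exp (s • E)).mulVec x.ofLp i := rfl

theorem flow_zero (x : EuclideanSpace ℝ (Fin d)) : flow E 0 x = x := by
  ext i; rw [flow_apply, zero_smul, NormedSpace.exp_zero, Matrix.one_mulVec]

theorem flow_add (s t : ℝ) (x : EuclideanSpace ℝ (Fin d)) :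
    flow E (s + t) x = flow E s (flow E t x) := by
  ext i
  rw [flow_apply, flow_apply, matrix_exp_add_smul, ← Matrix.mulVec_mulVec]
  rfl

theorem flow_flow_neg (s : ℝ) (x : EuclideanSpace ℝ (Fin d)) : flow E s (flow E (-s) x) = x := by
  rw [← flow_add, add_neg_cancel, flow_zero]

theorem flow_neg (s : ℝ) : flow E (-s) = flow (-E) s := by
  rw [flow, flow, neg_smul, smul_neg]

theorem continuous_flow (s : ℝ) : Continuous (flow E s) :=
  LinearMap.continuous_of_finiteDimensional _

theorem continuous_flow_left (x : EuclideanSpace ℝ (Fin d)) : Continuous fun s => flow E s x := by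
  have h : ∀ i, Continuous fun s => flow E s x i := by
    intro i
    simp only [flow_apply, Matrix.mulVec, dotProduct]
    refine continuous_finsetSum _ fun j _ => Continuous.mul ?_ continuous_const
    rw [continuous_iff_continuousAt]
    intro t
    have h1 := hasDerivAt_matrix_exp E
    have h2 : (fun s : ℝ => NormedSpace.exp (s • E) i j) =
        fun s => ∑ k, NormedSpace.exp (t • E) i k * NormedSpace.exp ((s - t) • E) k j := by
      funext s
      rw [← Matrix.mul_apply, ← matrix_exp_add_smul, add_sub_cancel]
    rw [h2]
    refine tendsto_finsetSum _ fun k _ => Tendsto.const_mul _ ?_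
    have h3 := (h1 k j).continuousAt
    have h4 : ContinuousAt (fun s : ℝ => s - t) t := by fun_prop
    exact ContinuousAt.comp (g := fun s : ℝ => NormedSpace.exp (s • E) k j) (by simpa using h3) h4
  exact (PiLp.continuous_toLp 2 _).comp (continuous_pi h)

theorem inner_flow (s : ℝ) (x ξ : EuclideanSpace ℝ (Fin d)) :
    inner ℝ (flow E s x) ξ = inner ℝ x (flow E.transpose s ξ) := by
  have e : NormedSpace.exp (s • E.transpose) = (NormedSpace.exp (s • E)).transpose := by
    rw [← Matrix.exp_transpose, Matrix.transpose_smul]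
  simp only [EuclideanSpace.inner_eq_star_dotProduct, flow, e, star_trivial]
  simp only [Matrix.toEuclideanLin, Matrix.toLpLin_apply]
  rw [Matrix.mulVec_transpose, ← Matrix.dotProduct_mulVec]

theorem det_flow (s : ℝ) : LinearMap.det (flow E s) = Real.exp (s * E.trace) := by
  rw [← det_matrix_exp_smul, flow, Matrix.toEuclideanLin_eq_toLin_orthonormal, LinearMap.det_toLin]

theorem coe_flow_apply (s : ℝ) (x : EuclideanSpace ℝ (Fin d)) (i : Fin d) :
    ((flow E s x i : ℝ) : ℂ) = (NormedSpace.exp ((s : ℂ) • E.map (algebraMap ℝ ℂ))).mulVec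
      (fun j => (x j : ℂ)) i := by
  have e : (s : ℂ) • E.map (algebraMap ℝ ℂ) = (s • E).map (algebraMap ℝ ℂ) := by
    ext; simp
  rw [flow_apply, e, matrix_exp_map]
  simp [Matrix.mulVec, dotProduct]

/-- The complex estimate, applied to each basis vector, bounds the columns of exp(sE). -/
theorem exists_norm_flow_le {b : ℝ} (hb : ∀ a ∈ realSpectrum E, a < b) :
    ∃ C : ℝ, 0 < C ∧ ∀ s : ℝ, 0 ≤ s → ∀ x, ‖flow E s x‖ ≤ C * Real.exp (b * s) * ‖x‖ := by
  have hb' : ∀ μ ∈ spectrum ℂ (E.map (algebraMap ℝ ℂ)), μ.re < b := fun μ hμ => hb _ ⟨μ, hμ, rfl⟩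
  choose C hC0 hC using fun i : Fin d =>
    exists_norm_matrix_exp_mulVec_le _ hb' (Pi.single i 1)
  refine ⟨d * ∑ i, C i + 1, by
    have := Finset.sum_nonneg fun i (_ : i ∈ Finset.univ) => hC0 i
    positivity, fun s hs x => ?_⟩
  have hent : ∀ i j, |NormedSpace.exp (s • E) i j| ≤ C j * Real.exp (b * s) := by
    intro i j
    refine le_trans ?_ (hC j s hs)
    refine le_trans (le_of_eq ?_) (norm_le_pi_norm _ i)
    have := coe_flow_apply E s (EuclideanSpace.single j 1) i
    have e2 : (fun k => ((EuclideanSpace.single j (1:ℝ) : EuclideanSpace ℝ (Fin d)) k : ℂ)) = Pi.single j 1 := by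
      funext k; by_cases h : k = j <;> simp [h]
    rw [e2] at this
    rw [← this, flow_apply]
    simp
  have hcoord : ∀ i, ‖flow E s x i‖ ≤ (∑ j, C j) * Real.exp (b * s) * ‖x‖ := by
    intro i
    rw [flow_apply, Matrix.mulVec, dotProduct, Finset.sum_mul, Finset.sum_mul]
    refine (norm_sum_le _ _).trans (Finset.sum_le_sum fun j _ => ?_)
    rw [norm_mul]
    exact mul_le_mul (hent i j) (PiLp.norm_apply_le x j) (norm_nonneg _)
      (mul_nonneg (hC0 j) (Real.exp_pos _).le)
  calc ‖flow E s x‖ ≤ ∑ i : Fin d, (∑ j, C j) * Real.exp (b * s) * ‖x‖ :=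
        (euclidean_norm_le_sum _).trans (Finset.sum_le_sum fun i _ => hcoord i)
    _ = d * (∑ j, C j) * Real.exp (b * s) * ‖x‖ := by simp; ring
    _ ≤ _ := by gcongr; linarith

theorem mem_realSpectrum_neg {a : ℝ} : a ∈ realSpectrum (-E) ↔ -a ∈ realSpectrum E := by
  have e : (-E).map (algebraMap ℝ ℂ) = -(E.map (algebraMap ℝ ℂ)) := by ext; simp
  have h : ∀ F : Matrix (Fin d) (Fin d) ℂ, ∀ a : ℝ, a ∈ Complex.re '' spectrum ℂ F → -a ∈ Complex.re '' spectrum ℂ (-F) := by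
    rintro F a ⟨μ, hμ, rfl⟩
    obtain ⟨v, hv, hv2⟩ := exists_mulVec_eq_smul_of_mem_spectrum hμ
    exact ⟨-μ, mem_spectrum_of_mulVec hv (by rw [Matrix.neg_mulVec, hv2, neg_smul]), by simp⟩
  constructor
  · intro ha
    have := h _ a ha
    rwa [e, neg_neg] at this
  · intro ha
    have := h _ _ ha
    rw [neg_neg] at this
    rwa [realSpectrum, e]

theorem exists_norm_flow_neg_le {b : ℝ} (hb : ∀ a ∈ realSpectrum E, b < a) :
    ∃ C : ℝ, 0 < C ∧ ∀ s : ℝ, 0 ≤ s → ∀ x, ‖flow E (-s) x‖ ≤ C * Real.exp (-b * s) * ‖x‖ := by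
  simp_rw [flow_neg]
  refine exists_norm_flow_le (-E) fun a ha => ?_
  have := hb _ ((mem_realSpectrum_neg E).1 ha)
  linarith

theorem mem_realSpectrum_transpose {a : ℝ} : a ∈ realSpectrum E.transpose ↔ a ∈ realSpectrum E := by
  have h : ∀ F : Matrix (Fin d) (Fin d) ℂ, spectrum ℂ F.transpose = spectrum ℂ F := by
    intro F
    ext μ
    rw [Matrix.mem_spectrum_iff_isRoot_charpoly, Matrix.mem_spectrum_iff_isRoot_charpoly, Matrix.charpoly_transpose]
  rw [realSpectrum, realSpectrum, ← h (E.map _)]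
  rfl

/-- Here g(x) = |w·x| for a complex left eigenvector w, so the flow multiplies g by |exp(sμ)|
exactly. The eigenvalue need not be real, hence u is only the real or the imaginary part of w,
whichever is nonzero, and is merely dominated by g. -/
theorem exists_eigenfunctional {a : ℝ} (ha : a ∈ realSpectrum E) :
    ∃ (u : EuclideanSpace ℝ (Fin d)) (g : EuclideanSpace ℝ (Fin d) → ℝ), u ≠ 0 ∧
      (∀ x, |inner ℝ u x| ≤ g x) ∧ (∃ C, ∀ x, g x ≤ C * ‖x‖) ∧
      ∀ s x, g (flow E s x) = Real.exp (a * s) * g x := by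
  obtain ⟨μ, hμ, rfl⟩ := (mem_realSpectrum_transpose E).2 ha
  obtain ⟨w, hw, hw2⟩ := exists_mulVec_eq_smul_of_mem_spectrum hμ
  set g : EuclideanSpace ℝ (Fin d) → ℝ := fun x => ‖w ⬝ᵥ fun j => (x j : ℂ)‖ with hg
  have hg1 : ∃ C, ∀ x, g x ≤ C * ‖x‖ := by
    refine ⟨∑ i, ‖w i‖, fun x => ?_⟩
    rw [hg, Finset.sum_mul]
    refine (norm_sum_le _ _).trans (Finset.sum_le_sum fun i _ => ?_)
    rw [norm_mul, Complex.norm_real]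
    gcongr
    exact PiLp.norm_apply_le x i
  have hg2 : ∀ s x, g (flow E s x) = Real.exp (μ.re * s) * g x := by
    intro s x
    have e1 : (fun j => (flow E s x j : ℂ)) = (NormedSpace.exp ((s : ℂ) • E.map (algebraMap ℝ ℂ))).mulVec
      (fun j => (x j : ℂ)) := funext fun j => coe_flow_apply E s x j
    simp only [hg]
    rw [e1, Matrix.dotProduct_mulVec, ← Matrix.mulVec_transpose, ← Matrix.exp_transpose,
      Matrix.transpose_smul, matrix_exp_smul_mulVec_eigenvector (A := (E.map (algebraMap ℝ ℂ)).transpose) hw2, smul_dotProduct, norm_smul,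
      Complex.norm_exp]
    congr 2
    simp [mul_comm]
  have hdot : ∀ (x : EuclideanSpace ℝ (Fin d)) (u : Fin d → ℝ), inner ℝ (WithLp.toLp 2 u) x = ∑ i, u i * x i := by
    intro x u
    simp [PiLp.inner_apply, mul_comm]
  by_cases hre : (fun i => (w i).re) = 0
  · have him : (fun i => (w i).im) ≠ 0 := by
      intro him
      exact hw (funext fun i => Complex.ext (congrFun hre i) (congrFun him i))
    refine ⟨WithLp.toLp 2 fun i => (w i).im, g, ?_, fun x => ?_, hg1, hg2⟩
    · simpa using him
    · rw [hdot]
      refine le_trans (le_of_eq ?_) (Complex.abs_im_le_norm _)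
      simp [dotProduct, Complex.mul_im]
  · refine ⟨WithLp.toLp 2 fun i => (w i).re, g, ?_, fun x => ?_, hg1, hg2⟩
    · simpa using hre
    · rw [hdot]
      refine le_trans (le_of_eq ?_) (Complex.abs_re_le_norm _)
      simp [dotProduct, Complex.mul_re]

/-- The flow of the real (or imaginary) part of an eigenvector w is that part of exp(sμ)w. Unlike
the general growth bound, this one loses nothing in the exponent and is valid for s of either sign.
-/
theorem exists_norm_flow_eigenvector_le {a : ℝ} (ha : a ∈ realSpectrum E) :
    ∃ (u : EuclideanSpace ℝ (Fin d)) (C : ℝ), u ≠ 0 ∧ 0 < C ∧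
      ∀ s, ‖flow E s u‖ ≤ C * Real.exp (a * s) := by
  obtain ⟨μ, hμ, rfl⟩ := ha
  obtain ⟨w, hw, hw2⟩ := exists_mulVec_eq_smul_of_mem_spectrum hμ
  have key : ∀ u : Fin d → ℝ, u ≠ 0 → (∀ (M : Matrix (Fin d) (Fin d) ℝ) i, |M.mulVec u i| ≤ ‖(M.map (algebraMap ℝ ℂ)).mulVec w i‖) →  ∃ (u : EuclideanSpace ℝ (Fin d)) (C : ℝ), u ≠ 0 ∧ 0 < C ∧
      ∀ s, ‖flow E s u‖ ≤ C * Real.exp (μ.re * s) := by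
    intro u hu h
    refine ⟨WithLp.toLp 2 u, ∑ i, ‖w i‖ + 1, by simpa using hu, by positivity, fun s => ?_⟩
    refine (euclidean_norm_le_sum _).trans ?_
    have h1 : ∀ i, ‖flow E s (WithLp.toLp 2 u) i‖ ≤ ‖w i‖ * Real.exp (μ.re * s) := by
      intro i
      refine (h _ i).trans ?_
      have e : ((s • E).map (algebraMap ℝ ℂ)) = (s : ℂ) • E.map (algebraMap ℝ ℂ) := by
        ext; simp
      rw [← matrix_exp_map, e, matrix_exp_smul_mulVec_eigenvector hw2, Pi.smul_apply, norm_smul, Complex.norm_exp, mul_comm]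
      simp [mul_comm]
    refine (Finset.sum_le_sum fun i _ => h1 i).trans ?_
    rw [← Finset.sum_mul]
    gcongr
    linarith
  by_cases hre : (fun i => (w i).re) = 0
  · have him : (fun i => (w i).im) ≠ 0 := by
      intro him
      exact hw (funext fun i => Complex.ext (congrFun hre i) (congrFun him i))
    refine key _ him fun M i => ?_
    refine le_trans (le_of_eq ?_) (Complex.abs_im_le_norm _)
    simp [Matrix.mulVec, dotProduct, Complex.mul_im]
  · refine key _ hre fun M i => ?_
    refine le_trans (le_of_eq ?_) (Complex.abs_re_le_norm _)
    simp [Matrix.mulVec, dotProduct, Complex.mul_re]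

/-- The trace is the sum of the real parts of the d complex roots of the characteristic polynomial.
-/
theorem mul_le_trace {a : ℝ} (ha : ∀ b ∈ realSpectrum E, a ≤ b) : d * a ≤ E.trace := by
  set A := E.map (algebraMap ℝ ℂ) with hA
  have h1 : A.trace = (E.trace : ℂ) := by simp [hA, Matrix.trace]
  have h2 := Matrix.trace_eq_sum_roots_charpoly A
  have h3 : Multiset.card A.charpoly.roots = d := by
    rw [← (IsAlgClosed.splits A.charpoly).natDegree_eq_card_roots, Matrix.charpoly_natDegree_eq_dim, Fintype.card_fin]
  have h4 : E.trace = (A.charpoly.roots.map Complex.re).sum := by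
    have := congrArg Complex.re (h1.symm.trans h2)
    rw [Complex.ofReal_re] at this
    rw [this]
    exact map_multiset_sum Complex.reAddGroupHom _
  rw [h4]
  have h5 := Multiset.card_nsmul_le_sum (s := A.charpoly.roots.map Complex.re) (a := a) (by
    intro x hx
    obtain ⟨μ, hμ, rfl⟩ := Multiset.mem_map.1 hx
    exact ha _ ⟨μ, Matrix.mem_spectrum_of_isRoot_charpoly (Polynomial.isRoot_of_mem_roots hμ), rfl⟩)
  simpa [h3] using h5

/-! ### Variograms and their two-sided power bounds -/

/-- The properties of the standard deviation `n h` of the increments `X (x + h) - X x` of an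
operator scaling field with stationary increments. -/
structure IsVariogram {d : ℕ} (E : Matrix (Fin d) (Fin d) ℝ) (H : ℝ)
    (n : EuclideanSpace ℝ (Fin d) → ℝ) : Prop where
  nonneg : ∀ x, 0 ≤ n x
  zero : n 0 = 0
  neg : ∀ x, n (-x) = n x
  add_le : ∀ x y, n (x + y) ≤ n x + n y
  lsc : LowerSemicontinuous n
  flow : ∀ s x, n (flow E s x) = Real.exp (H * s) * n x
  pos : ∀ x, x ≠ 0 → 0 < n x

namespace IsVariogram

variable {d : ℕ} {E : Matrix (Fin d) (Fin d) ℝ} {H : ℝ} {n : EuclideanSpace ℝ (Fin d) → ℝ}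

/-- Baire category: the sublevel sets are closed and cover the space, so one of them contains a
ball. Subadditivity and evenness move this ball to the origin. -/
theorem exists_bound (hn : IsVariogram E H n) : ∃ M r : ℝ, 0 < M ∧ 0 < r ∧ ∀ x, ‖x‖ ≤ r → n x ≤ M := by
  obtain ⟨k, x₀, hx₀⟩ := nonempty_interior_of_iUnion_of_closed
    (f := fun k : ℕ => {x | n x ≤ k}) (fun k => hn.lsc.isClosed_preimage (k : ℝ)) (by
      ext x
      simpa using exists_nat_ge (n x))
  rw [mem_interior_iff_mem_nhds, Metric.mem_nhds_iff] at hx₀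
  obtain ⟨ε, hε, hsub⟩ := hx₀
  have h0 : n x₀ ≤ k := hsub (Metric.mem_ball_self hε)
  refine ⟨k + k + 1, ε / 2, by positivity, by positivity, fun x hx => ?_⟩
  have h1 : n (x₀ + x) ≤ k := hsub (by
    rw [Metric.mem_ball, dist_eq_norm, add_sub_cancel_left]; linarith)
  have h2 := hn.add_le (x₀ + x) (-x₀)
  rw [hn.neg, add_neg_cancel_comm] at h2
  linarith

/-- Flow h outwards for the time s at which the growth bound with b = H/γ > a still keeps it in the
ball of radius r. There n ≤ M, and undoing the flow costs exp(-Hs) = (C‖h‖/r)^γ. -/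
theorem exists_le_rpow (hn : IsVariogram E H n) {a γ : ℝ} (ha : ∀ b ∈ realSpectrum E, b ≤ a)
    (ha0 : 0 < a) (hH : 0 < H) (hγ : 0 < γ) (hγa : γ < H / a) :
    ∃ C r : ℝ, 0 < C ∧ 0 < r ∧ ∀ h, ‖h‖ ≤ r → n h ≤ C * ‖h‖ ^ γ := by
  obtain ⟨M, r, hM, hr, hb⟩ := hn.exists_bound
  have hba : a < H / γ := by
    rw [lt_div_iff₀ ha0] at hγa
    rw [lt_div_iff₀ hγ]; linarith
  set b := H / γ with hbdef
  have hb0 : 0 < b := by positivity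
  have hHb : H = γ * b := by rw [hbdef]; field_simp
  obtain ⟨C, hC, hflow⟩ := exists_norm_flow_le E (b := b) fun a' ha' => (ha a' ha').trans_lt hba
  refine ⟨M * (C / r) ^ γ, r / C, by positivity, by positivity, fun h hh => ?_⟩
  by_cases h0 : h = 0
  · rw [h0, hn.zero]; positivity
  have hpos : 0 < ‖h‖ := norm_pos_iff.2 h0
  set q := r / (C * ‖h‖) with hq
  have hq0 : 0 < q := by positivity
  have hq1 : 1 ≤ q := by
    rw [hq, one_le_div (by positivity)]
    rw [le_div_iff₀ hC] at hh; linarith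
  set s := Real.log q / b with hs
  have hs0 : 0 ≤ s := div_nonneg (Real.log_nonneg hq1) hb0.le
  have hbs : b * s = Real.log q := by rw [hs]; field_simp
  have h1 : ‖OperatorScaling.flow E s h‖ ≤ r := by
    refine (hflow s hs0 h).trans (le_of_eq ?_)
    rw [hbs, Real.exp_log hq0, hq]; field_simp
  have h2 := hb _ h1
  rw [hn.flow] at h2
  have h3 : Real.exp (H * s) = q ^ γ := by
    rw [Real.rpow_def_of_pos hq0, hHb, ← hbs]; ring_nf
  rw [h3] at h2
  have h4 : M * (C / r) ^ γ * ‖h‖ ^ γ = M / q ^ γ := by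
    have e : C / r * ‖h‖ = q⁻¹ := by rw [hq]; field_simp
    rw [mul_assoc, ← Real.mul_rpow (by positivity) hpos.le, e, Real.inv_rpow hq0.le,
      div_eq_mul_inv]
  rw [h4, le_div_iff₀ (by positivity)]
  linarith

/-- A lower semicontinuous function attains its minimum on the sphere. A point outside is carried
back through the sphere by the contracting flow, and along the way n can only decrease. -/
theorem exists_pos_le (hn : IsVariogram E H n) {a : ℝ} (ha : ∀ b ∈ realSpectrum E, a ≤ b)
    (ha0 : 0 < a) (hH : 0 < H) {r : ℝ} (hr : 0 < r) :
    ∃ m : ℝ, 0 < m ∧ ∀ x, r ≤ ‖x‖ → m ≤ n x := by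
  have hsphere : ∃ m : ℝ, 0 < m ∧ ∀ x, ‖x‖ = r → m ≤ n x := by
    -- The sphere is empty only in dimension 0, where any constant serves.
    rcases (Metric.sphere (0 : EuclideanSpace ℝ (Fin d)) r).eq_empty_or_nonempty with he | hne
    · refine ⟨1, one_pos, fun x hx => ?_⟩
      have : x ∈ Metric.sphere (0 : EuclideanSpace ℝ (Fin d)) r := by simpa using hx
      rw [he] at this
      exact this.elim
    · obtain ⟨x₀, hx₀, hmin⟩ := LowerSemicontinuousOn.exists_isMinOn hne (isCompact_sphere 0 r)
        (hn.lsc.lowerSemicontinuousOn _)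
      refine ⟨n x₀, hn.pos _ ?_, fun x hx => hmin (by simpa using hx)⟩
      rintro rfl
      simp at hx₀
      exact hr.ne hx₀
  obtain ⟨m, hm, hmin⟩ := hsphere
  refine ⟨m, hm, fun x hx => ?_⟩
  obtain ⟨C, hC, hflow⟩ := exists_norm_flow_neg_le E (b := a / 2) fun b hb => by
    have := ha b hb; linarith
  have hlim : Tendsto (fun s => C * Real.exp (-(a / 2) * s) * ‖x‖) atTop (𝓝 0) := by
    have h1 : Tendsto (fun s : ℝ => Real.exp (-(a / 2) * s)) atTop (𝓝 0) :=
      Real.tendsto_exp_atBot.comp (tendsto_id.const_mul_atTop_of_neg (by linarith))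
    simpa using (h1.const_mul C).mul_const ‖x‖
  obtain ⟨S, hS, hS0⟩ := ((hlim.eventually_le_const hr).and (eventually_ge_atTop 0)).exists
  have hcont : Continuous fun s => ‖OperatorScaling.flow E (-s) x‖ :=
    ((continuous_flow_left E x).comp continuous_neg).norm
  obtain ⟨t, ht, htr⟩ := intermediate_value_Icc' hS0 hcont.continuousOn
    (show r ∈ Set.Icc _ _ from ⟨(hflow S hS0 x).trans hS, by simpa [flow_zero] using hx⟩)
  have h1 := hmin _ htr
  have h2 := hn.flow t (OperatorScaling.flow E (-t) x)
  rw [flow_flow_neg] at h2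
  rw [h2]
  have h3 : 1 ≤ Real.exp (H * t) := Real.one_le_exp (mul_nonneg hH.le ht.1)
  nlinarith

/-- Flow x until g = 1. Since g is dominated by the norm, the point is then at a definite distance
from 0, where n ≥ m; undoing the flow multiplies by g(x)^(H/a) ≥ |⟨u,x⟩|^(H/a). -/
theorem exists_rpow_inner_le (hn : IsVariogram E H n) {a₁ a : ℝ} (ha₁ : ∀ b ∈ realSpectrum E, a₁ ≤ b)
    (ha₁0 : 0 < a₁) (ha : a ∈ realSpectrum E) (hH : 0 < H) :
    ∃ (u : EuclideanSpace ℝ (Fin d)) (c : ℝ), u ≠ 0 ∧ 0 < c ∧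
      ∀ x, c * |inner ℝ u x| ^ (H / a) ≤ n x := by
  have ha0 : 0 < a := ha₁0.trans_le (ha₁ a ha)
  obtain ⟨u, g, hu, hug, ⟨C, hgC⟩, hg⟩ := exists_eigenfunctional E ha
  have hgC' : ∀ x, g x ≤ (|C| + 1) * ‖x‖ := fun x => (hgC x).trans (by
    gcongr; linarith [le_abs_self C])
  obtain ⟨m, hm, hmin⟩ := hn.exists_pos_le ha₁ ha₁0 hH (r := 1 / (|C| + 1)) (by positivity)
  refine ⟨u, m, hu, hm, fun x => ?_⟩
  by_cases hx : inner ℝ u x = 0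
  · rw [hx, abs_zero, Real.zero_rpow (by positivity), mul_zero]
    exact hn.nonneg x
  have hgx : 0 < g x := (abs_pos.2 hx).trans_le (hug x)
  set s := -Real.log (g x) / a with hs
  have hs1 : a * s = -Real.log (g x) := by rw [hs]; field_simp
  have h1 : g (OperatorScaling.flow E s x) = 1 := by
    rw [hg, hs1, Real.exp_neg, Real.exp_log hgx, inv_mul_cancel₀ hgx.ne']
  have h2 := hmin (OperatorScaling.flow E s x) (by
    rw [div_le_iff₀ (by positivity)]
    have := hgC' (OperatorScaling.flow E s x)
    linarith)
  rw [hn.flow] at h2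
  have h3 : Real.exp (H * s) = (g x ^ (H / a))⁻¹ := by
    rw [Real.rpow_def_of_pos hgx, ← Real.exp_neg, hs]; congr 1; ring
  rw [h3, inv_mul_eq_div, le_div_iff₀ (by positivity)] at h2
  refine le_trans ?_ h2
  gcongr
  exact hug x

end IsVariogram

/-! ### Hausdorff and box dimension: the energy method and coverings -/

/-- Finite energy makes the potential I at most k on some A ⊆ F of positive measure. If U meets A at
x, then U lies in the ball of radius diam U about x, so μ(U ∩ A) ≤ k (diam U)^s. The mass
distribution principle compares μ on A with the Hausdorff measure. -/
theorem le_dimH_of_energy_ne_top {M : Type*} [EMetricSpace M] [MeasurableSpace M] [BorelSpace M]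
    [SecondCountableTopology M] (μ : Measure M) [SFinite μ] {F : Set M} (hF : MeasurableSet F)
    (hμ : μ F ≠ 0) {s : ℝ≥0} (hs : 0 < s)
    (h : ∫⁻ x in F, ∫⁻ y, edist x y ^ (-(s : ℝ)) ∂μ ∂μ ≠ ∞) : (s : ℝ≥0∞) ≤ dimH F := by
  set I : M → ℝ≥0∞ := fun x => ∫⁻ y, edist x y ^ (-(s : ℝ)) ∂μ with hI
  have hImeas : Measurable I :=
    Measurable.lintegral_prod_right' (f := fun p : M × M => edist p.1 p.2 ^ (-(s : ℝ)))
      (by fun_prop)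
  obtain ⟨k, hk⟩ : ∃ k : ℕ, μ (F ∩ {x | I x ≤ k}) ≠ 0 := by
    by_contra! hcon
    have hfin : ∀ᵐ x ∂μ.restrict F, I x < ∞ := ae_lt_top hImeas h
    have hnull : μ.restrict F (⋃ k : ℕ, {x | I x ≤ k}) = 0 := by
      refine measure_iUnion_null fun k => ?_
      rw [Measure.restrict_apply (measurableSet_le hImeas measurable_const), Set.inter_comm]
      exact hcon k
    have hall : ∀ᵐ x ∂μ.restrict F, x ∈ ⋃ k : ℕ, {x | I x ≤ k} := by
      filter_upwards [hfin] with x hx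
      obtain ⟨k, hk⟩ := ENNReal.exists_nat_gt hx.ne
      exact Set.mem_iUnion.2 ⟨k, hk.le⟩
    have : μ.restrict F Set.univ = 0 := by
      refine le_antisymm ((measure_mono_ae ?_).trans hnull.le) zero_le
      filter_upwards [hall] with x hx _ using hx
    rw [Measure.restrict_apply_univ] at this
    exact hμ this
  set A := F ∩ {x | I x ≤ k} with hA
  have hAm : MeasurableSet A := hF.inter (measurableSet_le hImeas measurable_const)
  -- The added 1 covers the case k = 0.
  set c : ℝ≥0∞ := ((k : ℝ≥0∞) + 1)⁻¹ with hc
  have hc0 : c ≠ 0 := ENNReal.inv_ne_zero.2 (by finiteness)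
  have hle : c • μ.restrict A ≤ μH[(s : ℝ)] := by
    refine Measure.le_hausdorffMeasure _ _ 1 one_pos fun U hU => ?_
    rw [Measure.smul_apply, smul_eq_mul, Measure.restrict_apply' hAm, mul_comm, hc,
      ← div_eq_mul_inv]
    refine ENNReal.div_le_of_le_mul ?_
    rcases (U ∩ A).eq_empty_or_nonempty with he | ⟨x, hxU, hxA⟩
    · rw [he, measure_empty]; exact zero_le
    set δ := Metric.ediam U with hδ
    have hδ' : δ ≠ ∞ := ne_top_of_le_ne_top ENNReal.one_ne_top hU
    have hsub : U ⊆ Metric.closedEBall x δ := fun y hy => by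
      rw [Metric.mem_closedEBall]
      exact Metric.edist_le_ediam_of_mem hy hxU
    have h1 : μ (Metric.closedEBall x δ) * δ ^ (-(s : ℝ)) ≤ k := by
      refine le_trans ?_ hxA.2
      calc μ (Metric.closedEBall x δ) * δ ^ (-(s : ℝ))
          = ∫⁻ y in Metric.closedEBall x δ, δ ^ (-(s : ℝ)) ∂μ := by
            rw [setLIntegral_const, mul_comm]
        _ ≤ ∫⁻ y in Metric.closedEBall x δ, edist x y ^ (-(s : ℝ)) ∂μ := by
            refine setLIntegral_mono (by fun_prop) fun y hy => ?_
            rw [ENNReal.rpow_neg, ENNReal.rpow_neg]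
            refine ENNReal.inv_le_inv.2 (ENNReal.rpow_le_rpow ?_ s.2)
            rw [edist_comm]; exact hy
        _ ≤ I x := setLIntegral_le_lintegral _ _
    have h2 : μ (U ∩ A) ≤ μ (Metric.closedEBall x δ) :=
      measure_mono (Set.inter_subset_left.trans hsub)
    -- When diam U = 0 the bound reads μ{x} · ∞ ≤ k, so x is not an atom.
    rcases eq_or_ne δ 0 with h0 | h0
    · rw [h0, ENNReal.zero_rpow_of_neg (by simpa using hs)] at h1
      have : μ (Metric.closedEBall x 0) = 0 := by
        by_contra hne
        rw [ENNReal.mul_top hne] at h1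
        exact absurd h1 (by simp)
      rw [h0, this] at h2
      exact h2.trans zero_le
    · rw [ENNReal.rpow_neg, ← div_eq_mul_inv, ENNReal.div_le_iff
        (by simp [h0, hδ']) (by finiteness)] at h1
      refine h2.trans (h1.trans ?_)
      rw [mul_comm]
      gcongr
      exact le_self_add
  refine le_dimH_of_hausdorffMeasure_ne_zero fun h0 => ?_
  have h3 := hle F
  rw [h0, Measure.smul_apply, smul_eq_mul, Measure.restrict_apply' hAm,
    Set.inter_eq_self_of_subset_right Set.inter_subset_left] at h3
  rcases mul_eq_zero.1 (le_antisymm h3 zero_le) with h4 | h4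
  exacts [hc0 h4, hk h4]

theorem exists_cover_encard_le {M : Type*} [PseudoEMetricSpace M] (ε : ℝ≥0) (F : Set M)
    (h : Metric.externalCoveringNumber ε F ≠ ⊤) :
    ∃ C : Finset M, Metric.IsCover ε F (C : Set M) ∧
      C.card = (Metric.externalCoveringNumber ε F).toNat := by
  have h1 : Metric.externalCoveringNumber ε F < Metric.externalCoveringNumber ε F + 1 :=
    ENat.lt_add_one_iff h |>.2 le_rfl
  conv_lhs at h1 => rw [Metric.externalCoveringNumber]
  simp only [iInf_lt_iff] at h1
  obtain ⟨C, hC, hlt⟩ := h1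
  have hle := (ENat.lt_add_one_iff h).1 hlt
  have hfin : C.Finite := Set.encard_ne_top_iff.1 (ne_top_of_le_ne_top h hle)
  have heq : C.encard = Metric.externalCoveringNumber ε F :=
    le_antisymm hle (iInf₂_le C hC)
  refine ⟨hfin.toFinset, by simpa using hC, ?_⟩
  rw [← heq, hfin.encard_eq_coe_toFinset_card]; rfl

/-- The Hausdorff measure is at most a liminf over covers, so good covers along one sequence of
scales suffice: N balls of diameter at most 2ε contribute at most 2^t. This is the inequality
between the Hausdorff and the lower box dimension. -/
theorem dimH_le_of_frequently {M : Type*} [MetricSpace M] {F : Set M} {t : ℝ≥0}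
    (hfin : ∀ ε : ℝ≥0, 0 < ε → Metric.externalCoveringNumber ε F ≠ ⊤)
    (h : ∃ᶠ ε : ℝ≥0 in 𝓝[>] 0,
      ((Metric.externalCoveringNumber ε F).toNat : ℝ) ≤ (ε : ℝ) ^ (-(t : ℝ))) :
    dimH F ≤ t := by
  borelize M
  have h' := h.and_eventually self_mem_nhdsWithin
  obtain ⟨ε, hε, hεt⟩ := exists_seq_forall_of_frequently h'
  choose C hC hcard using fun k => exists_cover_encard_le (ε k) F (hfin (ε k) (hεt k).2)
  have hε0 : Tendsto ε atTop (𝓝 0) := hε.mono_right nhdsWithin_le_nhds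
  have key := Measure.hausdorffMeasure_le_liminf_sum (t : ℝ) F (l := atTop)
    (fun k => 2 * (ε k : ℝ≥0∞)) (by
      have : Tendsto (fun k => ((2 * ε k : ℝ≥0) : ℝ≥0∞)) atTop (𝓝 ((2 * 0 : ℝ≥0) : ℝ≥0∞)) :=
        ENNReal.tendsto_coe.2 (hε0.const_mul 2)
      simpa using this)
    (fun k (c : C k) => Metric.closedEBall (c : M) (ε k))
    (Eventually.of_forall fun k c => Metric.ediam_closedEBall_le)
    (Eventually.of_forall fun k x hx => by
      obtain ⟨c, hc, hxc⟩ := hC k hx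
      exact Set.mem_iUnion.2 ⟨⟨c, hc⟩, hxc⟩)
  refine dimH_le_of_hausdorffMeasure_ne_top (d := t) (ne_top_of_le_ne_top (b := (2 : ℝ≥0∞) ^ (t : ℝ)) (by finiteness) (key.trans ?_))
  refine liminf_le_of_le (by isBoundedDefault) fun b hb => ?_
  obtain ⟨k, hk⟩ := hb.exists
  refine hk.trans ?_
  calc ∑ c : C k, Metric.ediam (Metric.closedEBall (c : M) (ε k)) ^ (t : ℝ)
      ≤ ∑ c : C k, (2 * (ε k : ℝ≥0∞)) ^ (t : ℝ) := by
        gcongr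
        exact Metric.ediam_closedEBall_le
    _ = (C k).card * ((2 : ℝ≥0∞) ^ (t : ℝ) * (ε k : ℝ≥0∞) ^ (t : ℝ)) := by
        rw [ENNReal.mul_rpow_of_nonneg _ _ t.coe_nonneg]; simp
    _ = 2 ^ (t : ℝ) * ((C k).card * (ε k : ℝ≥0∞) ^ (t : ℝ)) := by ring
    _ ≤ 2 ^ (t : ℝ) * 1 := by
        gcongr
        have h1 := (hεt k).1
        have hpos : (0 : ℝ) < ε k := (hεt k).2
        rw [← hcard k, Real.rpow_neg hpos.le, ← one_div, le_div_iff₀ (by positivity)] at h1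
        rw [← ENNReal.coe_rpow_of_nonneg _ t.coe_nonneg]
        exact_mod_cast h1
    _ = _ := mul_one _

/-- Only one bound on each dimension is needed. Too few covering balls at arbitrarily small scales
would force dim_H below D, and the upper covering bound also bounds dim_H. -/
theorem dimH_and_hasBoxDim_of_bounds {M : Type*} [MetricSpace M] {F : Set M} {D : ℝ} (hD : 0 < D)
    (hne : F.Nonempty) (htb : TotallyBounded F)
    (hlow : ∀ s : ℝ≥0, 0 < s → (s : ℝ) < D → (s : ℝ≥0∞) ≤ dimH F)
    (hup : ∀ t : ℝ, D < t → ∃ C : ℝ, ∀ᶠ ε : ℝ≥0 in 𝓝[>] 0,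
      ((Metric.externalCoveringNumber ε F).toNat : ℝ) ≤ C * (ε : ℝ) ^ (-t)) :
    dimH F = ENNReal.ofReal D ∧ HasBoxDim F D := by
  have hfin : ∀ ε : ℝ≥0, 0 < ε → Metric.externalCoveringNumber ε F ≠ ⊤ := by
    intro ε hε
    obtain ⟨N, -, hN, hc⟩ := Metric.exists_finite_isCover_of_totallyBounded hε.ne' htb
    exact ne_top_of_le_ne_top hN.encard_lt_top.ne (iInf₂_le N hc)
  have hlog : Tendsto (fun ε : ℝ≥0 => -Real.log (ε : ℝ)) (𝓝[>] 0) atTop := by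
    refine tendsto_neg_atBot_atTop.comp (Real.tendsto_log_nhdsGT_zero.comp ?_)
    refine tendsto_nhdsWithin_iff.2 ⟨?_, ?_⟩
    · exact (NNReal.tendsto_coe.2 tendsto_id).mono_left nhdsWithin_le_nhds
    · filter_upwards [self_mem_nhdsWithin] with ε hε using NNReal.coe_pos.2 hε
  have hN1 : ∀ ε : ℝ≥0, 0 < ε → (1 : ℝ) ≤ ((Metric.externalCoveringNumber ε F).toNat : ℝ) := by
    intro ε hε
    have h2 : (Metric.externalCoveringNumber ε F).toNat ≠ 0 := by
      simpa [ENat.toNat_eq_zero] using ⟨hne.ne_empty, hfin ε hε⟩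
    exact_mod_cast Nat.one_le_iff_ne_zero.2 h2
  have hup' : ∀ t : ℝ, D < t → ∀ᶠ ε : ℝ≥0 in 𝓝[>] 0,
      ((Metric.externalCoveringNumber ε F).toNat : ℝ) < (ε : ℝ) ^ (-t) := by
    intro t ht
    -- Using the midpoint leaves a negative power of ε that absorbs the constant C.
    obtain ⟨C, hC⟩ := hup ((D + t) / 2) (by linarith)
    have h1 : ∀ᶠ ε : ℝ≥0 in 𝓝[>] 0, Real.log (|C| + 1) < (t - D) / 2 * -Real.log (ε : ℝ) :=
      (hlog.const_mul_atTop (by linarith : 0 < (t - D) / 2)).eventually_gt_atTop _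
    filter_upwards [hC, h1, self_mem_nhdsWithin] with ε hε h1 hpos
    have hpos' : (0 : ℝ) < ε := hpos
    refine hε.trans_lt ?_
    have h2 : |C| + 1 < (ε : ℝ) ^ (-((t - D) / 2)) := by
      rw [Real.rpow_def_of_pos hpos', ← Real.log_lt_iff_lt_exp (by positivity)]
      linarith
    calc C * (ε : ℝ) ^ (-((D + t) / 2)) < (ε : ℝ) ^ (-((t - D) / 2)) * (ε : ℝ) ^ (-((D + t) / 2)) := by
          gcongr
          linarith [le_abs_self C]
      _ = (ε : ℝ) ^ (-t) := by rw [← Real.rpow_add hpos']; ring_nf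
  have hlow' : ∀ t : ℝ, t < D → ∀ᶠ ε : ℝ≥0 in 𝓝[>] 0,
      (ε : ℝ) ^ (-t) < ((Metric.externalCoveringNumber ε F).toNat : ℝ) := by
    intro t ht
    by_contra hcon
    rw [not_eventually] at hcon
    -- A negative t is replaced by 0, which is still below D because D > 0.
    set t' : ℝ≥0 := Real.toNNReal t with ht'
    have ht'D : (t' : ℝ) < D := by rw [ht', Real.coe_toNNReal']; exact max_lt ht hD
    have h1 : dimH F ≤ t' := by
      refine dimH_le_of_frequently hfin ?_
      have hsmall : ∀ᶠ ε : ℝ≥0 in 𝓝[>] 0, ε < 1 := mem_nhdsWithin_of_mem_nhds (Iio_mem_nhds one_pos)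
      refine (hcon.and_eventually (hsmall.and self_mem_nhdsWithin)).mono fun ε ⟨h, hlt, hpos⟩ => ?_
      refine (not_lt.1 h).trans ?_
      exact Real.rpow_le_rpow_of_exponent_ge hpos (by exact_mod_cast hlt.le)
        (neg_le_neg (Real.le_coe_toNNReal t))
    obtain ⟨s, hs1, hs2⟩ := exists_between ht'D
    have hs0 : 0 ≤ s := t'.2.trans hs1.le
    lift s to ℝ≥0 using hs0
    have h2 := (hlow s (lt_of_le_of_lt t'.2 hs1) hs2).trans h1
    rw [ENNReal.coe_le_coe] at h2
    exact absurd hs1 (not_lt.2 h2)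
  have hup0 : dimH F ≤ ENNReal.ofReal D := by
    refine ENNReal.le_of_forall_pos_le_add fun δ hδ _ => ?_
    have h1 : dimH F ≤ (Real.toNNReal D + δ : ℝ≥0) := by
      refine dimH_le_of_frequently hfin (Eventually.frequently ?_)
      filter_upwards [hup' (D + δ) (by simpa using hδ)] with ε hε
      have e : ((Real.toNNReal D + δ : ℝ≥0) : ℝ) = D + δ := by
        rw [NNReal.coe_add, Real.coe_toNNReal _ hD.le]
      rw [e]; exact hε.le
    simpa [ENNReal.ofReal] using h1
  have hlow0 : ENNReal.ofReal D ≤ dimH F := by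
    refine le_of_forall_lt fun c hc => ?_
    obtain ⟨s, hs1, hs2⟩ := ENNReal.lt_iff_exists_nnreal_btwn.1 hc
    have hsD : (s : ℝ) < D := by
      rw [ENNReal.ofReal, ENNReal.coe_lt_coe] at hs2
      exact Real.lt_toNNReal_iff_coe_lt.1 hs2
    have hs0 : 0 < s := by
      have := (zero_le (a := c)).trans_lt hs1
      exact_mod_cast this
    exact hs1.trans_le (hlow s hs0 hsD)
  refine ⟨le_antisymm hup0 hlow0, hne, htb, tendsto_order.2 ⟨fun t ht => ?_, fun t ht => ?_⟩⟩
  · filter_upwards [hlow' t ht, self_mem_nhdsWithin, hlog.eventually_gt_atTop 0] with ε h1 hpos hl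
    have hpos' : (0 : ℝ) < ε := hpos
    rw [lt_div_iff₀ hl]
    have := Real.log_lt_log (Real.rpow_pos_of_pos hpos' _) h1
    rw [Real.log_rpow hpos'] at this
    linarith
  · filter_upwards [hup' t ht, self_mem_nhdsWithin, hlog.eventually_gt_atTop 0] with ε h1 hpos hl
    have hpos' : (0 : ℝ) < ε := hpos
    rw [div_lt_iff₀ hl]
    have := Real.log_lt_log (by linarith [hN1 ε hpos]) h1
    rw [Real.log_rpow hpos'] at this
    linarith

/-! ### Integrals for the energy estimate -/

theorem lintegral_max_rpow_lt_top {s : ℝ} (hs : 1 < s) :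
    ∫⁻ x : ℝ, max 1 ‖x‖ₑ ^ (-s) < ∞ := by
  have h1 : ∫⁻ x : ℝ, ENNReal.ofReal ((1 + ‖x‖) ^ (-s)) < ∞ :=
    finite_integral_one_add_norm (E := ℝ) (by simpa using hs)
  have hs0 : 0 ≤ s := by linarith
  calc ∫⁻ x : ℝ, max 1 ‖x‖ₑ ^ (-s)
      ≤ ∫⁻ x : ℝ, 2 ^ s * ENNReal.ofReal ((1 + ‖x‖) ^ (-s)) := by
        refine lintegral_mono fun x => ?_
        rw [← ENNReal.ofReal_rpow_of_pos (by positivity), ENNReal.ofReal_add one_pos.le (norm_nonneg _),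
          ENNReal.ofReal_one, ofReal_norm]
        have h2 : 1 + ‖x‖ₑ ≤ 2 * max 1 ‖x‖ₑ := by
          rw [two_mul]; exact add_le_add (le_max_left _ _) (le_max_right _ _)
        have h3 := ENNReal.rpow_le_rpow h2 hs0
        rw [ENNReal.mul_rpow_of_nonneg _ _ hs0] at h3
        have h4 : (max 1 ‖x‖ₑ : ℝ≥0∞) ≠ 0 := (zero_lt_one.trans_le (le_max_left _ _)).ne'
        have h5 : (max 1 ‖x‖ₑ : ℝ≥0∞) ≠ ∞ := by simp
        rw [ENNReal.rpow_neg, ENNReal.rpow_neg, ← div_eq_mul_inv,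
          ENNReal.le_div_iff_mul_le (by simp) (by left; finiteness), mul_comm, ← div_eq_mul_inv]
        exact ENNReal.div_le_of_le_mul h3
    _ = 2 ^ s * ∫⁻ x : ℝ, ENNReal.ofReal ((1 + ‖x‖) ^ (-s)) :=
        lintegral_const_mul' _ _ (by finiteness)
    _ < ∞ := ENNReal.mul_lt_top (by finiteness) h1

theorem lintegral_max_rpow {s : ℝ} {r : ℝ} (hr : 0 < r) :
    ∫⁻ x : ℝ, max (ENNReal.ofReal r) ‖x‖ₑ ^ (-s) =
      ENNReal.ofReal r ^ (1 - s) * ∫⁻ x : ℝ, max 1 ‖x‖ₑ ^ (-s) := by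
  have hr0 : ENNReal.ofReal r ≠ 0 := by simpa using hr
  have hm : Measurable fun x : ℝ => max (ENNReal.ofReal r) ‖x‖ₑ ^ (-s) := by fun_prop
  have h1 : ∫⁻ x : ℝ, max (ENNReal.ofReal r) ‖r * x‖ₑ ^ (-s) =
      ENNReal.ofReal r⁻¹ * ∫⁻ x : ℝ, max (ENNReal.ofReal r) ‖x‖ₑ ^ (-s) := by
    rw [← lintegral_map hm (measurable_const_mul r), Real.map_volume_mul_left hr.ne',
      lintegral_smul_measure, abs_of_pos (inv_pos.2 hr), smul_eq_mul]
  have h2 : ∀ x : ℝ, max (ENNReal.ofReal r) ‖r * x‖ₑ ^ (-s) =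
      ENNReal.ofReal r ^ (-s) * max 1 ‖x‖ₑ ^ (-s) := by
    intro x
    rw [enorm_mul, Real.enorm_of_nonneg hr.le, ← ENNReal.mul_rpow_of_ne_top (by finiteness) (by simp),
      mul_max_of_nonneg _ _ (by simp), mul_one]
  simp_rw [h2] at h1
  rw [lintegral_const_mul' _ _ (by finiteness)] at h1
  have h3 : ENNReal.ofReal r * ENNReal.ofReal r⁻¹ = 1 := by
    rw [← ENNReal.ofReal_mul hr.le, mul_inv_cancel₀ hr.ne', ENNReal.ofReal_one]
  calc ∫⁻ x : ℝ, max (ENNReal.ofReal r) ‖x‖ₑ ^ (-s)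
      = ENNReal.ofReal r * (ENNReal.ofReal r⁻¹ * ∫⁻ x : ℝ, max (ENNReal.ofReal r) ‖x‖ₑ ^ (-s)) := by
        rw [← mul_assoc, h3, one_mul]
    _ = _ := by
        rw [← h1, ← mul_assoc, sub_eq_add_neg, ENNReal.rpow_add _ _ hr0 (by finiteness), ENNReal.rpow_one]

/-- The Gaussian density is at most 1/σ, and the remaining Lebesgue integral scales in r. -/
theorem lintegral_max_rpow_gaussianReal_le {s : ℝ} (r : ℝ) (hr : 0 < r)
    {σ : ℝ≥0} (hσ : σ ≠ 0) :
    ∫⁻ x, max (ENNReal.ofReal r) ‖x‖ₑ ^ (-s) ∂gaussianReal 0 (σ ^ 2) ≤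
      (∫⁻ x : ℝ, max 1 ‖x‖ₑ ^ (-s)) * ENNReal.ofReal r ^ (1 - s) * (σ : ℝ≥0∞)⁻¹ := by
  rw [gaussianReal_of_var_ne_zero _ (pow_ne_zero 2 hσ),
    lintegral_withDensity_eq_lintegral_mul _ (measurable_gaussianPDF _ _) (by fun_prop)]
  have hσ0 : (0 : ℝ) < σ := by positivity
  have hpdf : ∀ x, gaussianPDF 0 (σ ^ 2) x ≤ (σ : ℝ≥0∞)⁻¹ := by
    intro x
    rw [gaussianPDF, gaussianPDFReal, ← ENNReal.coe_inv hσ, ← ENNReal.ofReal_coe_nnreal]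
    refine ENNReal.ofReal_le_ofReal ?_
    rw [NNReal.coe_inv]
    have h1 : (√(2 * Real.pi * (σ ^ 2 : ℝ≥0)))⁻¹ ≤ (σ : ℝ)⁻¹ := by
      refine inv_anti₀ hσ0 (Real.le_sqrt_of_sq_le ?_)
      push_cast
      nlinarith [Real.pi_gt_three, sq_nonneg (σ : ℝ)]
    have h2 : Real.exp (-(x - 0) ^ 2 / (2 * (σ ^ 2 : ℝ≥0))) ≤ 1 := by
      rw [Real.exp_le_one_iff]
      exact div_nonpos_of_nonpos_of_nonneg (by nlinarith [sq_nonneg (x - 0)]) (by positivity)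
    calc _ ≤ (σ : ℝ)⁻¹ * 1 := by gcongr
      _ = _ := mul_one _
  calc _ ≤ ∫⁻ x : ℝ, (σ : ℝ≥0∞)⁻¹ * max (ENNReal.ofReal r) ‖x‖ₑ ^ (-s) := by
        refine lintegral_mono fun x => ?_
        exact mul_le_mul_left (hpdf x) _
    _ = _ := by
        rw [lintegral_const_mul' _ _ (by simpa using hσ), lintegral_max_rpow hr]
        ring

theorem integrable_indicator_abs_rpow {θ R : ℝ} (hθ : θ < 1) :
    Integrable ((Set.Icc (-R) R).indicator fun t : ℝ => |t| ^ (-θ)) := by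
  rw [integrable_indicator_iff measurableSet_Icc]
  rcases le_or_gt R 0 with hR | hR
  · refine (integrableOn_singleton (x := (0 : ℝ)) (f := fun t : ℝ => |t| ^ (-θ)) (μ := volume) (by simp) (by simp)).mono_set ?_
    intro t ht
    rw [Set.mem_singleton_iff]
    linarith [ht.1, ht.2]
  have h1 : IntegrableOn (fun t : ℝ => |t| ^ (-θ)) (Set.Icc 0 R) := by
    have := intervalIntegral.intervalIntegrable_rpow' (a := 0) (b := R) (r := -θ) (by linarith)
    rw [intervalIntegrable_iff_integrableOn_Icc_of_le hR.le] at this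
    exact this.congr_fun (fun t ht => by rw [abs_of_nonneg ht.1]) measurableSet_Icc
  have h2 : IntegrableOn (fun t : ℝ => |t| ^ (-θ)) (Set.Icc (-R) 0) := by
    have := (Measure.measurePreserving_neg (volume : Measure ℝ)).integrableOn_comp_preimage
      (MeasurableEquiv.neg ℝ).measurableEmbedding (f := fun t : ℝ => |t| ^ (-θ)) (s := Set.Icc 0 R)
    have := this.2 h1
    simpa [Function.comp_def] using this
  have := h2.union h1
  rwa [Set.Icc_union_Icc_eq_Icc (by linarith) hR.le] at this

theorem ennreal_prod_rpow {ι : Type*} (t : Finset ι) (f : ι → ℝ) {x : ℝ≥0∞} (h0 : x ≠ 0)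
    (htop : x ≠ ∞) : ∏ i ∈ t, x ^ f i = x ^ ∑ i ∈ t, f i := by
  classical
  induction t using Finset.induction_on with
  | empty => simp
  | insert a t ha ih => rw [Finset.prod_insert ha, Finset.sum_insert ha, ih, ENNReal.rpow_add _ _ h0 htop]

/-- Since |y_i| ≤ ‖y‖, the power ‖y‖^(1-s) can be distributed over the coordinates, which bounds the
integrand by a product of one-variable powers |y_i|^(-θ_i) with every θ_i < 1. -/
theorem lintegral_norm_rpow_mul_coord_rpow_lt_top {d : ℕ} (i₀ : Fin d) {s γ : ℝ}
    (hγ1 : γ < 1) (hs1 : 1 < s) (hs : s < d + 1 - γ) (R : ℝ) :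
    ∫⁻ y in Metric.closedBall (0 : EuclideanSpace ℝ (Fin d)) R,
      ‖y‖ₑ ^ (1 - s) * ‖y i₀‖ₑ ^ (-γ) < ∞ := by
  have hdγ : 0 < d - γ := by linarith
  -- The weights α are t(1-γ) at i₀ and t elsewhere, with sum t(d-γ) = s - 1. Every θ_i is below 1
  -- once t < 1, which is the hypothesis s < d + 1 - γ.
  set t := (s - 1) / (d - γ) with ht
  have ht0 : 0 < t := div_pos (by linarith) hdγ
  have ht1 : t < 1 := by rw [ht, div_lt_one hdγ]; linarith
  have htm : t * (d - γ) = s - 1 := by rw [ht]; field_simp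
  set α : Fin d → ℝ := fun i => if i = i₀ then t * (1 - γ) else t with hα
  set θ : Fin d → ℝ := fun i => if i = i₀ then t * (1 - γ) + γ else t with hθ
  have hα0 : ∀ i, 0 ≤ α i := fun i => by
    simp only [hα]; split_ifs
    · exact mul_nonneg ht0.le (by linarith)
    · exact ht0.le
  have hθ1 : ∀ i, θ i < 1 := fun i => by
    simp only [hθ]; split_ifs
    · nlinarith
    · exact ht1
  have hαsum : ∑ i, α i = s - 1 := by
    have e : ∀ i, α i = t - if i = i₀ then t * γ else 0 := fun i => by
      simp only [hα]; split_ifs <;> ring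
    simp only [e, Finset.sum_sub_distrib, Finset.sum_ite_eq', Finset.mem_univ, if_true,
      Finset.sum_const, Finset.card_univ, Fintype.card_fin, nsmul_eq_mul]
    linarith
  set F : (Fin d → ℝ) → ℝ := fun y => ∏ i, (Set.Icc (-R) R).indicator (fun t : ℝ => |t| ^ (-θ i)) (y i) with hF
  have hFint : Integrable F :=
    Integrable.fintype_prod fun i => integrable_indicator_abs_rpow (hθ1 i)
  have hFint' : Integrable (fun y : EuclideanSpace ℝ (Fin d) => F y.ofLp) :=
    (EuclideanSpace.volume_preserving_symm_measurableEquiv_toLp (Fin d)).integrable_comp_of_integrable hFint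
  have hae : ∀ᵐ y : EuclideanSpace ℝ (Fin d), ∀ i, y i ≠ 0 := by
    rw [ae_all_iff]
    intro i
    have h1 : ∀ᵐ y : Fin d → ℝ, y i ≠ 0 :=
      (Measure.quasiMeasurePreserving_eval (fun _ : Fin d => (volume : Measure ℝ)) i).ae
        (p := fun t : ℝ => t ≠ 0) (by simp [ae_iff])
    exact (EuclideanSpace.volume_preserving_symm_measurableEquiv_toLp (Fin d)).quasiMeasurePreserving.ae h1
  refine lt_of_le_of_lt ?_ hFint'.lintegral_lt_top
  rw [← lintegral_indicator Metric.isClosed_closedBall.measurableSet]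
  refine lintegral_mono_ae ?_
  filter_upwards [hae] with y hy
  by_cases hyR : y ∈ Metric.closedBall (0 : EuclideanSpace ℝ (Fin d)) R
  swap
  · rw [Set.indicator_of_notMem hyR]; exact zero_le
  rw [Set.indicator_of_mem hyR]
  have hnorm : ∀ i, ‖y i‖ₑ ≤ ‖y‖ₑ := fun i => by
    rw [← ofReal_norm, ← ofReal_norm]; exact ENNReal.ofReal_le_ofReal (PiLp.norm_apply_le y i)
  have hy0 : ‖y‖ₑ ≠ 0 := fun h => by
    have h2 := hnorm i₀
    rw [h] at h2
    exact hy i₀ (by simpa using h2)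
  have hFy : ENNReal.ofReal (F y.ofLp) = ∏ i, ‖y i‖ₑ ^ (-θ i) := by
    rw [hF, ENNReal.ofReal_prod_of_nonneg (fun i _ => Set.indicator_nonneg (fun _ _ => by positivity) _)]
    refine Finset.prod_congr rfl fun i _ => ?_
    have hmem : y i ∈ Set.Icc (-R) R := by
      have := (PiLp.norm_apply_le y i).trans (mem_closedBall_zero_iff.1 hyR)
      rwa [Real.norm_eq_abs, abs_le] at this
    rw [Set.indicator_of_mem hmem, ← ENNReal.ofReal_rpow_of_pos (abs_pos.2 (hy i)), ← Real.norm_eq_abs, ofReal_norm]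
  rw [hFy]
  have e1 : ‖y‖ₑ ^ (1 - s) = ∏ i, ‖y‖ₑ ^ (-α i) := by
    rw [ennreal_prod_rpow _ _ hy0 (by simp), Finset.sum_neg_distrib, hαsum, neg_sub]
  have e2 : ‖y i₀‖ₑ ^ (-γ) = ∏ i, ‖y i‖ₑ ^ (if i = i₀ then -γ else 0) := by
    rw [Finset.prod_eq_single i₀ (fun i _ hi => by simp [hi]) (by simp)]
    simp
  rw [e1, e2, ← Finset.prod_mul_distrib]
  refine Finset.prod_le_prod' fun i _ => ?_
  have e3 : -θ i = -α i + if i = i₀ then -γ else 0 := by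
    simp only [hθ, hα]; split_ifs <;> ring
  have hyi : ‖y i‖ₑ ≠ 0 := by simpa using hy i
  rw [e3, ENNReal.rpow_add _ _ hyi (by simp)]
  gcongr ?_ * _
  rw [ENNReal.rpow_neg, ENNReal.rpow_neg]
  exact ENNReal.inv_le_inv.2 (ENNReal.rpow_le_rpow (hnorm i) (hα0 i))

/-- A rotation taking u/‖u‖ to a basis vector reduces this to the coordinate case. -/
theorem lintegral_norm_rpow_mul_inner_rpow_lt_top {d : ℕ} {u : EuclideanSpace ℝ (Fin d)}
    (hu : u ≠ 0) {s γ : ℝ}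
    (hγ1 : γ < 1) (hs1 : 1 < s) (hs : s < d + 1 - γ) (R : ℝ) :
    ∫⁻ y in Metric.closedBall (0 : EuclideanSpace ℝ (Fin d)) R,
      ‖y‖ₑ ^ (1 - s) * ‖inner ℝ u y‖ₑ ^ (-γ) < ∞ := by
  have hd : 0 < d := by
    rcases Nat.eq_zero_or_pos d with rfl | h
    · exact absurd (Subsingleton.elim u 0) hu
    · exact h
  set i₀ : Fin d := ⟨0, hd⟩
  have hun : 0 < ‖u‖ := norm_pos_iff.2 hu
  obtain ⟨b, hb⟩ := Orthonormal.exists_orthonormalBasis_extension_of_card_eq (𝕜 := ℝ)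
    (E := EuclideanSpace ℝ (Fin d)) (ι := Fin d) (by simp) (v := fun _ => (‖u‖⁻¹ : ℝ) • u) (s := {i₀}) (by
      constructor
      · intro i
        simp [Set.domRestrict, norm_smul, hun.ne']
      · intro i j hij
        exact absurd (Subsingleton.elim i j) hij)
  have hb0 : b i₀ = (‖u‖⁻¹ : ℝ) • u := hb i₀ rfl
  have hinner : ∀ y, inner ℝ u y = ‖u‖ * b.repr y i₀ := by
    intro y
    rw [OrthonormalBasis.repr_apply_apply, hb0, real_inner_smul_left, ← mul_assoc,
      mul_inv_cancel₀ hun.ne', one_mul]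
  have hmp := b.measurePreserving_repr
  have hpre : Metric.closedBall (0 : EuclideanSpace ℝ (Fin d)) R = b.repr ⁻¹' Metric.closedBall 0 R := by
    ext y; simp
  have key := hmp.setLIntegral_comp_preimage_emb b.repr.toHomeomorph.measurableEmbedding
    (fun y : EuclideanSpace ℝ (Fin d) => ‖y‖ₑ ^ (1 - s) * ‖y i₀‖ₑ ^ (-γ)) (Metric.closedBall 0 R)
  have hlt := lintegral_norm_rpow_mul_coord_rpow_lt_top i₀ hγ1 hs1 hs R
  rw [← key, ← hpre] at hlt
  have e : ∀ y, ‖y‖ₑ ^ (1 - s) * ‖inner ℝ u y‖ₑ ^ (-γ) =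
      ‖u‖ₑ ^ (-γ) * (‖b.repr y‖ₑ ^ (1 - s) * ‖b.repr y i₀‖ₑ ^ (-γ)) := by
    intro y
    rw [hinner, enorm_mul, enorm_norm, ENNReal.mul_rpow_of_ne_top (by simp) (by simp),
      LinearIsometryEquiv.enorm_map]
    ring
  simp_rw [e]
  have hc : ‖u‖ₑ ^ (-γ) ≠ ∞ := ENNReal.rpow_ne_top_of_ne_zero (by simpa using hu) (by simp)
  rw [lintegral_const_mul' _ _ hc]
  exact ENNReal.mul_lt_top hc.lt_top hlt

/-! ### Lower bound for the Hausdorff dimension of the graph -/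

/-- Joint measurability, needed for Tonelli, requires exact measurability and continuity of every
path. Setting X to 0 on one measurable null set G gives both: on a countable dense set X agrees off
G with measurable functions, and the other values are limits of these. -/
theorem exists_continuous_modification {V Ω : Type*} [PseudoMetricSpace V]
    [SecondCountableTopology V] [MeasurableSpace Ω] {P : Measure Ω}
    {X : V → Ω → ℝ} (hXm : ∀ x, AEMeasurable (X x) P)
    (hXc : ∀ᵐ ω ∂P, Continuous fun x => X x ω) :
    ∃ X' : V → Ω → ℝ, (∀ x, Measurable (X' x)) ∧ (∀ ω, Continuous fun x => X' x ω) ∧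
      ∀ᵐ ω ∂P, ∀ x, X' x ω = X x ω := by
  classical
  obtain ⟨D, hDc, hDd⟩ := TopologicalSpace.exists_countable_dense V
  have hgood : ∀ᵐ ω ∂P, Continuous (fun x => X x ω) ∧ ∀ q ∈ D, X q ω = (hXm q).mk _ ω :=
    hXc.and ((ae_ball_iff hDc).2 fun q _ => (hXm q).ae_eq_mk)
  obtain ⟨G, hGsub, hGm, hG0⟩ := exists_measurable_superset_of_null hgood
  have hG : ∀ ω ∉ G, Continuous (fun x => X x ω) ∧ ∀ q ∈ D, X q ω = (hXm q).mk _ ω := by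
    intro ω hω
    by_contra hcon
    exact hω (hGsub hcon)
  refine ⟨fun x => Gᶜ.indicator (X x), fun x => ?_, fun ω => ?_, ?_⟩
  · have hDm : ∀ q ∈ D, Measurable (Gᶜ.indicator (X q)) := by
      intro q hq
      have : Gᶜ.indicator (X q) = Gᶜ.indicator ((hXm q).mk _) :=
        Set.indicator_congr fun ω hω => (hG ω hω).2 q hq
      rw [this]
      exact (hXm q).measurable_mk.indicator hGm.compl
    obtain ⟨q, hqD, hq⟩ := mem_closure_iff_seq_limit.1 (hDd x)
    refine measurable_of_tendsto_metrizable (fun k => hDm (q k) (hqD k)) (tendsto_pi_nhds.2 fun ω => ?_)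
    by_cases hω : ω ∈ G
    · have e : ∀ x, Gᶜ.indicator (X x) ω = 0 := fun x => Set.indicator_of_notMem (by simpa using hω) _
      simp_rw [e]; exact tendsto_const_nhds
    · have e : ∀ x, Gᶜ.indicator (X x) ω = X x ω := fun x => Set.indicator_of_mem hω _
      simp_rw [e]; exact ((hG ω hω).1.tendsto x).comp hq
  · by_cases hω : ω ∈ G
    · have : (fun x => Gᶜ.indicator (X x) ω) = fun _ => 0 :=
        funext fun x => Set.indicator_of_notMem (by simpa using hω) _
      rw [this]; exact continuous_const
    · have : (fun x => Gᶜ.indicator (X x) ω) = fun x => X x ω :=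
        funext fun x => Set.indicator_of_mem hω _
      rw [this]; exact (hG ω hω).1
  · filter_upwards [compl_mem_ae_iff.2 hG0] with ω hω x
    exact Set.indicator_of_mem hω _

theorem lintegral_edist_graph_rpow_le {Ω : Type*} [MeasurableSpace Ω] {P : Measure Ω}
    {Y : Ω → ℝ} (hYm : Measurable Y) {σ : ℝ≥0} (hσ0 : σ ≠ 0)
    (hlaw : P.map Y = gaussianReal 0 (σ ^ 2)) {r b c γ s : ℝ} (hr : 0 < r) (hc : 0 < c)
    (hγ0 : 0 ≤ γ) (hσ : c * |b| ^ γ ≤ σ) :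
    ∫⁻ ω, max (ENNReal.ofReal r) ‖Y ω‖ₑ ^ (-s) ∂P ≤
      (∫⁻ x : ℝ, max 1 ‖x‖ₑ ^ (-s)) * (ENNReal.ofReal c)⁻¹ *
        (ENNReal.ofReal r ^ (1 - s) * ‖b‖ₑ ^ (-γ)) := by
  have h1 : ∫⁻ ω, max (ENNReal.ofReal r) ‖Y ω‖ₑ ^ (-s) ∂P =
      ∫⁻ z, max (ENNReal.ofReal r) ‖z‖ₑ ^ (-s) ∂gaussianReal 0 (σ ^ 2) := by
    rw [← hlaw, lintegral_map (by fun_prop) hYm]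
  rw [h1]
  refine (lintegral_max_rpow_gaussianReal_le _ hr hσ0).trans ?_
  have h2 : ENNReal.ofReal c * ‖b‖ₑ ^ γ ≤ σ := by
    have h3 := ENNReal.ofReal_le_ofReal hσ
    rwa [ENNReal.ofReal_mul hc.le, ENNReal.ofReal_coe_nnreal,
      ← ENNReal.ofReal_rpow_of_nonneg (abs_nonneg _) hγ0, ← Real.norm_eq_abs, ofReal_norm] at h3
  have h3 : (σ : ℝ≥0∞)⁻¹ ≤ (ENNReal.ofReal c)⁻¹ * ‖b‖ₑ ^ (-γ) := by
    refine (ENNReal.inv_le_inv.2 h2).trans ?_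
    rw [ENNReal.mul_inv (by left; simpa using hc) (by left; finiteness), ENNReal.rpow_neg]
  calc _ ≤ (∫⁻ x : ℝ, max 1 ‖x‖ₑ ^ (-s)) * ENNReal.ofReal r ^ (1 - s) *
        ((ENNReal.ofReal c)⁻¹ * ‖b‖ₑ ^ (-γ)) := by gcongr
    _ = _ := by ring

theorem setLIntegral_sub_le {d : ℕ} {K : Set (EuclideanSpace ℝ (Fin d))} (hK : MeasurableSet K)
    {R : ℝ} (hR : K ⊆ Metric.closedBall 0 R) (f : EuclideanSpace ℝ (Fin d) → ℝ≥0∞)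
    {x : EuclideanSpace ℝ (Fin d)} (hx : x ∈ K) :
    ∫⁻ y in K, f (x - y) ≤ ∫⁻ y in Metric.closedBall 0 (2 * R), f y := by
  rw [← lintegral_indicator hK, ← lintegral_indicator Metric.isClosed_closedBall.measurableSet,
    ← lintegral_sub_left_eq_self (μ := volume) (Set.indicator (Metric.closedBall 0 (2 * R)) _) x]
  refine lintegral_mono fun y => ?_
  by_cases hy : y ∈ K
  · rw [Set.indicator_of_mem hy, Set.indicator_of_mem]
    rw [mem_closedBall_zero_iff]
    have h2 := mem_closedBall_zero_iff.1 (hR hx)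
    have h3 := mem_closedBall_zero_iff.1 (hR hy)
    linarith [norm_sub_le x y]
  · rw [Set.indicator_of_notMem hy]; exact zero_le

/-- The energy is that of Lebesgue measure on K pushed forward to the graph. -/
theorem le_dimH_graphOver_of_energy {d : ℕ} {K : Set (EuclideanSpace ℝ (Fin d))} (hK : IsCompact K)
    (hK0 : 0 < volume K) {f : EuclideanSpace ℝ (Fin d) → ℝ} (hf : Continuous f) {s : ℝ≥0}
    (hs : 0 < s) (h : ∫⁻ x in K, ∫⁻ y in K, max (edist x y) (edist (f x) (f y)) ^ (-(s : ℝ)) ≠ ∞) :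
    (s : ℝ≥0∞) ≤ dimH (graphOver K f) := by
  have hcont : Continuous fun x => (x, f x) := continuous_id.prodMk hf
  have hFc : IsCompact (graphOver K f) := hK.image hcont
  have : IsFiniteMeasure (volume.restrict K) := ⟨by
    rw [Measure.restrict_apply_univ]; exact hK.measure_lt_top⟩
  refine le_dimH_of_energy_ne_top ((volume.restrict K).map fun x => (x, f x))
    hFc.isClosed.measurableSet ?_ hs ?_
  · rw [Measure.map_apply hcont.measurable hFc.isClosed.measurableSet]
    have : K ⊆ (fun x => (x, f x)) ⁻¹' (graphOver K f) := Set.subset_preimage_image _ _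
    refine (lt_of_lt_of_le ?_ (measure_mono this)).ne'
    rwa [Measure.restrict_apply_self]
  · refine ne_top_of_le_ne_top ?_ (setLIntegral_le_lintegral _ _)
    have hm4 : Measurable fun p : (EuclideanSpace ℝ (Fin d) × ℝ) × (EuclideanSpace ℝ (Fin d) × ℝ) =>
        edist p.1 p.2 ^ (-(s : ℝ)) := by fun_prop
    rw [lintegral_map hm4.lintegral_prod_right' hcont.measurable]
    refine ne_of_eq_of_ne (lintegral_congr fun x => ?_) h
    rw [lintegral_map (by fun_prop) hcont.measurable]
    rfl

/-- By Tonelli the expected energy is a double integral over K of a function of x - y, which is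
locally integrable. Hence the energy is almost surely finite. -/
theorem ae_le_dimH_graphOver {d : ℕ} {Ω : Type*} [MeasurableSpace Ω] {P : Measure Ω}
    [IsProbabilityMeasure P] {X : EuclideanSpace ℝ (Fin d) → Ω → ℝ}
    (hXm : ∀ x, Measurable (X x)) (hXc : ∀ ω, Continuous fun x => X x ω)
    {σ : EuclideanSpace ℝ (Fin d) → ℝ≥0}
    (hlaw : ∀ x y, P.map (fun ω => X x ω - X y ω) = gaussianReal 0 (σ (x - y) ^ 2))
    {K : Set (EuclideanSpace ℝ (Fin d))} (hK : IsCompact K) (hK0 : 0 < volume K)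
    {u : EuclideanSpace ℝ (Fin d)} (hu : u ≠ 0) {c γ : ℝ} (hc : 0 < c) (hγ0 : 0 ≤ γ) (hγ1 : γ < 1)
    (hσ0 : ∀ x, x ≠ 0 → σ x ≠ 0)
    (hσ : ∀ x, c * |inner ℝ u x| ^ γ ≤ σ x) {s : ℝ≥0} (hs1 : 1 < s) (hs : s < d + 1 - γ) :
    ∀ᵐ ω ∂P, (s : ℝ≥0∞) ≤ dimH (graphOver K fun x => X x ω) := by
  set μ : Measure (EuclideanSpace ℝ (Fin d)) := volume.restrict K with hμ
  have hs1' : (1 : ℝ) < s := by exact_mod_cast hs1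
  have : IsFiniteMeasure μ := ⟨by
    rw [hμ, Measure.restrict_apply_univ]; exact hK.measure_lt_top⟩
  -- Positive dimension makes Lebesgue measure free of atoms, so the diagonal y = x can be
  -- discarded.
  have : Nontrivial (EuclideanSpace ℝ (Fin d)) := ⟨u, 0, hu⟩
  have hjoint : Measurable (Function.uncurry X) :=
    (stronglyMeasurable_uncurry_of_continuous_of_stronglyMeasurable (u := X) hXc
      fun x => (hXm x).stronglyMeasurable).measurable
  obtain ⟨Φ, hΦ⟩ : ∃ Φ : EuclideanSpace ℝ (Fin d) × EuclideanSpace ℝ (Fin d) → Ω → ℝ≥0∞,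
      ∀ x y ω, Φ (x, y) ω = max (edist x y) (edist (X x ω) (X y ω)) ^ (-(s : ℝ)) :=
    ⟨fun p ω => max (edist p.1 p.2) (edist (X p.1 ω) (X p.2 ω)) ^ (-(s : ℝ)), fun _ _ _ => rfl⟩
  have hΦm : Measurable (Function.uncurry Φ) := by
    have e : Function.uncurry Φ = fun q =>
        max (edist q.1.1 q.1.2) (edist (X q.1.1 q.2) (X q.1.2 q.2)) ^ (-(s : ℝ)) :=
      funext fun q => hΦ q.1.1 q.1.2 q.2
    rw [e]
    have h1 : Measurable fun q : (EuclideanSpace ℝ (Fin d) × EuclideanSpace ℝ (Fin d)) × Ω =>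
        X q.1.1 q.2 := hjoint.comp ((measurable_fst.comp measurable_fst).prodMk measurable_snd)
    have h2 : Measurable fun q : (EuclideanSpace ℝ (Fin d) × EuclideanSpace ℝ (Fin d)) × Ω =>
        X q.1.2 q.2 := hjoint.comp ((measurable_snd.comp measurable_fst).prodMk measurable_snd)
    have h3 : Measurable fun q : (EuclideanSpace ℝ (Fin d) × EuclideanSpace ℝ (Fin d)) × Ω =>
        edist q.1.1 q.1.2 := by fun_prop
    exact (h3.max (h1.edist h2)).pow_const _
  obtain ⟨J, hJfin, hJ⟩ : ∃ J : ℝ≥0∞, J < ∞ ∧ ∀ x y, x ≠ y → ∫⁻ ω, Φ (x, y) ω ∂P ≤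
      J * (‖x - y‖ₑ ^ (1 - (s : ℝ)) * ‖inner ℝ u (x - y)‖ₑ ^ (-γ)) := by
    refine ⟨(∫⁻ x : ℝ, max 1 ‖x‖ₑ ^ (-(s : ℝ))) * (ENNReal.ofReal c)⁻¹,
      ENNReal.mul_lt_top (lintegral_max_rpow_lt_top hs1') (by simpa using hc), fun x y hxy => ?_⟩
    have hxy' := sub_ne_zero.2 hxy
    have h1 := lintegral_edist_graph_rpow_le (s := s) ((hXm x).sub (hXm y)) (hσ0 _ hxy') (hlaw x y)
      (norm_pos_iff.2 hxy') hc hγ0 (hσ (x - y))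
    rw [ofReal_norm] at h1
    refine le_trans (lintegral_mono fun ω => ?_) h1
    rw [hΦ, edist_eq_enorm_sub, edist_eq_enorm_sub, Pi.sub_apply]
  obtain ⟨R, hR⟩ := hK.isBounded.subset_closedBall (0 : EuclideanSpace ℝ (Fin d))
  have hLfin := lintegral_norm_rpow_mul_inner_rpow_lt_top hu hγ1 hs1' hs (2 * R)
  set L := ∫⁻ y in Metric.closedBall (0 : EuclideanSpace ℝ (Fin d)) (2 * R),
      ‖y‖ₑ ^ (1 - (s : ℝ)) * ‖inner ℝ u y‖ₑ ^ (-γ) with hL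
  have hin : ∀ x ∈ K, ∫⁻ y in K, ∫⁻ ω, Φ (x, y) ω ∂P ≤ J * L := by
    intro x hx
    have h1 : ∫⁻ y in K, ∫⁻ ω, Φ (x, y) ω ∂P ≤ ∫⁻ y in K, J *
        (‖x - y‖ₑ ^ (1 - (s : ℝ)) * ‖inner ℝ u (x - y)‖ₑ ^ (-γ)) := by
      refine lintegral_mono_ae (ae_restrict_of_ae ?_)
      have : ∀ᵐ y : EuclideanSpace ℝ (Fin d), y ≠ x := by simp [ae_iff]
      filter_upwards [this] with y hy using hJ x y hy.symm
    refine h1.trans ?_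
    rw [lintegral_const_mul' _ _ hJfin.ne]
    gcongr
    exact setLIntegral_sub_le hK.isClosed.measurableSet hR
      (fun y => ‖y‖ₑ ^ (1 - (s : ℝ)) * ‖inner ℝ u y‖ₑ ^ (-γ)) hx
  have htot : ∫⁻ ω, ∫⁻ p, Φ p ω ∂(μ.prod μ) ∂P < ∞ := by
    rw [lintegral_lintegral_swap (f := fun ω p => Φ p ω) (hΦm.comp measurable_swap).aemeasurable]
    have hm2 : Measurable fun p => ∫⁻ ω, Φ p ω ∂P := hΦm.lintegral_prod_right'
    rw [lintegral_prod _ hm2.aemeasurable]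
    refine (setLIntegral_mono' hK.isClosed.measurableSet hin).trans_lt ?_
    rw [setLIntegral_const]
    exact ENNReal.mul_lt_top (ENNReal.mul_lt_top hJfin hLfin) hK.measure_lt_top
  have hm3 : Measurable fun ω => ∫⁻ p, Φ p ω ∂(μ.prod μ) :=
    Measurable.lintegral_prod_right' (f := fun q : Ω × _ => Φ q.2 q.1) (hΦm.comp measurable_swap)
  filter_upwards [ae_lt_top hm3 htot.ne] with ω hω
  refine le_dimH_graphOver_of_energy hK hK0 (hXc ω) (zero_lt_one.trans hs1) ?_
  rw [lintegral_prod (fun p => Φ p ω) (hΦm.comp measurable_prodMk_right).aemeasurable] at hω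
  simp_rw [hΦ] at hω
  exact hω.ne

/-! ### Upper bound for the box dimension: nets, chaining and box counting -/

/-- Finite nets `S k` of mesh `2 ^ (-k)` of the bounded set `K` with at most `(B 2 ^ k) ^ d` points,
together with nearest point maps. -/
structure IsDyadicNet {d : ℕ} (K : Set (EuclideanSpace ℝ (Fin d))) (B : ℕ)
    (S : ℕ → Finset (EuclideanSpace ℝ (Fin d)))
    (π : ℕ → EuclideanSpace ℝ (Fin d) → EuclideanSpace ℝ (Fin d)) : Prop where
  mem : ∀ k, ∀ x ∈ K, π k x ∈ S k
  norm_sub_le : ∀ k, ∀ x ∈ K, ‖x - π k x‖ ≤ (1 / 2) ^ k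
  card_le : ∀ k, (S k).card ≤ (B * 2 ^ k) ^ d

/-- The net is a grid of mesh 2^(-k)/d and π rounds each coordinate down, so the d coordinate errors
add up to at most 2^(-k). -/
theorem exists_isDyadicNet {d : ℕ} {K : Set (EuclideanSpace ℝ (Fin d))}
    (hK : Bornology.IsBounded K) : ∃ B S π, IsDyadicNet K B S π := by
  classical
  obtain ⟨R, hR⟩ := hK.subset_closedBall 0
  obtain ⟨M, hM⟩ := exists_nat_ge R
  set e : ℕ → (Fin d → ℤ) → EuclideanSpace ℝ (Fin d) := fun k m =>
    WithLp.toLp 2 fun i => (m i : ℝ) / (d * 2 ^ k) with he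
  -- Each coordinate takes 2·d·2^k·M + 1 values, at most (2dM + 1)·2^k.
  refine ⟨2 * d * M + 1, fun k => (Fintype.piFinset fun _ : Fin d =>
    Finset.Icc (-(d * 2 ^ k * M : ℤ)) (d * 2 ^ k * M)).image (e k),
    fun k x => e k fun i => ⌊x i * (d * 2 ^ k)⌋, fun k x hx => ?_, fun k x hx => ?_, fun k => ?_⟩
  · refine Finset.mem_image_of_mem _ (Fintype.mem_piFinset.2 fun i => ?_)
    have h1 : |x i| ≤ M := (PiLp.norm_apply_le x i).trans ((mem_closedBall_zero_iff.1 (hR hx)).trans hM)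
    have h0 : (0 : ℝ) ≤ d * 2 ^ k := by positivity
    rw [abs_le] at h1
    rw [Finset.mem_Icc, Int.le_floor, ← Int.lt_add_one_iff, Int.floor_lt]
    push_cast
    constructor <;> nlinarith
  · refine (euclidean_norm_le_sum _).trans ?_
    have h1 : ∀ i : Fin d, ‖(x - e k fun i => ⌊x i * (d * 2 ^ k)⌋) i‖ ≤ (1 / 2) ^ k / d := by
      intro i
      have hd : (0 : ℝ) < d := by exact_mod_cast Fin.pos i
      have hp : (0 : ℝ) < d * 2 ^ k := by positivity
      have e1 : (x - e k fun i => ⌊x i * (d * 2 ^ k)⌋) i =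
          (x i * (d * 2 ^ k) - ⌊x i * (d * 2 ^ k)⌋) / (d * 2 ^ k) := by
        simp only [he, PiLp.sub_apply]
        field_simp
      rw [e1, norm_div, Real.norm_of_nonneg hp.le, Int.self_sub_floor,
        Real.norm_of_nonneg (Int.fract_nonneg _),
        div_le_iff₀ hp]
      refine (Int.fract_lt_one _).le.trans (le_of_eq ?_)
      rw [one_div, inv_pow]; field_simp
    refine (Finset.sum_le_sum fun i _ => h1 i).trans ?_
    rcases Nat.eq_zero_or_pos d with rfl | hd
    · simp
    · have : (d : ℝ) ≠ 0 := by positivity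
      simp only [Finset.sum_const, Finset.card_univ, Fintype.card_fin, nsmul_eq_mul]
      rw [mul_div_cancel₀ _ this]
  · refine Finset.card_image_le.trans ?_
    rw [Fintype.card_piFinset_const, Int.card_Icc]
    gcongr
    have : ((d * 2 ^ k * M : ℤ) + 1 - -(d * 2 ^ k * M : ℤ)).toNat = 2 * (d * 2 ^ k * M) + 1 := by
      have : ((d * 2 ^ k * M : ℤ) + 1 - -(d * 2 ^ k * M : ℤ)) = ((2 * (d * 2 ^ k * M) + 1 : ℕ) : ℤ) := by
        push_cast; ring
      rw [this, Int.toNat_natCast]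
    rw [this]
    nlinarith [Nat.one_le_two_pow (n := k)]

/-- Markov's inequality for the m-th moment, with σ scaled out. The order m is free because a
Gaussian has all moments. -/
theorem exists_lintegral_enorm_rpow_gaussianReal (m : ℕ) :
    ∃ c : ℝ≥0, ∀ (σ : ℝ≥0) (t : ℝ≥0), t ≠ 0 →
      gaussianReal 0 (σ ^ 2) {x | (t : ℝ≥0∞) ≤ ‖x‖ₑ} ≤ c * (σ / t : ℝ≥0) ^ m := by
  have hfin : ∫⁻ x, ‖x‖ₑ ^ m ∂gaussianReal 0 1 ≠ ∞ := by
    have h1 := (memLp_id_gaussianReal (μ := 0) (v := 1) (m : ℝ≥0)).integrable_norm_pow' 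
    have h2 := h1.hasFiniteIntegral
    rw [HasFiniteIntegral] at h2
    simpa using h2.ne
  refine ⟨(∫⁻ x, ‖x‖ₑ ^ m ∂gaussianReal 0 1).toNNReal, fun σ t ht => ?_⟩
  rw [ENNReal.coe_toNNReal hfin]
  have hmap : gaussianReal 0 (σ ^ 2) = (gaussianReal 0 1).map (fun x => (σ : ℝ) * x) := by
    rw [gaussianReal_map_const_mul]
    congr 1
    · simp
    · ext; simp
  have hint : ∫⁻ x, ‖x‖ₑ ^ m ∂gaussianReal 0 (σ ^ 2) = σ ^ m * ∫⁻ x, ‖x‖ₑ ^ m ∂gaussianReal 0 1 := by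
    rw [hmap, lintegral_map (by fun_prop) (by fun_prop), ← lintegral_const_mul' _ _ (by finiteness)]
    refine lintegral_congr fun x => ?_
    rw [enorm_mul, mul_pow]
    congr 2
    simp [enorm, nnnorm]
  have hset : {x : ℝ | (t : ℝ≥0∞) ≤ ‖x‖ₑ} ⊆ {x : ℝ | (t : ℝ≥0∞) ^ m ≤ ‖x‖ₑ ^ m} := fun x hx => by
    simp only [Set.mem_ofPred_eq] at hx ⊢; gcongr
  have hmk := mul_meas_ge_le_lintegral (μ := gaussianReal 0 (σ ^ 2)) (f := fun x : ℝ => ‖x‖ₑ ^ m)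
    (by fun_prop) ((t : ℝ≥0∞) ^ m)
  rw [hint] at hmk
  have ht' : (t : ℝ≥0∞) ^ m ≠ 0 := by simp [ht]
  refine (measure_mono hset).trans ?_
  have e : ((σ / t : ℝ≥0) : ℝ≥0∞) ^ m = (σ : ℝ≥0∞) ^ m / (t : ℝ≥0∞) ^ m := by
    rw [← ENNReal.coe_pow, div_pow, ENNReal.coe_div (pow_ne_zero m ht), ENNReal.coe_pow,
      ENNReal.coe_pow]
  rw [e, mul_comm, ← ENNReal.mul_div_right_comm, ENNReal.le_div_iff_mul_le (by left; exact ht') (by left; finiteness), mul_comm]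
  exact hmk

/-- Above each of the at most (B 2^k)^d net points the graph stays within A 2^(-kγ) of its value
there, so about 2A · 2^(k(1-γ)) boxes of height 2^(-k) suffice. -/
theorem externalCoveringNumber_graphOver_le {d : ℕ} {K : Set (EuclideanSpace ℝ (Fin d))} {B : ℕ}
    {S π} (hnet : IsDyadicNet K B S π) {f : EuclideanSpace ℝ (Fin d) → ℝ} {A γ : ℝ} (hA : 0 ≤ A)
    (hγ : γ ≤ 1) {k : ℕ} (hf : ∀ x ∈ K, |f x - f (π k x)| ≤ A * (2 : ℝ) ^ (-(k * γ))) :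
    ((Metric.externalCoveringNumber ((1 / 2) ^ k) (graphOver K f)).toNat : ℝ) ≤
      B ^ d * (2 * A + 3) * (2 : ℝ) ^ (k * (d + 1 - γ)) := by
  classical
  set q : ℝ := (2 : ℝ) ^ (k * (1 - γ)) with hq
  -- This is where γ ≤ 1 enters: q ≥ 1 absorbs the rounding, 2J + 1 ≤ 2Aq + 3 ≤ (2A + 3)q.
  have hq1 : 1 ≤ q := Real.one_le_rpow one_le_two (mul_nonneg (Nat.cast_nonneg k) (by linarith))
  set J : ℕ := ⌈A * q⌉₊ with hJ
  have hJle : (J : ℝ) ≤ A * q + 1 := (Nat.ceil_lt_add_one (by positivity)).le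
  have hAJ : A * q ≤ J := Nat.le_ceil _
  set C : Finset (EuclideanSpace ℝ (Fin d) × ℝ) :=
    (S k ×ˢ Finset.Icc (-(J : ℤ)) J).image fun p => (p.1, f p.1 + p.2 * (1 / 2 : ℝ) ^ k) with hC
  have hcover : Metric.IsCover ((1 / 2) ^ k) (graphOver K f) (C : Set _) := by
    rintro _ ⟨x, hx, rfl⟩
    set z := (f x - f (π k x)) * 2 ^ k with hz
    have hzJ : |z| ≤ J := by
      rw [hz, abs_mul, abs_of_pos (by positivity : (0 : ℝ) < 2 ^ k)]
      refine le_trans ?_ hAJ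
      calc _ ≤ A * (2 : ℝ) ^ (-(k * γ)) * 2 ^ k := by gcongr; exact hf x hx
        _ = A * q := by
          rw [hq, mul_assoc, ← Real.rpow_natCast 2 k, ← Real.rpow_add two_pos]
          congr 2; ring
    rw [abs_le] at hzJ
    refine ⟨(π k x, f (π k x) + ⌊z⌋ * (1 / 2 : ℝ) ^ k), ?_, ?_⟩
    · refine Finset.mem_coe.2 (Finset.mem_image.2 ⟨(π k x, ⌊z⌋), ?_, rfl⟩)
      refine Finset.mem_product.2 ⟨hnet.mem k x hx, Finset.mem_Icc.2 ⟨Int.le_floor.2 ?_, ?_⟩⟩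
      · push_cast; exact hzJ.1
      · rw [← Int.lt_add_one_iff, Int.floor_lt]; push_cast; linarith
    · have hd1 : dist x (π k x) ≤ (1 / 2) ^ k := by
        rw [dist_eq_norm]; exact hnet.norm_sub_le k x hx
      have hd2 : dist (f x) (f (π k x) + ⌊z⌋ * (1 / 2 : ℝ) ^ k) ≤ (1 / 2) ^ k := by
        have e : f x - (f (π k x) + ⌊z⌋ * (1 / 2 : ℝ) ^ k) = Int.fract z * (1 / 2) ^ k := by
          rw [← Int.self_sub_floor, hz, one_div, inv_pow]; field_simp; ring
        rw [Real.dist_eq, e, abs_of_nonneg (mul_nonneg (Int.fract_nonneg _) (by positivity))]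
        exact mul_le_of_le_one_left (by positivity) (Int.fract_lt_one _).le
      change edist _ _ ≤ _
      rw [edist_dist]
      refine ENNReal.ofReal_le_of_le_toReal ?_
      have e : (((1 / 2 : ℝ≥0) ^ k : ℝ≥0) : ℝ≥0∞).toReal = (1 / 2 : ℝ) ^ k := by simp
      rw [e, Prod.dist_eq]
      exact max_le hd1 hd2
  have h1 : Metric.externalCoveringNumber ((1 / 2) ^ k) (graphOver K f) ≤ (C.card : ℕ∞) := by
    rw [← Set.encard_coe_eq_coe_finsetCard]
    exact iInf₂_le _ hcover
  have h2 : (Metric.externalCoveringNumber ((1 / 2) ^ k) (graphOver K f)).toNat ≤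
      (B * 2 ^ k) ^ d * (2 * J + 1) := by
    refine (ENat.toNat_le_of_le_natCast h1).trans (Finset.card_image_le.trans ?_)
    rw [Finset.card_product, Int.card_Icc]
    have e : ((J : ℤ) + 1 - -(J : ℤ)).toNat = 2 * J + 1 := by omega
    rw [e]
    gcongr
    exact hnet.card_le k
  calc ((Metric.externalCoveringNumber ((1 / 2) ^ k) (graphOver K f)).toNat : ℝ)
      ≤ (((B * 2 ^ k) ^ d * (2 * J + 1) : ℕ) : ℝ) := by exact_mod_cast h2
    _ = B ^ d * (2 ^ k) ^ d * (2 * J + 1) := by push_cast; ring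
    _ ≤ B ^ d * (2 ^ k) ^ d * ((2 * A + 3) * q) := by gcongr; linarith
    _ = B ^ d * (2 * A + 3) * ((2 ^ k) ^ d * q) := by ring
    _ = _ := by
      rw [hq, ← pow_mul, ← Real.rpow_natCast 2 (k * d), ← Real.rpow_add two_pos]
      push_cast; ring_nf

/-- Passing from ε to the next smaller power of 1/2 costs at most the factor 2^t. -/
theorem eventually_externalCoveringNumber_le {M : Type*} [PseudoMetricSpace M] {F : Set M}
    (hF : TotallyBounded F)
    {C t : ℝ} (hC : 0 ≤ C) (ht : 0 ≤ t) {k₀ : ℕ} (h : ∀ k ≥ k₀,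
      ((Metric.externalCoveringNumber ((1 / 2) ^ k) F).toNat : ℝ) ≤ C * (2 : ℝ) ^ (k * t)) :
    ∀ᶠ ε : ℝ≥0 in 𝓝[>] 0, ((Metric.externalCoveringNumber ε F).toNat : ℝ) ≤
      (C * 2 ^ t) * (ε : ℝ) ^ (-t) := by
  have hsmall : ∀ᶠ ε : ℝ≥0 in 𝓝[>] 0, ε < (1 / 2) ^ k₀ :=
    mem_nhdsWithin_of_mem_nhds (Iio_mem_nhds (by positivity))
  filter_upwards [hsmall, self_mem_nhdsWithin] with ε hε hpos
  have hpos' : (0 : ℝ) < ε := hpos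
  have hε1 : ε ≤ 1 := hε.le.trans (pow_le_one₀ (by positivity) (by norm_num))
  obtain ⟨n, hn1, hn2⟩ := exists_nat_pow_near_of_lt_one hpos hε1 (y := (1 / 2 : ℝ≥0)) (by norm_num) (by norm_num)
  have hk : k₀ ≤ n + 1 := by
    by_contra! hlt
    have : ((1 / 2 : ℝ≥0)) ^ k₀ ≤ (1 / 2) ^ (n + 1) := pow_le_pow_of_le_one (by positivity) (by norm_num) hlt.le
    exact absurd (this.trans hn1.le) (not_le.2 hε)
  have hfin : Metric.externalCoveringNumber ((1 / 2) ^ (n + 1)) F ≠ ⊤ := by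
    obtain ⟨N, -, hN, hc⟩ := Metric.exists_finite_isCover_of_totallyBounded
      (ε := (1 / 2) ^ (n + 1)) (by positivity) hF
    exact ne_top_of_le_ne_top hN.encard_lt_top.ne (iInf₂_le N hc)
  have h1 : ((Metric.externalCoveringNumber ε F).toNat : ℝ) ≤ C * (2 : ℝ) ^ ((n + 1 : ℕ) * t) :=
    le_trans (by exact_mod_cast ENat.toNat_le_toNat (Metric.externalCoveringNumber_anti hn1.le) hfin) (h _ hk)
  refine h1.trans ?_
  rw [mul_assoc]
  gcongr
  have h2 : (2 : ℝ) ^ n ≤ (ε : ℝ)⁻¹ := by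
    rw [le_inv_comm₀ (by positivity) hpos', ← inv_pow]
    have : (ε : ℝ) ≤ (1 / 2 : ℝ) ^ n := by exact_mod_cast hn2
    simpa using this
  rw [Real.rpow_neg hpos'.le, ← Real.inv_rpow hpos'.le]
  calc (2 : ℝ) ^ ((n + 1 : ℕ) * t) = 2 ^ t * ((2 : ℝ) ^ n) ^ t := by
        rw [← Real.rpow_natCast 2 n, ← Real.rpow_mul zero_le_two, ← Real.rpow_add two_pos]
        push_cast; ring_nf
    _ ≤ _ := by gcongr

theorem measure_increment_ge_le {Ω : Type*} [MeasurableSpace Ω] {P : Measure Ω} {Y : Ω → ℝ}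
    (hY : Measurable Y) {σ : ℝ≥0} (hlaw : P.map Y = gaussianReal 0 (σ ^ 2)) {m : ℕ} {c : ℝ≥0}
    (hc : ∀ (σ : ℝ≥0) (t : ℝ≥0), t ≠ 0 →
      gaussianReal 0 (σ ^ 2) {x | (t : ℝ≥0∞) ≤ ‖x‖ₑ} ≤ c * (σ / t : ℝ≥0) ^ m)
    {t b : ℝ} (ht : 0 < t) (hσ : σ / t ≤ b) :
    P {ω | t ≤ |Y ω|} ≤ ENNReal.ofReal (c * b ^ m) := by
  lift t to ℝ≥0 using ht.le
  have hb : 0 ≤ b := le_trans (by positivity) hσ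
  lift b to ℝ≥0 using hb
  have h1 := hc σ t (by exact_mod_cast ht.ne')
  rw [← hlaw, Measure.map_apply hY (measurableSet_le measurable_const measurable_enorm)] at h1
  have e : {ω | (t : ℝ) ≤ |Y ω|} = Y ⁻¹' {x | (t : ℝ≥0∞) ≤ ‖x‖ₑ} := by
    ext ω
    simp only [Set.mem_ofPred_eq, Set.mem_preimage]
    rw [enorm_eq_nnnorm, ENNReal.coe_le_coe, ← NNReal.coe_le_coe, coe_nnnorm, Real.norm_eq_abs]
  rw [e]
  refine h1.trans ?_
  have e2 : ((c : ℝ) * (b : ℝ) ^ m) = ((c * b ^ m : ℝ≥0) : ℝ) := by push_cast; ring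
  rw [e2, ENNReal.ofReal_coe_nnreal]
  have hσ' : σ / t ≤ b := by exact_mod_cast hσ
  exact_mod_cast (by gcongr : c * (σ / t) ^ m ≤ c * b ^ m)

theorem measure_exists_pair_le {d : ℕ} {Ω : Type*} [MeasurableSpace Ω] {P : Measure Ω}
    {X : EuclideanSpace ℝ (Fin d) → Ω → ℝ} {S T : Finset (EuclideanSpace ℝ (Fin d))}
    {δ t Q : ℝ} (h : ∀ p q, ‖p - q‖ ≤ δ → P {ω | t ≤ |X p ω - X q ω|} ≤ ENNReal.ofReal Q) :
    P {ω | ∃ p ∈ S, ∃ q ∈ T, ‖p - q‖ ≤ δ ∧ t ≤ |X p ω - X q ω|} ≤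
      ENNReal.ofReal (S.card * (T.card * Q)) := by
  have e : {ω | ∃ p ∈ S, ∃ q ∈ T, ‖p - q‖ ≤ δ ∧ t ≤ |X p ω - X q ω|} =
      ⋃ p ∈ S, ⋃ q ∈ T, {ω | ‖p - q‖ ≤ δ ∧ t ≤ |X p ω - X q ω|} := by
    ext ω; simp only [Set.mem_ofPred_eq, Set.mem_iUnion, exists_prop]
  rw [e]
  refine (measure_biUnion_finset_le _ _).trans ?_
  rw [ENNReal.ofReal_mul (Nat.cast_nonneg _), ENNReal.ofReal_natCast, ← nsmul_eq_mul]
  refine Finset.sum_le_card_nsmul _ _ _ fun p _ => ?_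
  refine (measure_biUnion_finset_le _ _).trans ?_
  rw [ENNReal.ofReal_mul (Nat.cast_nonneg _), ENNReal.ofReal_natCast, ← nsmul_eq_mul]
  refine Finset.sum_le_card_nsmul _ _ _ fun q _ => ?_
  by_cases hpq : ‖p - q‖ ≤ δ
  · exact (measure_mono fun ω hω => hω.2).trans (h p q hpq)
  · simp [hpq]

/-- Kolmogorov's chaining argument: by Borel–Cantelli, neighbouring points of consecutive nets
eventually have increments below 2^(-kγ'). Path continuity lets one sum along π_k x, π_(k+1) x, ...
up to x. Comparison with net points is all that box counting requires. -/
theorem ae_exists_abs_sub_net_le {d : ℕ} {Ω : Type*} [MeasurableSpace Ω] {P : Measure Ω}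
    {X : EuclideanSpace ℝ (Fin d) → Ω → ℝ}
    (hXm : ∀ x, Measurable (X x)) (hXc : ∀ ω, Continuous fun x => X x ω)
    {σ : EuclideanSpace ℝ (Fin d) → ℝ≥0}
    (hlaw : ∀ x y, P.map (fun ω => X x ω - X y ω) = gaussianReal 0 (σ (x - y) ^ 2))
    {K : Set (EuclideanSpace ℝ (Fin d))} {B : ℕ} {S π} (hnet : IsDyadicNet K B S π)
    {C r γ γ' : ℝ} (hC : 0 < C) (hr : 0 < r) (hσ : ∀ h, ‖h‖ ≤ r → σ h ≤ C * ‖h‖ ^ γ)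
    (hγ' : 0 < γ') (hγγ' : γ' < γ) :
    ∀ᵐ ω ∂P, ∃ A : ℝ, 0 ≤ A ∧ ∃ k₀ : ℕ, ∀ k ≥ k₀, ∀ x ∈ K,
      |X x ω - X (π k x) ω| ≤ A * (2 : ℝ) ^ (-(k * γ')) := by
  -- There are of order 2^(2dk) pairs, and m makes each probability of order 2^(-k(2d+1)), which
  -- leaves a summable factor 2^(-k).
  obtain ⟨m, hm⟩ := exists_nat_ge ((2 * d + 1) / (γ - γ'))
  rw [div_le_iff₀ (sub_pos.2 hγγ')] at hm
  obtain ⟨c, hc⟩ := exists_lintegral_enorm_rpow_gaussianReal m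
  obtain ⟨k₁, hk₁⟩ : ∃ k₁ : ℕ, (1 / 2 : ℝ) ^ k₁ < r / 2 :=
    exists_pow_lt_of_lt_one (by positivity) (by norm_num)
  set A : ℕ → Set Ω := fun k => {ω | ∃ p ∈ S k, ∃ q ∈ S (k + 1), ‖p - q‖ ≤ 2 * (1 / 2) ^ k ∧
    (2 : ℝ) ^ (-(k * γ')) ≤ |X p ω - X q ω|} with hA
  set Q : ℝ := B ^ d * (2 * B) ^ d * c * (C * 2 ^ γ) ^ m with hQ
  have hbound : ∀ k ≥ k₁, P (A k) ≤ ENNReal.ofReal (Q * (1 / 2) ^ k) := by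
    intro k hk
    have hkr : 2 * (1 / 2 : ℝ) ^ k ≤ r := by
      have : (1 / 2 : ℝ) ^ k ≤ (1 / 2) ^ k₁ := pow_le_pow_of_le_one (by norm_num) (by norm_num) hk
      linarith
    have hpair : ∀ p q, ‖p - q‖ ≤ 2 * (1 / 2) ^ k →
        P {ω | (2 : ℝ) ^ (-(k * γ')) ≤ |X p ω - X q ω|} ≤
          ENNReal.ofReal (c * (C * 2 ^ γ * 2 ^ (-(k * (γ - γ')))) ^ m) := by
      intro p q hpq
      refine measure_increment_ge_le ((hXm p).sub (hXm q)) (hlaw p q) hc (by positivity) ?_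
      rw [div_le_iff₀ (by positivity)]
      refine (hσ _ (hpq.trans hkr)).trans ?_
      have h1 : ‖p - q‖ ^ γ ≤ (2 * (1 / 2) ^ k) ^ γ :=
        Real.rpow_le_rpow (norm_nonneg _) hpq (by linarith)
      have h2 : (2 * (1 / 2 : ℝ) ^ k) ^ γ = 2 ^ γ * 2 ^ (-(k * γ)) := by
        rw [Real.mul_rpow zero_le_two (by positivity), one_div, inv_pow, ← Real.rpow_natCast,
          ← Real.rpow_neg zero_le_two, ← Real.rpow_mul zero_le_two]
        congr 2; ring
      have h7 : (2 : ℝ) ^ (-(k * γ)) = 2 ^ (-(k * (γ - γ'))) * 2 ^ (-(k * γ')) := by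
        rw [← Real.rpow_add two_pos]; congr 1; ring
      calc C * ‖p - q‖ ^ γ ≤ C * (2 ^ γ * 2 ^ (-(k * γ))) := by rw [← h2]; gcongr
        _ = _ := by rw [h7]; ring
    refine (measure_exists_pair_le hpair).trans (ENNReal.ofReal_le_ofReal ?_)
    have h3 : ((2 : ℝ) ^ (-(k * (γ - γ')))) ^ m ≤ ((1 / 2 : ℝ) ^ k) ^ (2 * d + 1) := by
      rw [← Real.rpow_natCast _ m, ← Real.rpow_mul zero_le_two, ← pow_mul, one_div, inv_pow,
        ← Real.rpow_natCast, ← Real.rpow_neg zero_le_two]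
      refine Real.rpow_le_rpow_of_exponent_le one_le_two ?_
      push_cast
      have := mul_le_mul_of_nonneg_left hm (Nat.cast_nonneg (α := ℝ) k)
      linarith
    have h4 : ((S k).card : ℝ) ≤ (B * 2 ^ k) ^ d := by exact_mod_cast hnet.card_le k
    have h5 : ((S (k + 1)).card : ℝ) ≤ (2 * B * 2 ^ k) ^ d := by
      have : ((S (k + 1)).card : ℝ) ≤ (B * 2 ^ (k + 1)) ^ d := by exact_mod_cast hnet.card_le (k + 1)
      refine this.trans (le_of_eq ?_)
      ring
    have h6 : (2 : ℝ) ^ k * (1 / 2) ^ k = 1 := by rw [← mul_pow]; norm_num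
    calc _ ≤ (B * 2 ^ k : ℝ) ^ d * ((2 * B * 2 ^ k) ^ d *
          (c * ((C * 2 ^ γ) ^ m * ((1 / 2 : ℝ) ^ k) ^ (2 * d + 1)))) := by
          rw [mul_pow _ _ m]
          gcongr
      _ = Q * (1 / 2) ^ k * ((2 : ℝ) ^ k * (1 / 2) ^ k) ^ (2 * d) := by
          rw [hQ]; simp only [mul_pow]; ring
      _ = _ := by rw [h6, one_pow, mul_one]
  have hQ0 : 0 ≤ Q := by positivity
  have hsum : ∑' k, P (A (k + k₁)) ≠ ∞ := by
    have h1 : Summable fun k : ℕ => Q * (1 / 2 : ℝ) ^ (k + k₁) := by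
      simp_rw [pow_add, ← mul_assoc]
      exact (summable_geometric_two.mul_left Q).mul_right _
    refine ne_top_of_le_ne_top h1.tsum_ofReal_ne_top (ENNReal.tsum_le_tsum fun k => hbound _ (by omega))
  filter_upwards [ae_eventually_notMem hsum] with ω hω
  obtain ⟨k₂, hk₂⟩ := eventually_atTop.1 hω
  set ρ : ℝ := (2 : ℝ) ^ (-γ') with hρ
  have hρ1 : ρ < 1 := Real.rpow_lt_one_of_one_lt_of_neg one_lt_two (by linarith)
  have hρk : ∀ k : ℕ, (2 : ℝ) ^ (-(k * γ')) = ρ ^ k := fun k => by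
    rw [hρ, ← Real.rpow_natCast, ← Real.rpow_mul zero_le_two]; congr 1; ring
  -- The constant is the sum of the geometric series of chaining steps. The shift by k₁ matches the
  -- indexing of the events in the Borel–Cantelli sum.
  refine ⟨(1 - ρ)⁻¹, inv_nonneg.2 (by linarith), k₂ + k₁, fun k hk x hx => ?_⟩
  have hstep : ∀ j, dist (X (π (k + j) x) ω) (X (π (k + (j + 1)) x) ω) ≤ ρ ^ k * ρ ^ j := by
    intro j
    have h1 := hk₂ (k + j - k₁) (by omega)
    rw [Nat.sub_add_cancel (by omega)] at h1
    by_contra! hcon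
    refine h1 ⟨π (k + j) x, hnet.mem _ x hx, π (k + j + 1) x, hnet.mem _ x hx, ?_, ?_⟩
    · have e : π (k + j) x - π (k + j + 1) x = (x - π (k + j + 1) x) - (x - π (k + j) x) := by abel
      rw [e]
      refine (norm_sub_le _ _).trans ?_
      have h2 := hnet.norm_sub_le (k + j) x hx
      have h3 := hnet.norm_sub_le (k + j + 1) x hx
      rw [pow_succ] at h3
      have : (0 : ℝ) < (1 / 2) ^ (k + j) := by positivity
      linarith
    · rw [hρk, pow_add]; exact hcon.le
  have hlim : Tendsto (fun j => X (π (k + j) x) ω) atTop (𝓝 (X x ω)) := by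
    refine ((hXc ω).tendsto x).comp ?_
    rw [tendsto_iff_norm_sub_tendsto_zero]
    have h0 : Tendsto (fun j : ℕ => (1 / 2 : ℝ) ^ (k + j)) atTop (𝓝 0) := by
      simp_rw [pow_add]
      simpa using (tendsto_pow_atTop_nhds_zero_of_lt_one (r := (1 / 2 : ℝ)) (by norm_num) (by norm_num)).const_mul ((1 / 2 : ℝ) ^ k)
    refine squeeze_zero (fun _ => norm_nonneg _) (fun j => ?_) h0
    rw [norm_sub_rev]; exact hnet.norm_sub_le _ x hx
  have := dist_le_of_le_geometric_of_tendsto₀ ρ (ρ ^ k) hρ1 hstep hlim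
  rw [add_zero, dist_comm, Real.dist_eq] at this
  rw [hρk]
  refine this.trans (le_of_eq ?_)
  rw [div_eq_mul_inv, mul_comm]

/-- The exceptional null set depends on the exponent, so both bounds are first collected over
rational exponents and then extended by monotonicity. -/
theorem ae_dim_graphOver_of_isVariogram {d : ℕ} {E : Matrix (Fin d) (Fin d) ℝ} {a₁ aₚ H : ℝ}
    (ha₁ : IsLeast (realSpectrum E) a₁) (ha₁_pos : 0 < a₁) (haₚ : IsGreatest (realSpectrum E) aₚ)
    {K : Set (EuclideanSpace ℝ (Fin d))} (hK : IsCompact K) (hK0 : 0 < volume K)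
    {Ω : Type*} [MeasurableSpace Ω] {P : Measure Ω} [IsProbabilityMeasure P]
    {X : EuclideanSpace ℝ (Fin d) → Ω → ℝ} (hXm : ∀ x, AEMeasurable (X x) P)
    (hXc : ∀ᵐ ω ∂P, Continuous fun x => X x ω) {n : EuclideanSpace ℝ (Fin d) → ℝ}
    (hn : IsVariogram E H n) (hH : 0 < H) (hHa : H < aₚ)
    (hlaw : ∀ x y, P.map (fun ω => X x ω - X y ω) = gaussianReal 0 ((n (x - y)).toNNReal ^ 2)) :
    ∀ᵐ ω ∂P, dimH (graphOver K fun x => X x ω) = ENNReal.ofReal (d + 1 - H / aₚ) ∧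
      HasBoxDim (graphOver K fun x => X x ω) (d + 1 - H / aₚ) := by
  obtain ⟨X', hX'm, hX'c, hXX'⟩ := exists_continuous_modification hXm hXc
  have hlaw' : ∀ x y, P.map (fun ω => X' x ω - X' y ω) = gaussianReal 0 ((n (x - y)).toNNReal ^ 2) := by
    intro x y
    rw [← hlaw x y]
    refine Measure.map_congr ?_
    filter_upwards [hXX'] with ω hω
    rw [hω, hω]
  have haₚ0 : 0 < aₚ := hH.trans hHa
  set γ := H / aₚ with hγ
  have hγ0 : 0 < γ := by positivity
  have hγ1 : γ < 1 := (div_lt_one haₚ0).2 hHa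
  obtain ⟨u, c, hu, hc, hlow⟩ := hn.exists_rpow_inner_le ha₁.2 ha₁_pos haₚ.1 hH
  have hd : (1 : ℝ) ≤ d := by
    rcases Nat.eq_zero_or_pos d with rfl | h
    · exact absurd (Subsingleton.elim u 0) hu
    · exact_mod_cast h
  have hA : ∀ᵐ ω ∂P, ∀ q : ℚ, 1 < q → (q : ℝ) < d + 1 - γ →
      ENNReal.ofReal q ≤ dimH (graphOver K fun x => X' x ω) := by
    refine ae_all_iff.2 fun q => ?_
    by_cases hq : 1 < q ∧ (q : ℝ) < d + 1 - γ
    · have hq0 : (0 : ℝ) ≤ q := by exact_mod_cast zero_le_one.trans hq.1.le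
      have hq1 : (1 : ℝ) < q := by exact_mod_cast hq.1
      filter_upwards [ae_le_dimH_graphOver (σ := fun h => (n h).toNNReal) (s := (q : ℝ).toNNReal) hX'm hX'c hlaw' hK hK0 hu hc hγ0.le hγ1
        (fun x hx => (Real.toNNReal_pos.2 (hn.pos x hx)).ne')
        (fun x => by rw [Real.coe_toNNReal _ (hn.nonneg x)]; exact hlow x)
        (Real.one_lt_toNNReal.2 hq1)
        (by rw [Real.coe_toNNReal _ hq0]; exact hq.2)] with ω hω _ _ using hω
    · exact Eventually.of_forall fun ω h1 h2 => absurd ⟨h1, h2⟩ hq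
  obtain ⟨B, S, π, hnet⟩ := exists_isDyadicNet hK.isBounded
  have hB : ∀ᵐ ω ∂P, ∀ g : ℚ, 0 < g → (g : ℝ) < γ → ∃ A : ℝ, 0 ≤ A ∧ ∃ k₀ : ℕ, ∀ k ≥ k₀, ∀ x ∈ K,
      |X' x ω - X' (π k x) ω| ≤ A * (2 : ℝ) ^ (-(k * (g : ℝ))) := by
    refine ae_all_iff.2 fun g => ?_
    by_cases hg : 0 < g ∧ (g : ℝ) < γ
    · obtain ⟨γ₁, hγ₁, hγ₁'⟩ := exists_between hg.2
      have hg0 : (0 : ℝ) < g := by exact_mod_cast hg.1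
      obtain ⟨C, r, hC, hr, hup⟩ := hn.exists_le_rpow haₚ.2 haₚ0 hH (hg0.trans hγ₁) hγ₁'
      filter_upwards [ae_exists_abs_sub_net_le hX'm hX'c hlaw' hnet hC hr
        (fun h hh => by rw [Real.coe_toNNReal _ (hn.nonneg h)]; exact hup h hh) hg0 hγ₁] with ω hω _ _ using hω
    · exact Eventually.of_forall fun ω h1 h2 => absurd ⟨h1, h2⟩ hg
  filter_upwards [hA, hB, hXX'] with ω hAω hBω hω
  have e : (fun x => X x ω) = fun x => X' x ω := funext fun x => (hω x).symm
  rw [e]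
  have hF : IsCompact (graphOver K fun x => X' x ω) := hK.image (continuous_id.prodMk (hX'c ω))
  have hne : (graphOver K fun x => X' x ω).Nonempty := (nonempty_of_measure_ne_zero hK0.ne').image _
  refine dimH_and_hasBoxDim_of_bounds (by linarith) hne hF.totallyBounded ?_ ?_
  · intro s _ hs
    -- The energy estimate needs an exponent above 1, and d ≥ 1 > γ leaves room for one.
    obtain ⟨q, hq1, hq2⟩ := exists_rat_btwn (max_lt hs (by linarith : (1 : ℝ) < d + 1 - γ))
    refine le_trans ?_ (hAω q (by exact_mod_cast (le_max_right _ _).trans_lt hq1) hq2)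
    rw [← ENNReal.ofReal_coe_nnreal]
    exact ENNReal.ofReal_le_ofReal ((le_max_left _ _).trans hq1.le)
  · intro t ht
    obtain ⟨g, hg1, hg2⟩ := exists_rat_btwn (max_lt hγ0 (by linarith : d + 1 - t < γ))
    have hg0 : (0 : ℝ) < g := (le_max_left _ _).trans_lt hg1
    have hgt : d + 1 - t < g := (le_max_right _ _).trans_lt hg1
    obtain ⟨A, hA0, k₀, hk₀⟩ := hBω g (by exact_mod_cast hg0) hg2
    have h1 := eventually_externalCoveringNumber_le hF.totallyBounded
      (C := B ^ d * (2 * A + 3)) (t := d + 1 - g) (by positivity) (by linarith) (k₀ := k₀)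
      (fun k hk => externalCoveringNumber_graphOver_le hnet hA0 (by linarith) (hk₀ k hk))
    refine ⟨B ^ d * (2 * A + 3) * 2 ^ ((d : ℝ) + 1 - g), ?_⟩
    have hsmall : ∀ᶠ ε : ℝ≥0 in 𝓝[>] 0, ε < 1 := mem_nhdsWithin_of_mem_nhds (Iio_mem_nhds one_pos)
    filter_upwards [h1, hsmall, self_mem_nhdsWithin] with ε hε hε1 hpos
    refine hε.trans ?_
    have hε1' : (ε : ℝ) ≤ 1 := by exact_mod_cast hε1.le
    refine mul_le_mul_of_nonneg_left ?_ (by positivity)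
    exact Real.rpow_le_rpow_of_exponent_ge hpos hε1' (by linarith)

/-! ### Law of the stochastic integral -/

theorem sum_eq_sum_equivFin_symm {ι M : Type*} [AddCommMonoid M] (t : Finset ι) (f : ι → M) :
    ∑ i ∈ t, f i = ∑ j, f (t.equivFin.symm j) := by
  rw [← Finset.sum_coe_sort]
  exact (Equiv.sum_comp t.equivFin.symm fun i : t => f i).symm

/-- Fibres where g vanishes may have infinite measure, so they are left out of the sum. -/
theorem toReal_eLpNorm_two_map_sq {𝕜 β : Type*} [RCLike 𝕜] {d : ℕ}
(p : SimpleFunc (EuclideanSpace ℝ (Fin d)) β)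
    (g : β → 𝕜) (hp : ∀ b, g b ≠ 0 → volume (p ⁻¹' {b}) ≠ ∞) :
    (eLpNorm (p.map g) 2 volume).toReal ^ 2
      = ∑ b ∈ p.range with g b ≠ 0, ‖g b‖ ^ 2 * volume.real (p ⁻¹' {b}) := by
  have h1 : eLpNorm (p.map g) 2 volume ^ 2 = ∑ b ∈ p.range, ‖g b‖ₑ ^ 2 * volume (p ⁻¹' {b}) := by
    have := eLpNorm_nnreal_pow_eq_lintegral (μ := volume) (f := p.map g) (p := 2) two_ne_zero
    simp only [NNReal.coe_ofNat, ENNReal.rpow_ofNat, ENNReal.coe_ofNat] at this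
    rw [this, ← SimpleFunc.map_lintegral (fun b => ‖g b‖ₑ ^ 2), ← SimpleFunc.lintegral_eq_lintegral]
    simp
  rw [← ENNReal.toReal_pow, h1, ENNReal.toReal_sum, Finset.sum_filter]
  · refine Finset.sum_congr rfl fun b _ => ?_
    split_ifs with hb
    · rw [ENNReal.toReal_mul, ENNReal.toReal_pow, toReal_enorm, measureReal_def]
    · rw [not_not] at hb
      simp [hb]
  · intro b _
    by_cases hb : g b = 0
    · simp [hb]
    · exact ENNReal.mul_ne_top (by simp) (hp b hb)

theorem IsStochIntegral.memLp_two {𝕜 : Type*} [RCLike 𝕜] {d : ℕ} {Ω : Type*}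
    [MeasurableSpace Ω] {P : Measure Ω} {Z : Set (EuclideanSpace ℝ (Fin d)) → Ω → 𝕜}
    {f : EuclideanSpace ℝ (Fin d) → 𝕜} {Y : Ω → 𝕜}
    (hf : IsStochIntegral 2 P Z f Y) : MemLp f 2 volume := by
  simpa using hf.1

section StochasticIntegral

variable {𝕜 : Type*} [RCLike 𝕜] [MeasurableSpace 𝕜] {d : ℕ} {Ω : Type*} [MeasurableSpace Ω]
  {α κ : ℝ} {P : Measure Ω} {Z : Set (EuclideanSpace ℝ (Fin d)) → Ω → 𝕜}

/-- For the constant sequence ∅ the partial sums n Z(∅) converge, so their constant difference Z(∅)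
is 0. -/
theorem IsStableRandomMeasure.ae_empty (hZ : IsStableRandomMeasure α κ P Z) :
    ∀ᵐ ω ∂P, Z ∅ ω = 0 := by
  have h := hZ.sigma_additive (fun _ => ∅) (fun _ => .empty) (by simp)
    (fun i j _ => by simp [Function.onFun])
  filter_upwards [h] with ω hω
  have h1 := ((tendsto_add_atTop_iff_nat 1).2 hω).sub hω
  simp only [Finset.sum_range_succ, add_sub_cancel_left, sub_self] at h1
  exact tendsto_nhds_unique tendsto_const_nhds h1

theorem IsStableRandomMeasure.ae_union (hZ : IsStableRandomMeasure α κ P Z)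
    {A B : Set (EuclideanSpace ℝ (Fin d))} (hA : MeasurableSet A) (hB : MeasurableSet B)
    (hA' : volume A ≠ ∞) (hB' : volume B ≠ ∞) (hAB : Disjoint A B) :
    ∀ᵐ ω ∂P, Z (A ∪ B) ω = Z A ω + Z B ω := by
  set F : ℕ → Set (EuclideanSpace ℝ (Fin d)) := fun n => if n = 0 then A else if n = 1 then B else ∅
    with hF
  have hU : ⋃ i, F i = A ∪ B := by
    ext x
    simp only [Set.mem_iUnion, Set.mem_union]
    constructor
    · rintro ⟨i, hi⟩
      simp only [hF] at hi
      split_ifs at hi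
      · exact .inl hi
      · exact .inr hi
      · exact hi.elim
    · rintro (hx | hx)
      · exact ⟨0, by simpa [hF] using hx⟩
      · exact ⟨1, by simpa [hF] using hx⟩
  have h := hZ.sigma_additive F
    (fun i => by simp only [hF]; split_ifs; exacts [hA, hB, .empty])
    (by rw [hU]; exact ((measure_union_le A B).trans_lt
      (ENNReal.add_lt_top.2 ⟨hA'.lt_top, hB'.lt_top⟩)).ne)
    (fun i j hij => by
      simp only [Function.onFun, hF]
      split_ifs <;> first | exact hAB | exact hAB.symm | (exfalso; omega) | simp)
  filter_upwards [h, hZ.ae_empty] with ω hω h0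
  rw [hU] at hω
  refine tendsto_nhds_unique ((tendsto_add_atTop_iff_nat 2).2 hω) ?_
  have : ∀ n, ∑ i ∈ Finset.range (n + 2), Z (F i) ω = Z A ω + Z B ω := by
    intro n
    induction n with
    | zero => simp [Finset.sum_range_succ, hF]
    | succ n ih =>
      rw [show n + 1 + 2 = (n + 2) + 1 by ring, Finset.sum_range_succ, ih]
      simp [hF, h0]
  simp only [this]
  exact tendsto_const_nhds

theorem IsStableRandomMeasure.ae_biUnion (hZ : IsStableRandomMeasure α κ P Z) {ι : Type*}
    (t : Finset ι) (A : ι → Set (EuclideanSpace ℝ (Fin d)))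
    (hA : ∀ i ∈ t, MeasurableSet (A i)) (hA' : ∀ i ∈ t, volume (A i) ≠ ∞)
    (hd : (t : Set ι).PairwiseDisjoint A) :
    ∀ᵐ ω ∂P, Z (⋃ i ∈ t, A i) ω = ∑ i ∈ t, Z (A i) ω := by
  classical
  induction t using Finset.induction_on with
  | empty => simpa using hZ.ae_empty
  | insert a t ha ih =>
    have hfin : volume (⋃ i ∈ t, A i) ≠ ∞ :=
      (measure_biUnion_lt_top t.finite_toSet
        fun i hi => (hA' i (Finset.mem_insert_of_mem hi)).lt_top).ne
    have h1 := ih (fun i hi => hA i (Finset.mem_insert_of_mem hi))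
      (fun i hi => hA' i (Finset.mem_insert_of_mem hi))
      (hd.subset (by simp))
    have h2 := hZ.ae_union (hA a (Finset.mem_insert_self a t))
      (t.measurableSet_biUnion fun i hi => hA i (Finset.mem_insert_of_mem hi))
      (hA' a (Finset.mem_insert_self a t)) hfin
      (Set.disjoint_iUnion₂_right.2 fun i hi => hd (by simp) (by simp [hi])
        (fun h => ha (h ▸ hi)))
    filter_upwards [h1, h2] with ω h1 h2
    rw [Finset.set_biUnion_insert, h2, h1, Finset.sum_insert ha]

/-- The integral may be computed on any finer partition, so two simple functions can be integrated
over a common one. -/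
theorem IsStableRandomMeasure.ae_simpleStochIntegral_map (hZ : IsStableRandomMeasure α κ P Z)
    {β : Type*} (p : SimpleFunc (EuclideanSpace ℝ (Fin d)) β) (g : β → 𝕜)
    (hp : ∀ b, g b ≠ 0 → volume (p ⁻¹' {b}) ≠ ∞) :
    ∀ᵐ ω ∂P, simpleStochIntegral Z (p.map g) ω = ∑ b ∈ p.range, g b * Z (p ⁻¹' {b}) ω := by
  classical
  have h : ∀ c ∈ (p.map g).range, ∀ᵐ ω ∂P, c * Z ((p.map g) ⁻¹' {c}) ω
      = ∑ b ∈ p.range with g b = c, g b * Z (p ⁻¹' {b}) ω := by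
    intro c _
    by_cases hc : c = 0
    · refine .of_forall fun ω => ?_
      rw [hc, zero_mul, Finset.sum_eq_zero]
      intro b hb
      rw [(Finset.mem_filter.1 hb).2, zero_mul]
    · have := hZ.ae_biUnion {b ∈ p.range | g b = c} (fun b => p ⁻¹' {b})
        (fun b _ => p.measurableSet_fiber b)
        (fun b hb => hp b (by rw [(Finset.mem_filter.1 hb).2]; exact hc))
        (fun b _ b' _ hbb => Disjoint.preimage _ (by simpa using hbb))
      filter_upwards [this] with ω hω
      have hset : (p.map g) ⁻¹' {c} = ⋃ b ∈ p.range.filter (g · = c), p ⁻¹' {b} := by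
        ext x
        simp
      rw [hset, hω, Finset.mul_sum]
      refine Finset.sum_congr rfl fun b hb => ?_
      rw [(Finset.mem_filter.1 hb).2]
  have h' := (Finset.eventually_all (p.map g).range).2 h
  filter_upwards [h'] with ω hω
  rw [simpleStochIntegral, Finset.sum_congr rfl hω]
  exact Finset.sum_fiberwise_of_maps_to
    (fun b hb => by rw [SimpleFunc.range_map]; exact Finset.mem_image_of_mem g hb) _

variable [BorelSpace 𝕜]

theorem IsStableRandomMeasure.integral_exp_sum (hZ : IsStableRandomMeasure 2 κ P Z) {ι : Type*}
    (t : Finset ι) (A : ι → Set (EuclideanSpace ℝ (Fin d))) (c : ι → 𝕜)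
    (hA : ∀ i ∈ t, MeasurableSet (A i)) (hA' : ∀ i ∈ t, volume (A i) ≠ ∞)
    (hd : (t : Set ι).PairwiseDisjoint A) (r : ℝ) :
    ∫ ω, Complex.exp (Complex.I * ((r * RCLike.re (∑ i ∈ t, c i * Z (A i) ω) : ℝ) : ℂ)) ∂P
      = Complex.exp (-((κ * r ^ 2 * ∑ i ∈ t, ‖c i‖ ^ 2 * volume.real (A i) : ℝ) : ℂ)) := by
  set e := t.equivFin.symm with he
  have hind := hZ.indep t.card (fun j => A (e j)) (fun j => hA _ (e j).2) (fun j => hA' _ (e j).2)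
    (fun j k hjk => hd (e j).2 (e k).2 fun h => hjk (e.injective (Subtype.ext h)))
  -- The characteristic function is written with Re(star t · Z), so the coefficient r c corresponds
  -- to the argument r · star c.
  set F : Fin t.card → 𝕜 → ℂ := fun j z =>
    Complex.exp (Complex.I * ((RCLike.re (star ((r : 𝕜) * star (c (e j))) * z) : ℝ) : ℂ)) with hF
  have hFc : ∀ j, Continuous (F j) := fun j => by
    simp only [hF]
    fun_prop
  have h1 := hind.integral_fun_prod_comp (f := F)
    (fun j => hZ.aemeasurable _ (hA _ (e j).2) (hA' _ (e j).2))
    (fun j => (hFc j).measurable.aestronglyMeasurable)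
  have h2 : ∀ ω, Complex.exp (Complex.I * ((r * RCLike.re (∑ i ∈ t, c i * Z (A i) ω) : ℝ) : ℂ))
      = ∏ j, F j (Z (A (e j)) ω) := by
    intro ω
    simp only [hF]
    rw [← Complex.exp_sum, ← Finset.mul_sum, sum_eq_sum_equivFin_symm]
    congr 2
    rw [← he]
    push_cast
    rw [map_sum]
    push_cast
    rw [Finset.mul_sum]
    refine Finset.sum_congr rfl fun j _ => ?_
    rw [← Complex.ofReal_mul]
    congr 1
    simp [mul_assoc, he]
  simp only [h2]
  rw [h1]
  simp only [hF]
  rw [Finset.prod_congr rfl fun j _ => hZ.charFun_eq _ (hA _ (e j).2) (hA' _ (e j).2) _,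
    ← Complex.exp_sum, sum_eq_sum_equivFin_symm t, ← he]
  congr 1
  push_cast
  rw [Finset.mul_sum, ← Finset.sum_neg_distrib]
  refine Finset.sum_congr rfl fun j _ => ?_
  rw [← Complex.ofReal_pow]
  norm_cast
  simp only [norm_mul, norm_star, RCLike.norm_ofReal, mul_pow, sq_abs]
  ring

/-- On the joint partition by the values of (s, t) the difference is one sum over disjoint sets, so
independence applies. Cells with equal values cancel and, possibly being of infinite measure, are
dropped. -/
theorem IsStableRandomMeasure.integral_exp_simpleStochIntegral_sub
    (hZ : IsStableRandomMeasure 2 κ P Z) {s t : SimpleFunc (EuclideanSpace ℝ (Fin d)) 𝕜}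
    (hs : MemLp s 2 volume) (ht : MemLp t 2 volume) (r : ℝ) :
    ∫ ω, Complex.exp (Complex.I * ((r * RCLike.re
        (simpleStochIntegral Z s ω - simpleStochIntegral Z t ω) : ℝ) : ℂ)) ∂P
      = Complex.exp (-((κ * r ^ 2 * (eLpNorm (s - t) 2 volume).toReal ^ 2 : ℝ) : ℂ)) := by
  classical
  have hs' : ∀ b : 𝕜 × 𝕜, b.1 ≠ 0 → volume ((s.pair t) ⁻¹' {b}) ≠ ∞ := fun b hb =>
    ((measure_mono (t := s ⁻¹' {b.1}) fun x hx => by simp_all [Prod.ext_iff]).trans_lt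
      (SimpleFunc.measure_preimage_lt_top_of_memLp two_ne_zero (by simp) s hs _ hb)).ne
  have ht' : ∀ b : 𝕜 × 𝕜, b.2 ≠ 0 → volume ((s.pair t) ⁻¹' {b}) ≠ ∞ := fun b hb =>
    ((measure_mono (t := t ⁻¹' {b.2}) fun x hx => by simp_all [Prod.ext_iff]).trans_lt
      (SimpleFunc.measure_preimage_lt_top_of_memLp two_ne_zero (by simp) t ht _ hb)).ne
  have hst : ∀ b : 𝕜 × 𝕜, b.1 - b.2 ≠ 0 → volume ((s.pair t) ⁻¹' {b}) ≠ ∞ := fun b hb => by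
    by_cases h1 : b.1 = 0
    · exact ht' b fun h2 => hb (by rw [h1, h2, sub_zero])
    · exact hs' b h1
  have hae : ∀ᵐ ω ∂P, simpleStochIntegral Z s ω - simpleStochIntegral Z t ω
      = ∑ b ∈ (s.pair t).range with b.1 - b.2 ≠ 0, (b.1 - b.2) * Z ((s.pair t) ⁻¹' {b}) ω := by
    have h1 := hZ.ae_simpleStochIntegral_map (s.pair t) Prod.fst hs'
    have h2 := hZ.ae_simpleStochIntegral_map (s.pair t) Prod.snd ht'
    rw [SimpleFunc.map_fst_pair] at h1
    rw [SimpleFunc.map_snd_pair] at h2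
    filter_upwards [h1, h2] with ω h1 h2
    rw [h1, h2, ← Finset.sum_sub_distrib, Finset.sum_filter]
    refine Finset.sum_congr rfl fun b _ => ?_
    split_ifs with hb
    · rw [sub_mul]
    · rw [← sub_mul, not_not.1 hb, zero_mul]
  rw [integral_congr_ae (g := fun ω => Complex.exp (Complex.I * ((r * RCLike.re
    (∑ b ∈ (s.pair t).range with b.1 - b.2 ≠ 0, (b.1 - b.2) * Z ((s.pair t) ⁻¹' {b}) ω) : ℝ) : ℂ)))
    (by filter_upwards [hae] with ω hω; rw [hω]),
    hZ.integral_exp_sum _ _ _ (fun b _ => (s.pair t).measurableSet_fiber b)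
      (fun b hb => hst b (Finset.mem_filter.1 hb).2)
      (fun b _ b' _ hbb => Disjoint.preimage _ (by simpa using hbb))]
  have := toReal_eLpNorm_two_map_sq (s.pair t) (fun b => b.1 - b.2) hst
  rw [← this]
  rfl

theorem IsStableRandomMeasure.aemeasurable_simpleStochIntegral
    (hZ : IsStableRandomMeasure 2 κ P Z) {s : SimpleFunc (EuclideanSpace ℝ (Fin d)) 𝕜}
    (hs : MemLp s 2 volume) : AEMeasurable (simpleStochIntegral Z s) P := by
  refine Finset.aemeasurable_fun_sum _ fun c _ => ?_
  by_cases hc : c = 0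
  · simp [hc]
  · exact (hZ.aemeasurable _ (s.measurableSet_fiber c)
      (SimpleFunc.measure_preimage_lt_top_of_memLp two_ne_zero (by simp) s hs _ hc).ne).const_mul c

theorem IsStochIntegral.aemeasurable (hZ : IsStableRandomMeasure 2 κ P Z)
    {f : EuclideanSpace ℝ (Fin d) → 𝕜} {Y : Ω → 𝕜} (hf : IsStochIntegral 2 P Z f Y) :
    AEMeasurable Y P := by
  obtain ⟨-, s, hs, -, hsY⟩ := hf
  simp only [show ENNReal.ofReal 2 = 2 by norm_num] at hs
  exact hsY.aemeasurable fun n => hZ.aemeasurable_simpleStochIntegral (hs n)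

/-- The characteristic functions exp(-κ r² ‖s_n - t_n‖²) of the approximations converge to that of a
Gaussian of variance 2κ‖f - g‖². Taking real parts treats the real and the complex measure together.
-/
theorem IsStochIntegral.map_re_sub [IsProbabilityMeasure P] (hκ : 0 < κ) (hZ : IsStableRandomMeasure 2 κ P Z)
    {f g : EuclideanSpace ℝ (Fin d) → 𝕜} {Y Y' : Ω → 𝕜} (hf : IsStochIntegral 2 P Z f Y)
    (hg : IsStochIntegral 2 P Z g Y') :
    P.map (fun ω => RCLike.re (Y ω) - RCLike.re (Y' ω))
      = gaussianReal 0 ((√(2 * κ) * (eLpNorm (f - g) 2 volume).toReal).toNNReal ^ 2) := by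
  have hYm : AEMeasurable Y P := hf.aemeasurable hZ
  have hYm' : AEMeasurable Y' P := hg.aemeasurable hZ
  obtain ⟨hfm, s, hs, hsl, hsY⟩ := hf
  obtain ⟨hgm, t, ht, htl, htY⟩ := hg
  have h2 : ENNReal.ofReal 2 = 2 := by norm_num
  simp only [h2] at *
  have hDm : AEMeasurable (fun ω => RCLike.re (Y ω) - RCLike.re (Y' ω)) P :=
    (RCLike.continuous_re.measurable.comp_aemeasurable hYm).sub (RCLike.continuous_re.measurable.comp_aemeasurable hYm')
  obtain ⟨φ, hφ, hφY⟩ := hsY.exists_seq_tendsto_ae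
  -- The second subsequence is extracted from the first, so that both approximations converge almost
  -- surely along it.
  obtain ⟨φ', hφ', hφY'⟩ := (TendstoInMeasure.comp htY hφ.tendsto_atTop).exists_seq_tendsto_ae
  set a : ℕ → ℕ := fun n => φ (φ' n) with ha
  have hat : Tendsto a atTop atTop := hφ.tendsto_atTop.comp hφ'.tendsto_atTop
  have hnorm : Tendsto (fun n => (eLpNorm (⇑(s (a n)) - ⇑(t (a n))) 2 volume).toReal) atTop
      (𝓝 (eLpNorm (f - g) 2 volume).toReal) := by
    have h1 := (Lp.tendsto_Lp_iff_tendsto_eLpNorm'' _ hs _ hfm).2 hsl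
    have h2 := (Lp.tendsto_Lp_iff_tendsto_eLpNorm'' _ ht _ hgm).2 htl
    have h3 := ((h1.comp hat).sub (h2.comp hat)).norm
    simpa only [Function.comp_def, ← MemLp.toLp_sub, Lp.norm_toLp] using h3
  have : IsProbabilityMeasure (P.map fun ω => RCLike.re (Y ω) - RCLike.re (Y' ω)) :=
    Measure.isProbabilityMeasure_map hDm
  refine Measure.ext_of_charFun (funext fun r => ?_)
  rw [charFun_apply_real, charFun_gaussianReal, integral_map hDm (by fun_prop)]
  have hL : Tendsto (fun n => ∫ ω, Complex.exp (Complex.I * ((r * RCLike.re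
      (simpleStochIntegral Z (s (a n)) ω - simpleStochIntegral Z (t (a n)) ω) : ℝ) : ℂ)) ∂P) atTop
      (𝓝 (∫ ω, Complex.exp (r * (RCLike.re (Y ω) - RCLike.re (Y' ω) : ℝ) * Complex.I) ∂P)) := by
    refine tendsto_integral_of_dominated_convergence (fun _ => 1) (fun n => ?_) (by simp) ?_ ?_
    · refine AEMeasurable.aestronglyMeasurable ?_
      have := RCLike.continuous_re.measurable.comp_aemeasurable 
        ((hZ.aemeasurable_simpleStochIntegral (hs (a n))).sub
          (hZ.aemeasurable_simpleStochIntegral (ht (a n))))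
      exact (show Continuous fun x : ℝ => Complex.exp (Complex.I * ((r * x : ℝ) : ℂ)) by
        fun_prop).measurable.comp_aemeasurable this
    · intro n
      refine .of_forall fun ω => ?_
      rw [mul_comm, Complex.norm_exp_ofReal_mul_I]
    · filter_upwards [hφY, hφY'] with ω h1 h2
      have h3 := (h1.comp hφ'.tendsto_atTop).sub h2
      have h4 := ((show Continuous fun z : 𝕜 => Complex.exp (Complex.I * ((r * RCLike.re z : ℝ) : ℂ))
        by fun_prop).tendsto _).comp h3
      have h5 : Complex.exp (r * (RCLike.re (Y ω) - RCLike.re (Y' ω) : ℝ) * Complex.I)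
          = Complex.exp (Complex.I * ((r * RCLike.re (Y ω - Y' ω) : ℝ) : ℂ)) := by
        rw [map_sub, Complex.ofReal_mul, mul_comm]
      rw [h5]
      exact h4
  refine tendsto_nhds_unique hL ?_
  simp only [hZ.integral_exp_simpleStochIntegral_sub (hs _) (ht _)]
  have hc := ((show Continuous fun x : ℝ => Complex.exp (-((κ * r ^ 2 * x ^ 2 : ℝ) : ℂ)) by
    fun_prop).tendsto _).comp hnorm
  have h0 : (0 : ℝ) ≤ √(2 * κ) * (eLpNorm (f - g) 2 volume).toReal := by positivity
  have h6 : (r * (0 : ℝ) * Complex.I - (((√(2 * κ) * (eLpNorm (f - g) 2 volume).toReal).toNNReal ^ 2 :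
      ℝ≥0) : ℝ) * r ^ 2 / 2 : ℂ)
      = -((κ * r ^ 2 * (eLpNorm (f - g) 2 volume).toReal ^ 2 : ℝ) : ℂ) := by
    rw [NNReal.coe_pow, Real.coe_toNNReal _ h0, mul_pow, Real.sq_sqrt (by positivity)]
    push_cast
    ring
  rw [h6]
  exact hc

end StochasticIntegral

/-! ### Variograms from square integrable kernels -/

/-- Stationarity turns the L² triangle inequality for x, 0, -y into subadditivity. Fatou's lemma
gives lower semicontinuity from almost everywhere continuity of the kernel in x, without any
dominating function. -/
theorem isVariogram_eLpNorm {𝕜 : Type*} [RCLike 𝕜] {d : ℕ} {E : Matrix (Fin d) (Fin d) ℝ} {H c : ℝ}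
    (hc : 0 < c) {f : EuclideanSpace ℝ (Fin d) → EuclideanSpace ℝ (Fin d) → 𝕜}
    (hf : ∀ x, MemLp (f x) 2 volume)
    (hst : ∀ x y, eLpNorm (f x - f y) 2 volume = eLpNorm (f (x - y) - f 0) 2 volume)
    (hcont : ∀ x, ∀ᵐ ξ, ContinuousAt (fun z => f z ξ) x)
    (hflow : ∀ s x, eLpNorm (f (flow E s x) - f 0) 2 volume
      = ENNReal.ofReal (Real.exp (H * s)) * eLpNorm (f x - f 0) 2 volume)
    (hpos : ∀ x, x ≠ 0 → ¬ f x =ᵐ[volume] f 0) :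
    IsVariogram E H fun h => c * (eLpNorm (f h - f 0) 2 volume).toReal where
  nonneg x := by positivity
  zero := by simp
  neg x := by
    have h1 := hst 0 x
    rw [zero_sub] at h1
    rw [← h1, eLpNorm_sub_comm]
  add_le x y := by
    have h1 := hst x (-y)
    have h2 := hst 0 (-y)
    rw [sub_neg_eq_add] at h1
    rw [zero_sub, neg_neg] at h2
    rw [← h1, ← h2, ← mul_add]
    have hx : eLpNorm (f x - f 0) 2 volume ≠ ∞ := ((hf x).sub (hf 0)).eLpNorm_ne_top
    have hy : eLpNorm (f 0 - f (-y)) 2 volume ≠ ∞ := ((hf 0).sub (hf (-y))).eLpNorm_ne_top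
    rw [← ENNReal.toReal_add hx hy]
    refine mul_le_mul_of_nonneg_left (ENNReal.toReal_mono (ENNReal.add_ne_top.2 ⟨hx, hy⟩) ?_) hc.le
    have := eLpNorm_add_le (p := 2) (μ := volume) ((hf x).sub (hf 0)).1 ((hf 0).sub (hf (-y))).1
      (by norm_num)
    rwa [sub_add_sub_cancel] at this
  lsc := by
    rw [lowerSemicontinuous_iff_isClosed_preimage]
    refine fun a => IsSeqClosed.isClosed fun u x hu hux => ?_
    simp only [Set.mem_preimage, Set.mem_Iic] at hu ⊢
    have hfin : ∀ x, eLpNorm (f x - f 0) 2 volume ≠ ∞ := fun x =>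
      ((hf x).sub (hf 0)).eLpNorm_ne_top
    have h1 : ∀ n, eLpNorm (f (u n) - f 0) 2 volume ≤ ENNReal.ofReal (a / c) := fun n => by
      rw [ENNReal.le_ofReal_iff_toReal_le (hfin _)
        (div_nonneg (le_trans (by positivity) (hu n)) hc.le), le_div_iff₀' hc]
      exact hu n
    have ha : 0 ≤ a / c := div_nonneg (le_trans (by positivity) (hu 0)) hc.le
    rw [← le_div_iff₀' hc, ← ENNReal.le_ofReal_iff_toReal_le (hfin _) ha]
    refine (Lp.eLpNorm_lim_le_liminf_eLpNorm (fun n => ((hf (u n)).sub (hf 0)).1) _ ?_).trans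
      (liminf_le_of_le (by isBoundedDefault) fun b hb => ?_)
    · filter_upwards [hcont x] with ξ hξ
      exact ((hξ.tendsto.comp hux).sub_const (f 0 ξ))
    · obtain ⟨n, hn⟩ := hb.exists
      exact hn.trans (h1 n)
  flow s x := by
    rw [hflow, ENNReal.toReal_mul, ENNReal.toReal_ofReal (Real.exp_pos _).le]
    ring
  pos x hx := by
    refine mul_pos hc (ENNReal.toReal_pos (fun h => hpos x hx ?_)
      ((hf x).sub (hf 0)).eLpNorm_ne_top)
    rw [eLpNorm_eq_zero_iff ((hf x).sub (hf 0)).1 two_ne_zero] at h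
    filter_upwards [h] with ξ hξ
    exact sub_eq_zero.1 hξ

/-- Change of variables: the Jacobian is exp(s tr E), and the L² norm takes its square root. -/
theorem eLpNorm_two_comp_flow {𝕜 : Type*} [RCLike 𝕜] {d : ℕ} (E : Matrix (Fin d) (Fin d) ℝ) (s : ℝ)
    {g : EuclideanSpace ℝ (Fin d) → 𝕜} (hg : AEStronglyMeasurable g volume) :
    eLpNorm g 2 volume
      = ENNReal.ofReal (Real.exp (s * E.trace / 2)) * eLpNorm (g ∘ flow E s) 2 volume := by
  have hdet : LinearMap.det (flow E s) ≠ 0 := by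
    rw [det_flow]; exact (Real.exp_pos _).ne'
  have hmap := Measure.map_linearMap_addHaar_eq_smul_addHaar (volume : Measure _) hdet
  have hg' : AEStronglyMeasurable g (volume.map (flow E s)) := by
    rw [hmap]; exact hg.smul_measure _
  rw [← eLpNorm_map_measure hg' (continuous_flow E s).aemeasurable, hmap,
    eLpNorm_smul_measure_of_ne_top (by norm_num), det_flow, ← Real.exp_neg, abs_of_pos (Real.exp_pos _),
    smul_eq_mul, ← mul_assoc, ENNReal.ofReal_rpow_of_pos (Real.exp_pos _), ← Real.exp_mul,
    ← ENNReal.ofReal_mul (Real.exp_pos _).le, ← Real.exp_add]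
  rw [show s * E.trace / 2 + -(s * E.trace) * (1 / 2 : ℝ≥0∞).toReal = 0 by simp; ring]
  simp

/-! ### Homogeneous and admissible functions -/

theorem pos_of_mem_realSpectrum {d : ℕ} {E : Matrix (Fin d) (Fin d) ℝ} {a : ℝ}
    (ha : a ∈ realSpectrum E) : 0 < d := by
  rcases Nat.eq_zero_or_pos d with rfl | h
  · obtain ⟨u, _, hu, _⟩ := exists_norm_flow_eigenvector_le E ha
    exact (hu (Subsingleton.elim _ _)).elim
  · exact h

/-- Homogeneity says nothing at 0. Along a contracting orbit φ decays like exp(-s), and continuity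
gives the value in the limit. -/
theorem IsHomogeneous.apply_zero {d : ℕ} {E : Matrix (Fin d) (Fin d) ℝ} {a : ℝ}
    (ha : IsLeast (realSpectrum E) a) (ha_pos : 0 < a) {φ : EuclideanSpace ℝ (Fin d) → ℝ}
    (hφ : IsHomogeneous E φ) (hφc : Continuous φ) : φ 0 = 0 := by
  obtain ⟨u, _, hu, _⟩ := exists_norm_flow_eigenvector_le E ha.1
  obtain ⟨C, hC, hflow⟩ := exists_norm_flow_neg_le E (b := a / 2)
    fun b hb => (half_lt_self ha_pos).trans_le (ha.2 hb)
  have h1 : Tendsto (fun s : ℝ => flow E (-s) u) atTop (𝓝 0) := by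
    refine squeeze_zero_norm' ((eventually_ge_atTop 0).mono fun s hs => hflow s hs u) ?_
    have : Tendsto (fun s : ℝ => Real.exp (-(a / 2 * s))) atTop (𝓝 0) :=
      Real.tendsto_exp_neg_atTop_nhds_zero.comp (tendsto_id.const_mul_atTop (by positivity))
    simpa [neg_mul] using (this.const_mul C).mul_const ‖u‖
  have h2 := (hφc.tendsto 0).comp h1
  have h3 : Tendsto (fun s : ℝ => φ (flow E (-s) u)) atTop (𝓝 0) := by
    have : ∀ s : ℝ, φ (flow E (-s) u) = Real.exp (-s) * φ u := fun s => by
      rw [← matPow_exp, hφ _ (Real.exp_pos _) _ hu]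
    simp only [this]
    simpa using Real.tendsto_exp_neg_atTop_nhds_zero.mul_const (φ u)
  exact tendsto_nhds_unique h2 h3

theorem IsHomogeneous.apply_flow {d : ℕ} {E : Matrix (Fin d) (Fin d) ℝ}
    {φ : EuclideanSpace ℝ (Fin d) → ℝ} (hφ : IsHomogeneous E φ) (h0 : φ 0 = 0) (s : ℝ)
    (x : EuclideanSpace ℝ (Fin d)) : φ (flow E s x) = Real.exp s * φ x := by
  by_cases hx : x = 0
  · simp [hx, h0]
  · rw [← matPow_exp, hφ _ (Real.exp_pos _) _ hx]

theorem IsAdaptedNorm.radialPart_le {d : ℕ} {E : Matrix (Fin d) (Fin d) ℝ}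
    {N : Seminorm ℝ (EuclideanSpace ℝ (Fin d))} (hN : IsAdaptedNorm E N)
    {x : EuclideanSpace ℝ (Fin d)} (hx : x ≠ 0) {t : ℝ} (ht : 0 < t)
    (h : N (matPow E t⁻¹ x) ≤ 1) : radialPart E N x ≤ t := by
  rw [radialPart]
  -- If the defining set is empty, its infimum is 0 by convention, so existence of the radius is not
  -- needed for this bound.
  rcases Set.eq_empty_or_nonempty {t : ℝ | 0 < t ∧ N (matPow E t⁻¹ x) = 1} with h0 | ⟨t', hm⟩
  · rw [h0, Real.sInf_empty]
    exact ht.le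
  · have ht' := hm.1
    have h' := hm.2
    refine (csInf_le ⟨0, fun r hr => le_of_lt hr.1⟩ hm).trans ?_
    rw [← h'] at h
    exact (inv_le_inv₀ ht ht').1
      (((hN.strictMonoOn x hx).le_iff_le (inv_pos.2 ht) (inv_pos.2 ht')).1 h)

theorem radialPart_nonneg {d : ℕ} (E : Matrix (Fin d) (Fin d) ℝ)
    (N : Seminorm ℝ (EuclideanSpace ℝ (Fin d))) (x : EuclideanSpace ℝ (Fin d)) :
    0 ≤ radialPart E N x :=
  Real.sInf_nonneg fun _ ht => ht.1.le

/-- The exponent of admissibility of a homogeneous function does not exceed the least real part of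
the eigenvalues: otherwise the function would be constant along an eigendirection. -/
theorem IsAdmissible.le_of_isLeast {d : ℕ} {E : Matrix (Fin d) (Fin d) ℝ} {a β : ℝ}
    (ha : IsLeast (realSpectrum E) a) (ha_pos : 0 < a)
    {N : Seminorm ℝ (EuclideanSpace ℝ (Fin d))} (hN : IsAdaptedNorm E N)
    {φ : EuclideanSpace ℝ (Fin d) → ℝ} (hφ : IsAdmissible β E N φ) (hφh : IsHomogeneous E φ) :
    β ≤ a := by
  by_contra! hβ
  obtain ⟨u, C, hu, hC, hflow⟩ := exists_norm_flow_eigenvector_le E ha.1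
  obtain ⟨M, hM, hNM⟩ : ∃ M, 0 < M ∧ ∀ x, N x ≤ M * ‖x‖ := by
    set e := EuclideanSpace.basisFun (Fin d) ℝ
    have h0 : 0 ≤ ∑ i, N (e i) := Finset.sum_nonneg fun i _ => apply_nonneg N _
    refine ⟨∑ i, N (e i) + 1, by positivity, fun x => ?_⟩
    calc N x = N (∑ i, e.repr x i • e i) := by rw [e.sum_repr]
      _ ≤ ∑ i, N (e.repr x i • e i) :=
          Finset.le_sum_of_subadditive N (map_zero N).le (map_add_le_add N) _ _
      _ ≤ ∑ i, ‖x‖ * N (e i) := by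
          gcongr with i
          rw [map_smul_eq_mul]
          gcongr
          exact (PiLp.norm_apply_le _ i).trans (e.repr.norm_map x).le
      _ ≤ _ := by
          rw [← Finset.mul_sum, mul_comm]
          gcongr
          linarith
  set D := M * C with hD
  have hD0 : 0 < D := by positivity
  -- On the eigendirection u the flow scales at the exact rate a, so τ(ru) is at most of order
  -- r^(1/a).
  have hrad : ∀ r : ℝ, 0 < r → radialPart E N (r • u) ≤ (r * D) ^ (1 / a) := by
    intro r hr
    have hrD : 0 < r * D := by positivity
    refine hN.radialPart_le (smul_ne_zero hr.ne' hu) (by positivity) ?_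
    rw [matPow_eq_flow, map_smul, map_smul_eq_mul, Real.norm_of_nonneg hr.le]
    calc r * N (flow E (Real.log ((r * D) ^ (1 / a))⁻¹) u)
        ≤ r * (M * (C * Real.exp (a * Real.log ((r * D) ^ (1 / a))⁻¹))) := by
          gcongr
          exact (hNM _).trans (by gcongr; exact hflow _)
      _ = 1 := by
          rw [Real.log_inv, Real.log_rpow hrD,
            show a * -(1 / a * Real.log (r * D)) = -Real.log (r * D) by field_simp,
            Real.exp_neg, Real.exp_log hrD, hD]
          field_simp
  -- Admissibility bounds |φ(tu) - φ(xu)| by a multiple of (t - x)^(β/a) with β/a > 1, so the right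
  -- derivative along the ray vanishes.
  have hderiv : ∀ x : ℝ, 0 < x → HasDerivWithinAt (fun t : ℝ => φ (t • u)) 0 (Set.Ici x) x := by
    intro x hx
    rw [← hasDerivWithinAt_Ioi_iff_Ici, hasDerivWithinAt_iff_tendsto_slope' Set.self_notMem_Ioi]
    have hun : 0 < ‖u‖ := norm_pos_iff.2 hu
    obtain ⟨C', hC', hb⟩ := hφ.bound (x * ‖u‖) (x * ‖u‖ + 1) (by positivity) (by linarith)
    have hlim : Tendsto (fun t : ℝ => C' * D ^ (β / a) * (t - x) ^ (β / a - 1)) (𝓝[>] x) (𝓝 0) := by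
      have h1 : 0 < β / a - 1 := by rw [sub_pos, one_lt_div ha_pos]; exact hβ
      have h2 : ContinuousAt (fun t : ℝ => C' * D ^ (β / a) * (t - x) ^ (β / a - 1)) x :=
        continuousAt_const.mul ((continuousAt_id.sub continuousAt_const).rpow_const (.inr h1.le))
      have h3 := h2.tendsto
      simp only [sub_self, Real.zero_rpow h1.ne', mul_zero] at h3
      exact h3.mono_left nhdsWithin_le_nhds
    refine squeeze_zero_norm' ?_ hlim
    filter_upwards [Ioo_mem_nhdsGT (show x < x + 1 / D by simpa using hD0)] with t ht
    have hr : 0 < t - x := sub_pos.2 ht.1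
    have hrD : (t - x) * D ≤ 1 := by
      have := ht.2
      rw [← sub_lt_iff_lt_add', lt_div_iff₀ hD0] at this
      exact this.le
    have h1 := hrad _ hr
    have h2 : radialPart E N ((t - x) • u) ≤ 1 :=
      h1.trans (Real.rpow_le_one (by positivity) hrD (by positivity))
    have hxu : ‖x • u‖ = x * ‖u‖ := by rw [norm_smul, Real.norm_of_nonneg hx.le]
    have h3 := hb ((t - x) • u) (x • u) hxu.ge (by rw [hxu]; linarith) h2
    rw [← add_smul, sub_add_cancel] at h3
    have hβ0 : 0 < β := ha_pos.trans hβ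
    rw [slope_def_field, norm_div, Real.norm_of_nonneg hr.le, div_le_iff₀ hr, Real.norm_eq_abs]
    refine h3.trans ?_
    calc C' * radialPart E N ((t - x) • u) ^ β
        ≤ C' * (((t - x) * D) ^ (1 / a)) ^ β := by
          gcongr
          exact radialPart_nonneg E N _
      _ = C' * D ^ (β / a) * ((t - x) ^ (β / a - 1) * (t - x)) := by
          rw [← Real.rpow_mul (by positivity), Real.mul_rpow hr.le hD0.le,
            ← Real.rpow_add_one hr.ne', sub_add_cancel, one_div_mul_eq_div]
          ring
      _ = _ := by ring
  have hc : Continuous fun t : ℝ => φ (t • u) := hφ.continuous.comp (by fun_prop)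
  -- Hence φ is constant on the segment from εu to u. Letting ε → 0 gives φ(u) = φ(0) = 0, against
  -- positivity.
  have hconst : ∀ ε : ℝ, 0 < ε → ε < 1 → φ u = φ (ε • u) := fun ε hε hε1 => by
    have := constant_of_has_deriv_right_zero hc.continuousOn
      (fun x hx => hderiv x (hε.trans_le hx.1)) 1 (Set.right_mem_Icc.2 hε1.le)
    simpa using this
  have h1 : Tendsto (fun ε : ℝ => φ (ε • u)) (𝓝[>] 0) (𝓝 (φ ((0 : ℝ) • u))) :=
    (hc.tendsto 0).mono_left nhdsWithin_le_nhds
  have h2 : Tendsto (fun ε : ℝ => φ (ε • u)) (𝓝[>] 0) (𝓝 (φ u)) := by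
    refine tendsto_const_nhds.congr' ?_
    filter_upwards [Ioo_mem_nhdsGT (zero_lt_one' ℝ)] with ε hε
    exact hconst ε hε.1 hε.2
  have h3 := tendsto_nhds_unique h2 h1
  rw [zero_smul, hφh.apply_zero ha ha_pos hφ.continuous] at h3
  exact (hφ.pos u hu).ne' h3

/-! ### Variograms of the two fields -/

/-- Translation invariance of Lebesgue measure gives stationarity, and the scaling exponent is p +
q/2 = H. If n(x) = 0, then φ(x - ·) = φ(-·) almost everywhere because p ≠ 0, hence everywhere by
continuity, and at the origin φ(x) = 0. -/
theorem isVariogram_movingAverage {d : ℕ} {E : Matrix (Fin d) (Fin d) ℝ} {a H p c : ℝ}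
    (ha : IsLeast (realSpectrum E) a) (ha_pos : 0 < a) (hc : 0 < c)
    {φ : EuclideanSpace ℝ (Fin d) → ℝ} (hφ : IsContinuousPositive φ) (hφh : IsHomogeneous E φ)
    (hp : p ≠ 0) (hpH : p = H - E.trace / 2)
    (hf : ∀ x, MemLp (fun y => φ (x - y) ^ p - φ (-y) ^ p) 2 volume) :
    (∀ x y, eLpNorm ((fun z => φ (x - z) ^ p - φ (-z) ^ p) - fun z => φ (y - z) ^ p - φ (-z) ^ p) 2
        volume = eLpNorm ((fun z => φ (x - y - z) ^ p - φ (-z) ^ p)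
          - fun z => φ (0 - z) ^ p - φ (-z) ^ p) 2 volume) ∧
    IsVariogram E H fun h => c * (eLpNorm ((fun z => φ (h - z) ^ p - φ (-z) ^ p)
      - fun z => φ (0 - z) ^ p - φ (-z) ^ p) 2 volume).toReal := by
  have hφ0 : φ 0 = 0 := hφh.apply_zero ha ha_pos hφ.continuous
  have hd : Nonempty (Fin d) := ⟨⟨0, pos_of_mem_realSpectrum ha.1⟩⟩
  have hst : ∀ x y, eLpNorm ((fun z => φ (x - z) ^ p - φ (-z) ^ p)
        - fun z => φ (y - z) ^ p - φ (-z) ^ p) 2 volume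
      = eLpNorm ((fun z => φ (x - y - z) ^ p - φ (-z) ^ p)
        - fun z => φ (0 - z) ^ p - φ (-z) ^ p) 2 volume := fun x y => by
    rw [← eLpNorm_comp_measurePreserving ((hf x).sub (hf y)).1
      (measurePreserving_add_right volume y)]
    congr 1
    ext z
    simp only [Function.comp_apply, Pi.sub_apply, zero_sub]
    rw [show x - (z + y) = x - y - z by abel, show y - (z + y) = -z by abel]
    ring
  refine ⟨hst, isVariogram_eLpNorm (f := fun x z => φ (x - z) ^ p - φ (-z) ^ p) hc hf hst
    (fun x => ?_) (fun s x => ?_) (fun x hx h => ?_)⟩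
  · have h1 : ∀ᵐ ξ : EuclideanSpace ℝ (Fin d), ξ ≠ x := by
      simp [ae_iff]
    filter_upwards [h1] with ξ hξ
    have h2 : φ (x - ξ) ≠ 0 := (hφ.pos _ (sub_ne_zero.2 hξ.symm)).ne'
    have h3 : ContinuousAt (fun z => φ (z - ξ)) x :=
      (hφ.continuous.comp (continuous_id.sub continuous_const)).continuousAt
    exact (h3.rpow_const (.inl h2)).sub continuousAt_const
  · rw [eLpNorm_two_comp_flow E s ((hf _).sub (hf 0)).1]
    have h1 : ((fun z => φ (flow E s x - z) ^ p - φ (-z) ^ p)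
          - fun z => φ (0 - z) ^ p - φ (-z) ^ p) ∘ flow E s
        = Real.exp (s * p) • ((fun z => φ (x - z) ^ p - φ (-z) ^ p)
          - fun z => φ (0 - z) ^ p - φ (-z) ^ p) := by
      ext z
      simp only [Function.comp_apply, Pi.sub_apply, Pi.smul_apply, smul_eq_mul, zero_sub]
      rw [← map_sub, ← map_neg, hφh.apply_flow hφ0, hφh.apply_flow hφ0,
        Real.mul_rpow (Real.exp_pos _).le (hφ.nonneg _), Real.mul_rpow (Real.exp_pos _).le (hφ.nonneg _),
        ← Real.exp_mul]
      ring
    rw [h1, eLpNorm_const_smul, ← mul_assoc, Real.enorm_of_nonneg (Real.exp_pos _).le,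
      ← ENNReal.ofReal_mul (Real.exp_pos _).le, ← Real.exp_add, hpH]
    congr 3
    ring_nf
  · have h1 : (fun z => φ (x - z)) =ᵐ[volume] fun z => φ (-z) := by
      filter_upwards [h] with z hz
      simp only [zero_sub, sub_self, sub_eq_zero] at hz
      exact (Real.rpow_left_inj (hφ.nonneg _) (hφ.nonneg _) hp).1 hz
    have h2 := (Continuous.ae_eq_iff_eq volume (hφ.continuous.comp (by fun_prop))
      (hφ.continuous.comp (by fun_prop))).1 h1
    have h3 : φ (x - 0) = φ (-0) := congrFun h2 0
    rw [sub_zero, neg_zero, hφ0] at h3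
    exact (hφ.pos x hx).ne' h3

/-- Stationarity holds because factoring out exp(i⟨y,ξ⟩) changes no modulus. The flow passes to ξ as
its transpose, giving the exponent -p - q/2 = H. -/
theorem isVariogram_harmonizable {d : ℕ} {E : Matrix (Fin d) (Fin d) ℝ} {a H p c : ℝ}
    (ha : IsLeast (realSpectrum E) a) (ha_pos : 0 < a) (hc : 0 < c)
    {ψ : EuclideanSpace ℝ (Fin d) → ℝ} (hψ : IsContinuousPositive ψ)
    (hψh : IsHomogeneous E.transpose ψ) (hpH : p = -H - E.trace / 2)
    (hf : ∀ x : EuclideanSpace ℝ (Fin d), MemLp (fun ξ =>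
      (Complex.exp (Complex.I * ((inner ℝ x ξ : ℝ) : ℂ)) - 1) * ((ψ ξ ^ p : ℝ) : ℂ)) 2 volume) :
    (∀ x y : EuclideanSpace ℝ (Fin d),
      eLpNorm ((fun ξ => (Complex.exp (Complex.I * ((inner ℝ x ξ : ℝ) : ℂ)) - 1) * ((ψ ξ ^ p : ℝ) : ℂ))
        - fun ξ => (Complex.exp (Complex.I * ((inner ℝ y ξ : ℝ) : ℂ)) - 1) * ((ψ ξ ^ p : ℝ) : ℂ)) 2
        volume
      = eLpNorm ((fun ξ =>
          (Complex.exp (Complex.I * ((inner ℝ (x - y) ξ : ℝ) : ℂ)) - 1) * ((ψ ξ ^ p : ℝ) : ℂ))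
        - fun ξ => (Complex.exp (Complex.I * ((inner ℝ 0 ξ : ℝ) : ℂ)) - 1) * ((ψ ξ ^ p : ℝ) : ℂ)) 2
        volume) ∧
    IsVariogram E H fun h => c * (eLpNorm ((fun ξ =>
        (Complex.exp (Complex.I * ((inner ℝ h ξ : ℝ) : ℂ)) - 1) * ((ψ ξ ^ p : ℝ) : ℂ))
      - fun ξ => (Complex.exp (Complex.I * ((inner ℝ 0 ξ : ℝ) : ℂ)) - 1) * ((ψ ξ ^ p : ℝ) : ℂ)) 2
      volume).toReal := by
  have ha' : IsLeast (realSpectrum E.transpose) a := by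
    refine ⟨(mem_realSpectrum_transpose E).2 ha.1, fun b hb => ha.2 ((mem_realSpectrum_transpose E).1 hb)⟩
  have hψ0 : ψ 0 = 0 := hψh.apply_zero ha' ha_pos hψ.continuous
  have hd : Nonempty (Fin d) := ⟨⟨0, pos_of_mem_realSpectrum ha.1⟩⟩
  have hst : ∀ x y : EuclideanSpace ℝ (Fin d),
    eLpNorm ((fun ξ => (Complex.exp (Complex.I * ((inner ℝ x ξ : ℝ) : ℂ)) - 1) * ((ψ ξ ^ p : ℝ) : ℂ))
      - fun ξ => (Complex.exp (Complex.I * ((inner ℝ y ξ : ℝ) : ℂ)) - 1) * ((ψ ξ ^ p : ℝ) : ℂ)) 2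
      volume
    = eLpNorm ((fun ξ =>
        (Complex.exp (Complex.I * ((inner ℝ (x - y) ξ : ℝ) : ℂ)) - 1) * ((ψ ξ ^ p : ℝ) : ℂ))
      - fun ξ => (Complex.exp (Complex.I * ((inner ℝ 0 ξ : ℝ) : ℂ)) - 1) * ((ψ ξ ^ p : ℝ) : ℂ)) 2
      volume := fun x y => by
    refine eLpNorm_congr_norm_ae (.of_forall fun ξ => ?_)
    simp only [Pi.sub_apply, inner_zero_left, Complex.ofReal_zero, mul_zero, Complex.exp_zero,
      sub_self, zero_mul, sub_zero]
    rw [← sub_mul, sub_sub_sub_cancel_right, norm_mul, norm_mul]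
    congr 1
    have : Complex.exp (Complex.I * ((inner ℝ x ξ : ℝ) : ℂ))
        - Complex.exp (Complex.I * ((inner ℝ y ξ : ℝ) : ℂ))
        = Complex.exp (((inner ℝ y ξ : ℝ) : ℂ) * Complex.I)
          * (Complex.exp (Complex.I * ((inner ℝ (x - y) ξ : ℝ) : ℂ)) - 1) := by
      rw [mul_sub, ← Complex.exp_add, inner_sub_left, mul_one]
      push_cast
      ring_nf
    rw [this, norm_mul, Complex.norm_exp_ofReal_mul_I, one_mul]
  refine ⟨hst, isVariogram_eLpNorm (f := fun x ξ =>
    (Complex.exp (Complex.I * ((inner ℝ x ξ : ℝ) : ℂ)) - 1) * ((ψ ξ ^ p : ℝ) : ℂ)) hc hf hst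
    (fun x => .of_forall fun ξ => ?_) (fun s x => ?_) (fun x hx h => ?_)⟩
  · exact Continuous.continuousAt (by fun_prop)
  · rw [eLpNorm_two_comp_flow E.transpose s ((hf x).sub (hf 0)).1]
    have h1 : ((fun ξ => (Complex.exp (Complex.I * ((inner ℝ (flow E s x) ξ : ℝ) : ℂ)) - 1)
            * ((ψ ξ ^ p : ℝ) : ℂ))
          - fun ξ => (Complex.exp (Complex.I * ((inner ℝ 0 ξ : ℝ) : ℂ)) - 1) * ((ψ ξ ^ p : ℝ) : ℂ))
        = Real.exp (-(s * p)) • (((fun ξ =>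
            (Complex.exp (Complex.I * ((inner ℝ x ξ : ℝ) : ℂ)) - 1) * ((ψ ξ ^ p : ℝ) : ℂ))
          - fun ξ => (Complex.exp (Complex.I * ((inner ℝ 0 ξ : ℝ) : ℂ)) - 1)
            * ((ψ ξ ^ p : ℝ) : ℂ)) ∘ flow E.transpose s) := by
      ext ξ
      simp only [Function.comp_apply, Pi.sub_apply, Pi.smul_apply, inner_zero_left,
        Complex.ofReal_zero, mul_zero, Complex.exp_zero, sub_self, zero_mul, sub_zero]
      rw [inner_flow, hψh.apply_flow hψ0, Real.mul_rpow (Real.exp_pos _).le (hψ.nonneg _),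
        ← Real.exp_mul, Complex.real_smul, mul_left_comm]
      congr 1
      rw [← Complex.ofReal_mul, ← mul_assoc, ← Real.exp_add]
      simp
    rw [h1, eLpNorm_const_smul, ← mul_assoc, Real.enorm_of_nonneg (Real.exp_pos _).le,
      ← ENNReal.ofReal_mul (Real.exp_pos _).le, ← Real.exp_add, hpH, Matrix.trace_transpose]
    congr 3
    ring_nf
  · have h1 : (fun ξ : EuclideanSpace ℝ (Fin d) => Complex.exp (Complex.I * ((inner ℝ x ξ : ℝ) : ℂ)))
        =ᵐ[volume] fun _ => 1 := by
      have h0 : ∀ᵐ ξ : EuclideanSpace ℝ (Fin d), ξ ≠ 0 := by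
        simp [ae_iff]
      filter_upwards [h, h0] with ξ hξ hξ0
      have h2 : ψ ξ ^ p ≠ 0 := (Real.rpow_pos_of_pos (hψ.pos ξ hξ0) p).ne'
      simpa [h2, sub_eq_zero] using hξ
    have h2 := (Continuous.ae_eq_iff_eq volume (by fun_prop) continuous_const).1 h1
    -- At ξ = πx/‖x‖² the exponential is -1, so it cannot be identically 1.
    have h3 := congrFun h2 ((Real.pi / ‖x‖ ^ 2) • x)
    have hx' : ‖x‖ ≠ 0 := norm_ne_zero_iff.2 hx
    simp only [real_inner_smul_right, real_inner_self_eq_norm_sq] at h3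
    rw [div_mul_cancel₀ _ (pow_ne_zero 2 hx'), mul_comm, Complex.exp_pi_mul_I] at h3
    norm_num at h3

end OperatorScaling

end

theorem theorem5p2 {d : ℕ} (E : Matrix (Fin d) (Fin d) ℝ) (a₁ aₚ : ℝ)
    (ha₁ : IsLeast (OperatorScaling.realSpectrum E) a₁) (ha₁_pos : 0 < a₁)
    (haₚ : IsGreatest (OperatorScaling.realSpectrum E) aₚ)
    (K : Set (EuclideanSpace ℝ (Fin d))) (hK : IsCompact K) (hK_pos : 0 < volume K)
    {Ω : Type*} [MeasurableSpace Ω] (P : Measure Ω) [IsProbabilityMeasure P]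
    (κ : ℝ) (hκ : 0 < κ) (H : ℝ) (hH : 0 < H)
    (X : EuclideanSpace ℝ (Fin d) → Ω → ℝ)
    (hX_cont : ∀ᵐ ω ∂P, Continuous (fun x => X x ω)) :
    (∀ (N : Seminorm ℝ (EuclideanSpace ℝ (Fin d))) (β : ℝ) (φ : EuclideanSpace ℝ (Fin d) → ℝ)
        (Z : Set (EuclideanSpace ℝ (Fin d)) → Ω → ℝ),
      OperatorScaling.IsAdaptedNorm E N → 0 < β →
      OperatorScaling.IsHomogeneous E φ → OperatorScaling.IsAdmissible β E N φ →
      H < β → (d = 1 → H ≠ E.trace / 2) →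
      OperatorScaling.IsStableRandomMeasure 2 κ P Z →
      OperatorScaling.IsMovingAverageField 2 H E φ P Z X →
      ∀ᵐ ω ∂P,
        dimH (OperatorScaling.graphOver K (fun x => X x ω)) = ENNReal.ofReal (d + 1 - H / aₚ) ∧
        OperatorScaling.HasBoxDim (OperatorScaling.graphOver K (fun x => X x ω))
          (d + 1 - H / aₚ)) ∧
    (∀ (ψ : EuclideanSpace ℝ (Fin d) → ℝ) (W : Set (EuclideanSpace ℝ (Fin d)) → Ω → ℂ),
      OperatorScaling.IsContinuousPositive ψ → OperatorScaling.IsHomogeneous E.transpose ψ →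
      H < a₁ →
      OperatorScaling.IsStableRandomMeasure 2 κ P W →
      OperatorScaling.IsHarmonizableField 2 H E ψ P W X →
      ∀ᵐ ω ∂P,
        dimH (OperatorScaling.graphOver K (fun x => X x ω)) = ENNReal.ofReal (d + 1 - H / aₚ) ∧
        OperatorScaling.HasBoxDim (OperatorScaling.graphOver K (fun x => X x ω))
          (d + 1 - H / aₚ)) := by
  have ha₁p : a₁ ≤ aₚ := ha₁.2 haₚ.1
  have hc : 0 < √(2 * κ) := by positivity
  refine ⟨fun N β φ Z hN hβ hφh hφ hHβ hd hZ hX => ?_, fun ψ W hψ hψh hHa hW hX => ?_⟩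
  · have hHa : H < a₁ := hHβ.trans_le (hφ.le_of_isLeast ha₁ ha₁_pos hN hφh)
    -- For p = 0 the kernel would degenerate. If d ≥ 2, then q/2 ≥ d a₁/2 ≥ a₁ > H; only d = 1 needs
    -- the hypothesis.
    have hp : H - E.trace / 2 ≠ 0 := by
      have hd0 := OperatorScaling.pos_of_mem_realSpectrum ha₁.1
      rcases (show d = 1 ∨ 2 ≤ d by omega) with h1 | h2
      · exact sub_ne_zero.2 (hd h1)
      · have h3 := OperatorScaling.mul_le_trace (a := a₁) E fun b hb => ha₁.2 hb
        have h4 : (2 : ℝ) ≤ d := by exact_mod_cast h2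
        nlinarith
    obtain ⟨hst, hn⟩ := OperatorScaling.isVariogram_movingAverage ha₁ ha₁_pos hc
      hφ.toIsContinuousPositive hφh hp rfl fun x => (hX x).memLp_two
    refine OperatorScaling.ae_dim_graphOver_of_isVariogram ha₁ ha₁_pos haₚ hK hK_pos
      (fun x => (hX x).aemeasurable hZ) hX_cont hn hH (hHa.trans_le ha₁p) fun x y => ?_
    have h := (hX x).map_re_sub hκ hZ (hX y)
    rw [hst] at h
    exact h
  · choose Y hY hXY using hX
    obtain ⟨hst, hn⟩ := OperatorScaling.isVariogram_harmonizable ha₁ ha₁_pos hc hψ hψh rfl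
      fun x => (hY x).memLp_two
    refine OperatorScaling.ae_dim_graphOver_of_isVariogram ha₁ ha₁_pos haₚ hK hK_pos
      (fun x => (Complex.measurable_re.comp_aemeasurable ((hY x).aemeasurable hW)).congr
        (hXY x).symm) hX_cont hn hH (hHa.trans_le ha₁p) fun x y => ?_
    have h := (hY x).map_re_sub hκ hW (hY y)
    rw [hst] at h
    rw [← h]
    refine Measure.map_congr ?_
    filter_upwards [hXY x, hXY y] with ω h1 h2
    rw [h1, h2]
    rfl
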